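/- **Notation.** For $\nu,\mu\in\mathbb C$ and $x>0$, $x\ne 1$, let $$P_\nu^{-\mu}(x)=\frac{2^{-\nu}|1-x|^{\mu/2}}{(1+x)^{\mu/2-\nu}}\;\frac{1}{\Gamma(1+\mu)}F\Big(-\nu,\mu-\nu;1+\mu;\frac{x-1}{x+1}\Big),$$ the Ferrers function of the first kind for $0<x<1$ and the associated Legendre function of the first kind for $x>1$; here $F$ is the Gauss hypergeometric function and $F(a,b;c;t)/\Gamma(c)=\sum_{n\ge0}\frac{(a)_n(b)_n}{\Gamma(c+n)\,n!}t^n$ is understood as an entire function of $c$. $(a)_n=a(a+1)\cdots(a+n-1)$ is the Pochhammer symbol, $1/\Gamma$ is the entire reciprocal Gamma function, and $\mathbb N_0=\{0,1,2,\dots\}$. Let $\mathcal G_n$, $\widehat{\mathcal G}_n$ and, for $0<x<1$, $\mathfrak N^{\pm}_{n,\nu,\mu}(x)$ be the Maclaurin coefficients in (principal branches near $z=0$) $$(1-wz)^{\tau}\Big(1+\frac zw\Big)^{-\tau}(1+z^2)^{-\rho}=\sum_{n\ge0}\mathcal G_n(\tau,\rho,w)z^n,\qquad (1+wz)^{\tau}\Big(1+\frac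 zw\Big)^{-\tau}(1-z^2)^{-\rho}=\sum_{n\ge0}\widehat{\mathcal G}_n(\tau,\rho,w)z^n,$$ $$\frac{\big(1+x^{\pm1}\sqrt{1\pm z^2}\big)^{\nu}\big(1+\sqrt{1\pm z^2}\big)^{-\mu}}{2^{-\mu}\Big(1+\frac{z}{\sqrt{|x^{\mp2}-1|}}\Big)^{\nu}}=\sum_{n\ge0}\mathfrak N^{\pm}_{n,\nu,\mu}(x)z^n .$$ Infinite series are understood as limits of their partial sums (absolute convergence is not asserted). **Theorem.** Let $\mu,\nu\in\mathbb C$. Then the following two pairs of expansions hold; in each pair, each of two families of functions is expanded in the other. 1. For $0<x<1$, if $\operatorname{Re}\nu>-1$ or $\nu-\mu\in\mathbb N_0$, $$\frac{(1-x^2)^{\frac{\mu+\nu}4}P_{\frac{\mu-\nu-2}2}^{-\frac{\mu+\nu}2}(x)}{2^{\frac{3\mu-\nu}2}x^{\nu}\,\Gamma\big(\frac{\mu-\nu+1}2\big)}=\sum_{n=0}^\infty\frac{(\mu-\nu)_n\,\mathcal G_n\Big(-\nu,\mu,\sqrt{\tfrac{1-x}{1+x}}\Big)}{\sqrt\pi\,\big(\frac{1-x}{1+x}\big)^{-\nu/2}}\,P_\nu^{-\mu-n}\Big(\frac1x\Big),$$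 and for $0<x<1$ (with no condition on $\mu,\nu$), $$\frac{P_\nu^{-\mu}(1/x)}{\sqrt\pi}=\sum_{n=0}^\infty(\mu-\nu)_n\,\mathfrak N^-_{n,\nu,\mu}(x)\,\frac{(1-x^2)^{\frac{\mu-\nu+n}4}P_{\frac{\mu-\nu-2+n}2}^{-\frac{\mu+\nu+n}2}(x)}{2^{\frac{3\mu-\nu+n}2}\,\Gamma\big(\frac{\mu-\nu+n+1}2\big)} .$$ 2. For $x\in(2^{-1/2},1)$; also for $x=2^{-1/2}$ if $\operatorname{Re}\nu>-\frac52$; and for every $x\in(0,1)$ if $\nu-\mu\in\mathbb N_0$, $$\frac{P_\nu^{-\mu}(x)}{\sqrt\pi}=\sum_{n=0}^\infty(\mu-\nu)_n\,\mathfrak N^+_{n,\nu,\mu}(x)\,\frac{(1-x^2)^{\frac{\mu-\nu+n}4}P_{\frac{\mu-\nu+n-2}2}^{-\frac{\mu+\nu+n}2}(1/x)}{2^{\frac{3\mu-\nu+n}2}\,\Gamma\big(\frac{\mu-\nu+n+1}2\big)\,x^{\frac{\mu-\nu+n}2}},$$ and for $0<x<1$, $\operatorname{Re}\nu>-1$,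 $$\frac{(1-x^2)^{\frac{\mu+\nu}4}P_{\frac{\mu-\nu-2}2}^{-\frac{\mu+\nu}2}(1/x)}{2^{\frac{3\mu-\nu}2}x^{\frac{\mu-\nu}2}\,\Gamma\big(\frac{\mu-\nu+1}2\big)}=\sum_{n=0}^\infty\frac{(\mu-\nu)_n\,\widehat{\mathcal G}_n\Big(-\nu,\mu,\sqrt{\tfrac{1-x}{1+x}}\Big)}{\sqrt\pi\,\big(\frac{1-x}{1+x}\big)^{-\nu/2}}\,P_\nu^{-\mu-n}(x).$$ -/

import Mathlib

open Filter Topology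

noncomputable section

/-- The Pochhammer symbol `(a)ₙ = a (a+1) ⋯ (a+n-1)`. -/
def poch (a : ℂ) (n : ℕ) : ℂ := (ascPochhammer ℂ n).eval a

/-- The regularized Gauss hypergeometric series `F(a,b;c;t) / Γ(c)`, for `|t| < 1`.
It is entire in `a`, `b`, `c`: the term with `1/Γ(c+n)` vanishes when `c+n` is a pole of `Γ`
(Mathlib's `Complex.Gamma` is `0` there, and so is its inverse). -/
def regHyp (a b c t : ℂ) : ℂ :=
  ∑' n : ℕ, poch a n * poch b n / (Complex.Gamma (c + n) * (n.factorial : ℂ)) * t ^ n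

/-- `legendreP ν μ x` is `P_ν^{-μ}(x)` for `x > 0`, `x ≠ 1`: the Ferrers function of the first kind
of degree `ν` and order `-μ` if `0 < x < 1`, and the associated Legendre function of the first kind
if `x > 1`. -/
def legendreP (ν μ : ℂ) (x : ℝ) : ℂ :=
  (2 : ℂ) ^ (-ν) * ((|1 - x| : ℝ) : ℂ) ^ (μ / 2) / ((1 + x : ℝ) : ℂ) ^ (μ / 2 - ν)
    * regHyp (-ν) (μ - ν) (1 + μ) (((x - 1) / (x + 1) : ℝ) : ℂ)

/-- The `n`-th Maclaurin coefficient of a function analytic at `0`. -/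
def maclaurinCoeff (f : ℂ → ℂ) (n : ℕ) : ℂ := iteratedDeriv n f 0 / (n.factorial : ℂ)

/-- `𝒢ₙ(τ,ρ,w)`, with generating function `(1-wz)^τ (1+z/w)^{-τ} (1+z²)^{-ρ}`. -/
def calG (n : ℕ) (τ ρ w : ℂ) : ℂ :=
  maclaurinCoeff (fun z => (1 - w * z) ^ τ * (1 + z / w) ^ (-τ) * (1 + z ^ 2) ^ (-ρ)) n

/-- `𝒢̂ₙ(τ,ρ,η)`, with generating function `(1+ηζ)^τ (1+ζ/η)^{-τ} (1-ζ²)^{-ρ}`. -/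
def calGHat (n : ℕ) (τ ρ η : ℂ) : ℂ :=
  maclaurinCoeff (fun ζ => (1 + η * ζ) ^ τ * (1 + ζ / η) ^ (-τ) * (1 - ζ ^ 2) ^ (-ρ)) n

/-- `𝔑⁺_{n,ν,μ}(x)`, with generating function
`2^μ (1 + x √(1+z²))^ν (1 + √(1+z²))^{-μ} (1 + z/√|x⁻²-1|)^{-ν}`. -/
def frakNPlus (n : ℕ) (ν μ : ℂ) (x : ℝ) : ℂ :=
  maclaurinCoeff (fun z =>
    (1 + (x : ℂ) * (1 + z ^ 2) ^ (1 / 2 : ℂ)) ^ ν * (1 + (1 + z ^ 2) ^ (1 / 2 : ℂ)) ^ (-μ)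
      / ((2 : ℂ) ^ (-μ) * (1 + ((1 / √|(x ^ 2)⁻¹ - 1| : ℝ) : ℂ) * z) ^ ν)) n

/-- `𝔑⁻_{n,ν,μ}(x)`, with generating function
`2^μ (1 + x⁻¹ √(1-z²))^ν (1 + √(1-z²))^{-μ} (1 + z/√|x²-1|)^{-ν}`. -/
def frakNMinus (n : ℕ) (ν μ : ℂ) (x : ℝ) : ℂ :=
  maclaurinCoeff (fun z =>
    (1 + (x : ℂ)⁻¹ * (1 - z ^ 2) ^ (1 / 2 : ℂ)) ^ ν * (1 + (1 - z ^ 2) ^ (1 / 2 : ℂ)) ^ (-μ)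
      / ((2 : ℂ) ^ (-μ) * (1 + ((1 / √|x ^ 2 - 1| : ℝ) : ℂ) * z) ^ ν)) n

/-- The series `∑ₙ aₙ` converges to `s` in the ordinary sense (limit of the partial sums, possibly
not absolutely). -/
def SeriesTo (a : ℕ → ℂ) (s : ℂ) : Prop :=
  Tendsto (fun N : ℕ => ∑ n ∈ Finset.range N, a n) atTop (𝓝 s)

end

/-! Put q = (1-x)/(1+x). Up to elementary factors, (μ-ν)ₙ P_ν^{-μ-n} at x, resp. at 1/x, is
`eulerMoment t μ ν n` with t = q, resp. t = -q. The second family of Legendre functions, at 1/x,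
resp. at x, is likewise `quadraticMoment t μ ν n` with t = q, resp. t = -q. All four expansions are
therefore statements about these two sequences of moments.

For Re (μ-ν) > 0 and Re ν > -1 both are moments on (0,1), up to normalization: ∫ E(s) sⁿ ds with E =
s^(μ-ν-1) (1-s)^ν (1+ts)^ν, and ∫ Q(s) yⁿ ds with Q = s^(μ-ν-1) (1-s²)^ν (1-ts²)^(-μ) and y =
s(1-t)/(1-ts²). The second is Euler's integral after the substitution u = (1-s²)/(1-ts²). The
quotient Q/E = (1+s)^ν (1+ts)^(-ν) (1-ts²)^(-μ) is a power series in s. Conversely E/Q is a power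
series in y, because 1 - κy² = ((1+ts²)/(1-ts²))² for κ = -4t/(1-t)²; with w = 1 - √(1-κy²) and θ =
(1-t)/2 one finds E/Q = (1+y)^(-ν) (1-θw)^ν (1-w/2)^(-μ). Integrating termwise expands the zeroth
moment of each family in the moments of the other (`hasSum_eulerMoment`, `hasSum_quadraticMoment`).
Up to rescaling the variable and a constant factor, these two power series are the generating
functions of 𝒢, 𝒢̂ and 𝔑^±.

Termwise integration needs absolutely summable coefficients, hence restricted parameters. Normalized
by reciprocal Gamma values, every term and every sum is entire in (μ, ν), so the general case
follows by continuation along a complex line (`seriesTo_of_line`), provided that the series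
converges locally uniformly. Convergence is decided by the singularities of the generating function
on the unit circle against the size of the moments, which is n^(-Re ν-1) for both families:

- Q/E is singular at s = -1, with coefficients O(n^(-Re ν-1)). The terms are O(n^(-2 Re ν-2)) and
the coefficients alternate while the moments vary slowly, so pairing neighbours gives convergence
for Re ν > -1. - E/Q with |κ| < 1 is singular only at y = -1, with coefficients O(n^(Re ν-1)). The
terms are O(n^(-2)) for every ν. This covers t = -q, where κ = 1-x², and t = q with x > 1/√2, where
κ = 1-1/x². - E/Q with κ = -1 (x = 1/√2) has further branch points y = ±i, contributing coefficients
O(n^(-3/2)). The terms are O(n^(-Re ν-5/2) + n^(-2)), and pairing n with n+2 gives convergence for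
Re ν > -5/2.

If ν-μ = k is a natural number, then (μ-ν)ₙ = 0 for n > k, and the identity is one of finite sums.
It extends analytically in ν for the first kind of expansion and in t for the second. -/

noncomputable section

/-! ### Pochhammer symbols and their quotients by Gamma values -/

lemma poch_zero (a : ℂ) : poch a 0 = 1 := by simp [poch]

lemma poch_succ (a : ℂ) (n : ℕ) : poch a (n + 1) = poch a n * (a + n) :=
  ascPochhammer_succ_eval n a

lemma poch_add (a : ℂ) (n m : ℕ) : poch a (n + m) = poch a n * poch (a + n) m := by
  induction m with
  | zero => simp [poch_zero]
  | succ m ih => rw [← add_assoc, poch_succ, poch_succ, ih]; push_cast; ring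

lemma poch_succ_left (a : ℂ) (n : ℕ) : poch a (n + 1) = a * poch (a + 1) n := by
  rw [add_comm n 1, poch_add, poch_succ, poch_zero]; simp

lemma differentiable_poch (n : ℕ) : Differentiable ℂ (fun a => poch a n) :=
  (ascPochhammer ℂ n).differentiable

lemma Gamma_add_nat (a : ℂ) (ha : 0 < a.re) (n : ℕ) :
    Complex.Gamma (a + n) = poch a n * Complex.Gamma a := by
  induction n with
  | zero => simp [poch_zero]
  | succ n ih =>
    have h : a + n ≠ 0 := fun h => by
      have := congrArg Complex.re h
      simp at this
      have : (0 : ℝ) ≤ n := by positivity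
      linarith
    push_cast
    rw [← add_assoc, Complex.Gamma_add_one _ h, ih, poch_succ]; ring

lemma poch_neg_nat (k : ℕ) {n : ℕ} (h : k < n) : poch (-(k : ℂ)) n = 0 := by
  obtain ⟨m, rfl⟩ := Nat.exists_eq_add_of_lt h
  rw [show k + m + 1 = (k + 1) + m by ring, poch_add, poch_succ]; simp

/-- The quotient `(b)ₘ / Γ(c + m)`, an entire function of `b` and `c`. -/
def pochDivGamma (b c : ℂ) (m : ℕ) : ℂ := poch b m / Complex.Gamma (c + m)

/-- The coefficient `(α)ₘ / m!` of the binomial series of `(1 - z) ^ (-α)`. -/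
def binCoeff (α : ℂ) (m : ℕ) : ℂ := poch α m / (m.factorial : ℂ)

lemma pochDivGamma_one (α : ℂ) (m : ℕ) : pochDivGamma α 1 m = binCoeff α m := by
  rw [pochDivGamma, binCoeff, add_comm (1 : ℂ), Complex.Gamma_nat_eq_factorial]

/-- True at the poles as well, since `Complex.Gamma` takes the value 0 there. The recurrences below
therefore need no nonvanishing hypotheses on c. -/
lemma inv_Gamma_eq (z : ℂ) : (Complex.Gamma z)⁻¹ = z * (Complex.Gamma (z + 1))⁻¹ := by
  simpa using Complex.one_div_Gamma_eq_self_mul_one_div_Gamma_add_one z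

lemma pochDivGamma_succ (b c : ℂ) (m : ℕ) :
    pochDivGamma b c (m + 1) * (c + m) = pochDivGamma b c m * (b + m) := by
  simp only [pochDivGamma, div_eq_mul_inv, poch_succ]
  rw [inv_Gamma_eq (c + m)]; push_cast; rw [add_assoc c]; ring

lemma pochDivGamma_eq_mul (b c : ℂ) (m : ℕ) :
    pochDivGamma b c m = pochDivGamma b (c + 1) m * (c + m) := by
  simp only [pochDivGamma, div_eq_mul_inv]
  rw [inv_Gamma_eq (c + m)]; rw [show c + m + 1 = c + 1 + m by ring]; ring

/-- Differencing in m is the same as raising c by one, which by the growth bound gains a factor 1/m.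
The slow variation of the Euler moments comes from here. -/
lemma pochDivGamma_sub_succ (b c : ℂ) (m : ℕ) :
    pochDivGamma b c m - pochDivGamma b c (m + 1) = (c - b) * pochDivGamma b (c + 1) m := by
  rw [pochDivGamma_eq_mul b c m]
  simp only [pochDivGamma, div_eq_mul_inv, poch_succ]
  push_cast
  rw [show c + (m + 1) = c + 1 + m by ring]; ring

lemma binCoeff_zero (α : ℂ) : binCoeff α 0 = 1 := by simp [binCoeff, poch_zero]

lemma binCoeff_succ_sub (α : ℂ) (m : ℕ) :
    binCoeff α (m + 1) - binCoeff α m = binCoeff (α - 1) (m + 1) := by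
  have h1 : ((m.factorial : ℕ) : ℂ) ≠ 0 := by exact_mod_cast m.factorial_ne_zero
  have h2 : ((m : ℂ) + 1) ≠ 0 := by exact_mod_cast m.succ_ne_zero
  simp only [binCoeff]
  rw [poch_succ_left (α - 1), poch_succ, sub_add_cancel, Nat.factorial_succ]
  push_cast
  field_simp
  ring

lemma differentiable_binCoeff (n : ℕ) : Differentiable ℂ (fun a => binCoeff a n) :=
  (differentiable_poch n).div_const _

lemma continuous_pochDivGamma (m : ℕ) : Continuous fun p : ℂ × ℂ => pochDivGamma p.1 p.2 m := by
  have h1 := (differentiable_poch m).continuous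
  have h2 := Complex.differentiable_one_div_Gamma.continuous
  simp only [pochDivGamma, div_eq_mul_inv]
  exact (h1.comp continuous_fst).mul (h2.comp (continuous_snd.add continuous_const))

/-! ### Growth -/

/-- The exponents σ/(m+1) sum to σ log m up to a bounded error, and C/(m+1)² is summable. Explicit
constants are kept so that the bound is uniform in parameters. -/
lemma norm_le_rpow_of_ratio {u : ℕ → ℂ} {σ C : ℝ} {m₀ : ℕ}
    (h : ∀ m ≥ m₀, ‖u (m + 1)‖ ≤ Real.exp (σ / (m + 1) + C / ((m : ℝ) + 1) ^ 2) * ‖u m‖)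
    (hC : 0 ≤ C) (m : ℕ) (hm : m₀ ≤ m) :
    ‖u m‖ ≤ ‖u m₀‖ * ((m₀ : ℝ) + 1) ^ (-σ) * Real.exp (2 * (|σ| + C)) * ((m : ℝ) + 1) ^ σ := by
  -- The bound is strengthened so that the induction closes: since 1/(m+1)² ≤ 2/(m+1) - 2/(m+2), the
  -- quadratic errors telescope in the exponent.
  have key : ∀ m ≥ m₀, ‖u m‖ ≤ ‖u m₀‖ * ((m₀ : ℝ) + 1) ^ (-σ) *
      Real.exp (2 * (|σ| + C) - 2 * (|σ| + C) / (m + 1)) * ((m : ℝ) + 1) ^ σ := by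
    intro m hm
    induction m, hm using Nat.le_induction with
    | base =>
      have hp : (0 : ℝ) < (m₀ : ℝ) + 1 := by positivity
      have : ((m₀ : ℝ) + 1) ^ (-σ) * ((m₀ : ℝ) + 1) ^ σ = 1 := by
        rw [← Real.rpow_add hp]; simp
      have h1 : 1 ≤ Real.exp (2 * (|σ| + C) - 2 * (|σ| + C) / (m₀ + 1)) := by
        apply Real.one_le_exp
        have h3 : 2 * (|σ| + C) / ((m₀ : ℝ) + 1) ≤ 2 * (|σ| + C) :=
          div_le_self (by positivity) (by simp)
        linarith
      calc ‖u m₀‖ = ‖u m₀‖ * (((m₀ : ℝ) + 1) ^ (-σ) * ((m₀ : ℝ) + 1) ^ σ) * 1 := by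
            rw [this]; ring
        _ ≤ ‖u m₀‖ * (((m₀ : ℝ) + 1) ^ (-σ) * ((m₀ : ℝ) + 1) ^ σ) *
              Real.exp (2 * (|σ| + C) - 2 * (|σ| + C) / (m₀ + 1)) := by gcongr
        _ = _ := by ring
    | succ m hm ih =>
      have hp : (0 : ℝ) < (m : ℝ) + 1 := by positivity
      have hp2 : (0 : ℝ) < (m : ℝ) + 2 := by positivity
      have e1 : ((m : ℝ) + 1) ^ σ = Real.exp (Real.log (m + 1) * σ) := Real.rpow_def_of_pos hp σ
      have e2 : (((m + 1 : ℕ) : ℝ) + 1) ^ σ = Real.exp (Real.log (m + 2) * σ) := by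
        rw [Real.rpow_def_of_pos (by positivity)]; push_cast; congr 3; ring
      refine (h m hm).trans ((mul_le_mul_of_nonneg_left ih (Real.exp_pos _).le).trans ?_)
      rw [e1, e2]
      set A := ‖u m₀‖ * ((m₀ : ℝ) + 1) ^ (-σ)
      have hA : 0 ≤ A := by positivity
      set y : ℝ := 1 / ((m : ℝ) + 1) with hy
      have hy0 : 0 < y := by positivity
      have hlog : Real.log (m + 2) = Real.log (m + 1) + Real.log (1 + y) := by
        rw [← Real.log_mul (by positivity) (by positivity)]
        congr 1; rw [hy]; field_simp; ring
      have l1 : Real.log (1 + y) ≤ y := by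
        have := Real.log_le_sub_one_of_pos (x := 1 + y) (by positivity); linarith
      have l2 : y - y ^ 2 ≤ Real.log (1 + y) := by
        have := Real.one_sub_inv_le_log_of_pos (x := 1 + y) (by positivity)
        refine le_trans ?_ this
        have : 1 - (1 + y)⁻¹ = y / (1 + y) := by field_simp; ring
        rw [this, le_div_iff₀ (by positivity)]; nlinarith [pow_pos hy0 3]
      have l3 : σ * y - σ * Real.log (1 + y) ≤ |σ| * y ^ 2 := by
        have : |σ * (y - Real.log (1 + y))| ≤ |σ| * y ^ 2 := by
          rw [abs_mul]; gcongr; rw [abs_le]; constructor <;> nlinarith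
        have := (abs_le.1 this).2; linarith
      have l4 : y ^ 2 ≤ 2 * y - 2 / ((m : ℝ) + 2) := by
        have : 2 * y - 2 / ((m : ℝ) + 2) - y ^ 2 = m * y ^ 2 / (m + 2) := by
          rw [hy]; field_simp; ring
        have h0 : 0 ≤ m * y ^ 2 / ((m : ℝ) + 2) := by positivity
        linarith
      have l5 : (|σ| + C) * y ^ 2 ≤ (|σ| + C) * (2 * y - 2 / ((m : ℝ) + 2)) := by gcongr
      have : Real.exp (σ / (m + 1) + C / ((m : ℝ) + 1) ^ 2) *
          (A * Real.exp (2 * (|σ| + C) - 2 * (|σ| + C) / (m + 1)) * Real.exp (Real.log (m + 1) * σ))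
          = A * Real.exp (σ * y + C * y ^ 2 + (2 * (|σ| + C) - 2 * (|σ| + C) * y)
            + Real.log (m + 1) * σ) := by
        rw [show A * Real.exp (2 * (|σ| + C) - 2 * (|σ| + C) / (m + 1)) *
            Real.exp (Real.log (m + 1) * σ) = A * (Real.exp (2 * (|σ| + C) - 2 * (|σ| + C) / (m + 1)) *
            Real.exp (Real.log (m + 1) * σ)) by ring, mul_left_comm, ← Real.exp_add, ← Real.exp_add]
        congr 2
        rw [hy, div_pow, one_pow]; simp only [div_eq_mul_inv, one_mul]; ring_nf
      rw [this, mul_assoc A, ← Real.exp_add]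
      refine mul_le_mul_of_nonneg_left (Real.exp_le_exp.2 ?_) hA
      rw [hlog]; push_cast
      rw [show (m : ℝ) + 1 + 1 = m + 2 by ring]
      have : 2 * (|σ| + C) / ((m : ℝ) + 2) = (|σ| + C) * (2 / ((m : ℝ) + 2)) := by ring
      rw [this]
      nlinarith
  refine (key m hm).trans ?_
  gcongr
  have : 0 ≤ 2 * (|σ| + C) / ((m : ℝ) + 1) := by positivity
  linarith

lemma norm_one_add_le_exp (z : ℂ) : ‖1 + z‖ ≤ Real.exp (z.re + ‖z‖ ^ 2) := by
  have h1 : ‖1 + z‖ ^ 2 = 1 + 2 * z.re + ‖z‖ ^ 2 := by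
    rw [Complex.sq_norm, Complex.sq_norm, Complex.normSq_apply, Complex.normSq_apply]; simp; ring
  have h2 : 1 + 2 * z.re + ‖z‖ ^ 2 ≤ Real.exp (z.re + ‖z‖ ^ 2) ^ 2 := by
    rw [← Real.exp_nat_mul]
    have := Real.add_one_le_exp (((2 : ℕ) : ℝ) * (z.re + ‖z‖ ^ 2))
    push_cast at *
    nlinarith [sq_nonneg ‖z‖]
  exact (abs_le_of_sq_le_sq' (h1.trans_le h2) (Real.exp_pos _).le).2

/-- The ratio bound behind all Gamma quotient asymptotics. -/
lemma norm_ratio_le {b c : ℂ} {R : ℝ} (hb : ‖b‖ ≤ R) (hc : ‖c‖ ≤ R) {m : ℕ}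
    (hm : 4 * R + 1 ≤ m) :
    c + m ≠ 0 ∧ ‖(b + m) / (c + m)‖ ≤
      Real.exp ((b - c).re / (m + 1) + (8 * R * (1 + R) + 64 * R ^ 2) / ((m : ℝ) + 1) ^ 2) := by
  have hR : 0 ≤ R := (norm_nonneg _).trans hb
  have hp : (0 : ℝ) < (m : ℝ) + 1 := by positivity
  have hcm : ((m : ℝ) + 1) / 4 ≤ ‖c + m‖ := by
    have : ‖(m : ℂ)‖ - ‖c‖ ≤ ‖c + m‖ := by
      have := norm_sub_norm_le (m : ℂ) (-c)
      rw [norm_neg, sub_neg_eq_add, add_comm (m : ℂ)] at this; exact this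
    rw [Complex.norm_natCast] at this
    linarith
  have hcm0 : c + m ≠ 0 := by
    intro h; rw [h, norm_zero] at hcm; linarith
  refine ⟨hcm0, ?_⟩
  set z := (b - c) / (c + m) with hz
  have hz1 : (b + m) / (c + m) = 1 + z := by rw [hz]; field_simp; ring
  have hbc : ‖b - c‖ ≤ 2 * R := (norm_sub_le _ _).trans (by linarith)
  have hzn : ‖z‖ ≤ 8 * R / (m + 1) := by
    rw [hz, norm_div, div_le_div_iff₀ (by linarith) hp]
    nlinarith [norm_nonneg (b - c)]
  have hre : z.re ≤ (b - c).re / (m + 1) + 8 * R * (1 + R) / ((m : ℝ) + 1) ^ 2 := by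
    have hm1 : (m : ℂ) + 1 ≠ 0 := by exact_mod_cast hp.ne'
    have e : z = (b - c) / ((m : ℝ) + 1 : ℝ) + z * (1 - c) / (m + 1) := by
      rw [hz]; push_cast; field_simp; ring
    have h2 : (z * (1 - c) / (m + 1)).re ≤ 8 * R * (1 + R) / ((m : ℝ) + 1) ^ 2 := by
      refine (Complex.re_le_norm _).trans ?_
      rw [norm_div, norm_mul]
      have : ‖(m : ℂ) + 1‖ = m + 1 := by
        rw [← Nat.cast_succ, Complex.norm_natCast]; simp
      rw [this]
      have h1c : ‖1 - c‖ ≤ 1 + R := (norm_sub_le _ _).trans (by simpa using hc)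
      calc ‖z‖ * ‖1 - c‖ / ((m : ℝ) + 1) ≤ 8 * R / (m + 1) * (1 + R) / (m + 1) := by gcongr
        _ = _ := by field_simp
    rw [e, Complex.add_re, Complex.div_ofReal_re]
    linarith
  rw [hz1]
  refine (norm_one_add_le_exp z).trans (Real.exp_le_exp.2 ?_)
  have hz2 : ‖z‖ ^ 2 ≤ 64 * R ^ 2 / ((m : ℝ) + 1) ^ 2 := by
    calc ‖z‖ ^ 2 ≤ (8 * R / (m + 1)) ^ 2 := by gcongr
      _ = _ := by field_simp; ring
  rw [add_div]; linarith

/-- For large m the ratio of successive terms is 1 + (b-c)/m + O(1/m²), with constants depending on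
R only. The finitely many small m are handled by compactness, the quotient being continuous in (b,
c) even where Γ has poles. Uniformity over the ball is what yields locally uniform convergence
later. -/
theorem exists_norm_pochDivGamma_le (R : ℝ) : ∃ C : ℝ, 0 < C ∧ ∀ b c : ℂ, ‖b‖ ≤ R → ‖c‖ ≤ R →
    ∀ m : ℕ, ‖pochDivGamma b c m‖ ≤ C * ((m : ℝ) + 1) ^ (b - c).re := by
  set m₀ : ℕ := ⌈4 * R + 1⌉₊
  set K := 8 * |R| * (1 + |R|) + 64 * |R| ^ 2
  have hK : 0 ≤ K := by positivity
  have hcpt : IsCompact (Metric.closedBall (0 : ℂ) R ×ˢ Metric.closedBall (0 : ℂ) R) :=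
    (isCompact_closedBall _ _).prod (isCompact_closedBall _ _)
  choose B hB using fun m => hcpt.exists_bound_of_continuousOn (continuous_pochDivGamma m).continuousOn
  set B' := ∑ m ∈ Finset.range (m₀ + 1), |B m|
  have hB' : ∀ b c : ℂ, ‖b‖ ≤ R → ‖c‖ ≤ R → ∀ m ≤ m₀, ‖pochDivGamma b c m‖ ≤ B' := by
    intro b c hb hc m hm
    refine ((hB m (b, c) ⟨by simpa using hb, by simpa using hc⟩).trans (le_abs_self _)).trans ?_
    exact Finset.single_le_sum (f := fun m => |B m|) (fun _ _ => abs_nonneg _)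
      (Finset.mem_range.2 (by omega))
  have hB0 : 0 ≤ B' := Finset.sum_nonneg fun _ _ => abs_nonneg _
  set C := (B' + 1) * ((m₀ : ℝ) + 1) ^ (2 * |R|) * Real.exp (2 * (2 * |R| + K))
  refine ⟨C, by positivity, fun b c hb hc m => ?_⟩
  have hR : 0 ≤ R := (norm_nonneg _).trans hb
  have hRabs : |R| = R := abs_of_nonneg hR
  have hσ : |(b - c).re| ≤ 2 * |R| :=
    (Complex.abs_re_le_norm _).trans ((norm_sub_le _ _).trans (by rw [hRabs]; linarith))
  have hm1 : (1 : ℝ) ≤ (m₀ : ℝ) + 1 := by simp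
  have hpow : ((m₀ : ℝ) + 1) ^ (-(b - c).re) ≤ ((m₀ : ℝ) + 1) ^ (2 * |R|) :=
    Real.rpow_le_rpow_of_exponent_le hm1 (by linarith [neg_abs_le (b - c).re])
  rcases le_total m m₀ with h | h
  · have h1 : 1 ≤ ((m₀ : ℝ) + 1) ^ (2 * |R|) * ((m : ℝ) + 1) ^ (b - c).re := by
      have hp : (0 : ℝ) < (m : ℝ) + 1 := by positivity
      calc (1 : ℝ) = ((m : ℝ) + 1) ^ (2 * |R|) * ((m : ℝ) + 1) ^ (-(2 * |R|)) := by
            rw [← Real.rpow_add hp]; simp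
        _ ≤ _ := by
            gcongr
            · simp
            · linarith [neg_abs_le (b - c).re]
    have h2 : 1 ≤ Real.exp (2 * (2 * |R| + K)) := Real.one_le_exp (by positivity)
    calc _ ≤ B' + 1 := (hB' b c hb hc m h).trans (by simp)
      _ = (B' + 1) * 1 * 1 := by ring
      _ ≤ (B' + 1) * (((m₀ : ℝ) + 1) ^ (2 * |R|) * ((m : ℝ) + 1) ^ (b - c).re) *
          Real.exp (2 * (2 * |R| + K)) := by gcongr
      _ = _ := by simp only [C]; ring
  · have hr : ∀ m ≥ m₀, ‖pochDivGamma b c (m + 1)‖ ≤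
        Real.exp ((b - c).re / (m + 1) + K / ((m : ℝ) + 1) ^ 2) * ‖pochDivGamma b c m‖ := by
      intro m hm
      have hm' : 4 * R + 1 ≤ m := (Nat.le_ceil _).trans (by exact_mod_cast hm)
      obtain ⟨h0, h1⟩ := norm_ratio_le hb hc hm'
      have e : pochDivGamma b c (m + 1) = (b + m) / (c + m) * pochDivGamma b c m := by
        rw [div_mul_eq_mul_div, eq_div_iff h0, pochDivGamma_succ]; ring
      rw [e, norm_mul]
      simp only [K, hRabs]
      gcongr
    refine (norm_le_rpow_of_ratio hr hK m h).trans ?_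
    have := hB' b c hb hc m₀ le_rfl
    simp only [C]
    gcongr
    linarith

end

/-! ### Formal power series and the functions they represent on a disc. -/

noncomputable section

open PowerSeries in
/-- `φ` converges absolutely to `f` on the disc of radius `r`. -/
def Represents (φ : PowerSeries ℂ) (f : ℂ → ℂ) (r : ℝ) : Prop :=
  ∀ z : ℂ, ‖z‖ < r → Summable (fun n => ‖coeff n φ * z ^ n‖) ∧
    HasSum (fun n => coeff n φ * z ^ n) (f z)

namespace Represents
open PowerSeries

variable {φ ψ : PowerSeries ℂ} {f g : ℂ → ℂ} {r : ℝ}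

lemma congr (h : Represents φ f r) (hfg : ∀ z, ‖z‖ < r → f z = g z) : Represents φ g r :=
  fun z hz => by rw [← hfg z hz]; exact h z hz

lemma mul (hf : Represents φ f r) (hg : Represents ψ g r) :
    Represents (φ * ψ) (fun z => f z * g z) r := by
  intro z hz
  obtain ⟨f1, f2⟩ := hf z hz
  obtain ⟨g1, g2⟩ := hg z hz
  have e : (fun n => coeff n (φ * ψ) * z ^ n) = fun n =>
      ∑ kl ∈ Finset.HasAntidiagonal.antidiagonal n, coeff kl.1 φ * z ^ kl.1 * (coeff kl.2 ψ * z ^ kl.2) := by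
    funext n
    rw [coeff_mul, Finset.sum_mul]
    refine Finset.sum_congr rfl fun kl hkl => ?_
    rw [← Finset.HasAntidiagonal.mem_antidiagonal.1 hkl, pow_add]; ring
  have hs := summable_norm_sum_mul_antidiagonal_of_summable_norm f1 g1
  have hs' : Summable fun n => ‖coeff n (φ * ψ) * z ^ n‖ := by
    exact hs.congr fun n => by rw [← congrFun e n]
  refine ⟨hs', ?_⟩
  have := tsum_mul_tsum_eq_tsum_sum_antidiagonal_of_summable_norm f1 g1
  rw [f2.tsum_eq, g2.tsum_eq, ← e] at this
  simp only [this]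
  exact hs'.of_norm.hasSum

lemma one : Represents 1 (fun _ => 1) r := by
  intro z _
  have : (fun n => coeff n (1 : PowerSeries ℂ) * z ^ n) = fun n => if n = 0 then 1 else 0 := by
    funext n; rw [coeff_one]; split_ifs with h <;> simp [h]
  constructor
  · apply summable_of_ne_finset_zero (s := {0})
    intro n hn
    rw [congrFun this n]; simp at hn; simp [hn]
  · rw [this]; exact hasSum_ite_eq 0 1

lemma pow (hf : Represents φ f r) (k : ℕ) : Represents (φ ^ k) (fun z => f z ^ k) r := by
  induction k with
  | zero => simpa using one
  | succ k ih => simpa only [pow_succ] using ih.mul hf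

lemma rescale (hf : Represents φ f r) (c : ℂ) {s : ℝ} (hs : ‖c‖ * s ≤ r) (hr : 0 < r) :
    Represents (PowerSeries.rescale c φ) (fun z => f (c * z)) s := by
  intro z hz
  have hcz : ‖c * z‖ < r := by
    rw [norm_mul]
    rcases (norm_nonneg c).eq_or_lt with h | h
    · rw [← h]; simpa using hr
    · exact (mul_lt_mul_of_pos_left hz h).trans_le hs
  have e : ∀ n, coeff n (PowerSeries.rescale c φ) * z ^ n = coeff n φ * (c * z) ^ n := by
    intro n; rw [coeff_rescale, mul_pow]; ring
  simp only [e]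
  exact hf _ hcz

/-- Uniqueness of Taylor coefficients: the bridge from generating functions, whose coefficients are
defined by derivatives, to explicit formal series. -/
lemma maclaurinCoeff_eq (hf : Represents φ f r) (hr : 0 < r) (n : ℕ) :
    maclaurinCoeff f n = coeff n φ := by
  have hp : HasFPowerSeriesOnBall f (FormalMultilinearSeries.ofScalars ℂ fun n => coeff n φ) 0
      (ENNReal.ofReal r) := by
    refine ⟨?_, by simpa using hr, ?_⟩
    · refine le_of_forall_lt fun s hs => ?_
      lift s to NNReal using ne_top_of_lt hs
      obtain ⟨s', h1, h2⟩ := ENNReal.lt_iff_exists_nnreal_btwn.1 hs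
      refine lt_of_lt_of_le h1 ?_
      refine FormalMultilinearSeries.le_radius_of_summable _ ?_
      have h3 : ‖((s' : ℝ) : ℂ)‖ < r := by
        rw [Complex.norm_real, NNReal.norm_eq]
        rwa [ENNReal.ofReal, ENNReal.coe_lt_coe, ← NNReal.coe_lt_coe, Real.coe_toNNReal _ hr.le] at h2
      refine (hf _ h3).1.congr fun n => ?_
      rw [FormalMultilinearSeries.ofScalars_norm, norm_mul, norm_pow, Complex.norm_real,
        NNReal.norm_eq]
    · intro y hy
      have hy' : ‖y‖ < r := by
        rw [Metric.eball_ofReal] at hy; simpa using hy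
      simpa [FormalMultilinearSeries.ofScalars_apply_eq, mul_comm] using (hf y hy').2
  have h := hp.factorial_smul 1 n
  rw [← iteratedDeriv_eq_iteratedFDeriv] at h
  rw [maclaurinCoeff, ← h, FormalMultilinearSeries.ofScalars_apply_eq]
  have : ((n.factorial : ℕ) : ℂ) ≠ 0 := by exact_mod_cast n.factorial_ne_zero
  simp
  field_simp

end Represents

/-! ### Binomial series and the substitution of κX². -/

open PowerSeries

/-- The binomial series of `(1 - z) ^ (-α)`. -/
def binSeries (α : ℂ) : PowerSeries ℂ := PowerSeries.mk (binCoeff α)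

lemma represents_binSeries (α : ℂ) : Represents (binSeries α) (fun z => (1 - z) ^ (-α)) 1 := by
  intro z hz
  have hp := Complex.one_div_one_sub_cpow_hasFPowerSeriesOnBall_zero α
  have hc : ∀ n : ℕ, Ring.choose (α + n - 1) n = binCoeff α n := by
    intro n
    have hn : ((n.factorial : ℕ) : ℂ) ≠ 0 := by exact_mod_cast n.factorial_ne_zero
    rw [binCoeff, eq_div_iff hn, mul_comm, ← nsmul_eq_mul,
      ← Ring.descPochhammer_eq_factorial_smul_choose, Polynomial.descPochhammer_smeval_eq_ascPochhammer,
      Polynomial.ascPochhammer_smeval_eq_eval, poch]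
    congr 1; ring
  have hz' : z ∈ Metric.eball (0 : ℂ) 1 := by
    rw [← ENNReal.ofReal_one, Metric.eball_ofReal]; simpa using hz
  have h1 := hp.hasSum hz'
  simp only [FormalMultilinearSeries.ofScalars_apply_eq, hc, zero_add, smul_eq_mul] at h1
  have h2 := FormalMultilinearSeries.summable_norm_apply _
    (show z ∈ Metric.eball (0 : ℂ) _ from Metric.eball_subset_eball hp.r_le hz')
  simp only [FormalMultilinearSeries.ofScalars_apply_eq, hc, smul_eq_mul] at h2
  simp only [binSeries, coeff_mk]
  exact ⟨h2, by rw [Complex.cpow_neg, ← one_div]; exact h1⟩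

/-- The series `φ (κ X ^ 2)`. -/
def evenLift (κ : ℂ) (φ : PowerSeries ℂ) : PowerSeries ℂ :=
  PowerSeries.mk fun n => if Even n then κ ^ (n / 2) * coeff (n / 2) φ else 0

lemma coeff_evenLift_two_mul (κ : ℂ) (φ : PowerSeries ℂ) (m : ℕ) :
    coeff (2 * m) (evenLift κ φ) = κ ^ m * coeff m φ := by
  simp [evenLift]

lemma coeff_evenLift_of_not_even (κ : ℂ) (φ : PowerSeries ℂ) {n : ℕ} (hn : ¬ Even n) :
    coeff n (evenLift κ φ) = 0 := by
  simp [evenLift, hn]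

lemma Represents.evenLift {φ : PowerSeries ℂ} {f : ℂ → ℂ} {r s : ℝ} (hf : Represents φ f r)
    (κ : ℂ) (hs : ∀ z : ℂ, ‖z‖ < s → ‖κ * z ^ 2‖ < r) :
    Represents (evenLift κ φ) (fun z => f (κ * z ^ 2)) s := by
  intro z hz
  obtain ⟨h1, h2⟩ := hf _ (hs z hz)
  have hinj : Function.Injective fun m : ℕ => 2 * m := fun a b h => by simpa using h
  have e : ∀ m, coeff (2 * m) (_root_.evenLift κ φ) * z ^ (2 * m) = coeff m φ * (κ * z ^ 2) ^ m := by
    intro m; rw [coeff_evenLift_two_mul, mul_pow, pow_mul]; ring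
  have h0 : ∀ n ∉ Set.range fun m : ℕ => 2 * m, coeff n (_root_.evenLift κ φ) * z ^ n = 0 := by
    intro n hn
    rw [coeff_evenLift_of_not_even, zero_mul]
    rintro ⟨m, rfl⟩
    exact hn ⟨m, by simp; ring⟩
  constructor
  · rw [← hinj.summable_iff (fun n hn => by rw [h0 n hn, norm_zero])]
    refine h1.congr fun m => ?_
    simp only [Function.comp]; rw [e]
  · rw [← hinj.hasSum_iff h0]
    convert h2 using 1
    funext m; simp only [Function.comp]; rw [e]

/-- Multiplication by 1 - κX² after the lift is multiplication by 1 - X before it, so a singularity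
at 1 is damped together with both of its preimages. -/
lemma one_sub_mul_evenLift (κ : ℂ) (φ : PowerSeries ℂ) (n : ℕ) :
    coeff (n + 2) (evenLift κ φ) - κ * coeff n (evenLift κ φ) =
      coeff (n + 2) (evenLift κ ((1 - X) * φ)) := by
  rcases Nat.even_or_odd n with h | h
  · obtain ⟨m, rfl⟩ := h
    rw [show m + m + 2 = 2 * (m + 1) by ring, show m + m = 2 * m by ring]
    simp only [coeff_evenLift_two_mul, sub_mul, one_mul, map_sub, coeff_succ_X_mul, pow_succ]
    ring
  · have h1 : ¬ Even n := Nat.not_even_iff_odd.2 h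
    have h2 : ¬ Even (n + 2) := by rw [Nat.even_add]; simp [h1]
    simp [coeff_evenLift_of_not_even _ _ h1, coeff_evenLift_of_not_even _ _ h2]

/-! ### Polynomial growth of coefficients -/

/-- The coefficients of `φ` are at most `C (n + 1) ^ α`. -/
def CoeffBound (φ : PowerSeries ℂ) (C α : ℝ) : Prop :=
  ∀ n : ℕ, ‖coeff n φ‖ ≤ C * ((n : ℝ) + 1) ^ α

lemma CoeffBound.nonneg {φ : PowerSeries ℂ} {C α : ℝ} (h : CoeffBound φ C α) : 0 ≤ C := by
  simpa using (norm_nonneg _).trans (h 0)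

lemma CoeffBound.mono {φ : PowerSeries ℂ} {C α C' α' : ℝ} (h : CoeffBound φ C α) (hC : C ≤ C')
    (hα : α ≤ α') : CoeffBound φ C' α' := by
  intro n
  refine (h n).trans ?_
  have := h.nonneg.trans hC
  gcongr
  simp

lemma exists_pow_le_rpow {ρ : ℝ} (h0 : 0 ≤ ρ) (h1 : ρ < 1) (τ : ℝ) :
    ∃ C : ℝ, 0 < C ∧ ∀ m : ℕ, ρ ^ m ≤ C * ((m : ℝ) + 1) ^ τ := by
  set k : ℕ := ⌈|τ|⌉₊
  have h := (summable_pow_mul_geometric_of_norm_lt_one k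
    (r := ρ) (by rwa [Real.norm_of_nonneg h0])).tendsto_atTop_zero
  obtain ⟨B, hB⟩ := h.bddAbove_range
  refine ⟨2 ^ k * (|B| + 1), by positivity, fun m => ?_⟩
  have hB' : (m : ℝ) ^ k * ρ ^ m ≤ |B| := (hB ⟨m, rfl⟩).trans (le_abs_self _)
  have hp : (0 : ℝ) < (m : ℝ) + 1 := by positivity
  have hk : (((m : ℝ) + 1) ^ k)⁻¹ ≤ ((m : ℝ) + 1) ^ τ := by
    rw [← Real.rpow_natCast, ← Real.rpow_neg hp.le]
    apply Real.rpow_le_rpow_of_exponent_le (by simp)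
    have : |τ| ≤ k := Nat.le_ceil _
    linarith [neg_abs_le τ]
  have hmk : ((m : ℝ) + 1) ^ k * ρ ^ m ≤ 2 ^ k * (|B| + 1) := by
    rcases Nat.eq_zero_or_pos m with rfl | hm
    · simp
      calc (1 : ℝ) = 1 * 1 := by ring
        _ ≤ 2 ^ k * (|B| + 1) := by
          gcongr
          · exact one_le_pow₀ (by norm_num)
          · simp
    · have hm' : (1 : ℝ) ≤ m := by exact_mod_cast hm
      calc ((m : ℝ) + 1) ^ k * ρ ^ m ≤ (2 * m) ^ k * ρ ^ m := by gcongr; linarith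
        _ = 2 ^ k * (m ^ k * ρ ^ m) := by rw [mul_pow]; ring
        _ ≤ 2 ^ k * (|B| + 1) := by gcongr; linarith
  calc ρ ^ m = ((m : ℝ) + 1) ^ k * ρ ^ m * (((m : ℝ) + 1) ^ k)⁻¹ := by field_simp
    _ ≤ _ := by gcongr

lemma summable_add_one_rpow {α : ℝ} (hα : α < -1) : Summable fun n : ℕ => ((n : ℝ) + 1) ^ α := by
  have := (summable_nat_add_iff 1).2 (Real.summable_nat_rpow.2 hα)
  simpa using this

/-- In each term of the Cauchy product one index is at least n/2. If it belongs to ψ, it gives n^β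
and the other factor is summable because α < -1; if it belongs to φ, it gives n^α. The constant is
uniform for |β| ≤ B, since β will depend on ν. -/
lemma exists_coeffBound_mul {α : ℝ} (hα : α < -1) (B : ℝ) : ∃ K : ℝ, 0 < K ∧
    ∀ β : ℝ, |β| ≤ B → ∀ (φ ψ : PowerSeries ℂ) (A A' : ℝ), CoeffBound φ A α → CoeffBound ψ A' β →
      CoeffBound (φ * ψ) (K * (A * A')) (max α β) := by
  set Z := ∑' n : ℕ, ((n : ℝ) + 1) ^ α
  have hs := summable_add_one_rpow hα
  have hZ : 0 ≤ Z := tsum_nonneg fun n => by positivity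
  set D : ℝ := 2 ^ (|α| + |B|) with hD
  refine ⟨2 * D * Z + 1, by positivity, fun β hβ φ ψ A A' hφ hψ n => ?_⟩
  have hA := hφ.nonneg
  have hA' := hψ.nonneg
  have hn : (1 : ℝ) ≤ (n : ℝ) + 1 := by simp
  have half : ∀ (j : ℕ) (γ : ℝ), |γ| ≤ |α| + |B| → j ≤ n → n ≤ 2 * j →
      ((j : ℝ) + 1) ^ γ ≤ D * ((n : ℝ) + 1) ^ γ := by
    intro j γ hγ h1 h2
    have hj : (0 : ℝ) < (j : ℝ) + 1 := by positivity
    rcases le_total 0 γ with h | h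
    · calc ((j : ℝ) + 1) ^ γ ≤ ((n : ℝ) + 1) ^ γ := by gcongr
        _ = 1 * ((n : ℝ) + 1) ^ γ := by ring
        _ ≤ _ := by
          gcongr
          exact Real.one_le_rpow (by norm_num) (by positivity)
    · calc ((j : ℝ) + 1) ^ γ ≤ (((n : ℝ) + 1) / 2) ^ γ := by
            apply Real.rpow_le_rpow_of_nonpos (by positivity) _ h
            have : (n : ℝ) ≤ 2 * j := by exact_mod_cast h2
            linarith
        _ = 2 ^ (-γ) * ((n : ℝ) + 1) ^ γ := by
            rw [Real.div_rpow (by positivity) (by norm_num), Real.rpow_neg (by norm_num)]; ring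
        _ ≤ _ := by
            gcongr
            rw [hD]
            apply Real.rpow_le_rpow_of_exponent_le (by norm_num)
            exact (neg_le_abs γ).trans hγ
  have term : ∀ j m : ℕ, j + m = n → ((j : ℝ) + 1) ^ α * ((m : ℝ) + 1) ^ β ≤
      D * ((n : ℝ) + 1) ^ (max α β) * (((j : ℝ) + 1) ^ α + ((m : ℝ) + 1) ^ α) := by
    intro j m hjm
    rcases le_total j m with h | h
    · calc ((j : ℝ) + 1) ^ α * ((m : ℝ) + 1) ^ β
          ≤ ((j : ℝ) + 1) ^ α * (D * ((n : ℝ) + 1) ^ (max α β)) := by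
            gcongr
            refine (half m β ?_ (by omega) (by omega)).trans ?_
            · exact hβ.trans ((le_abs_self B).trans (by simp))
            · gcongr
              exact le_max_right _ _
        _ = D * ((n : ℝ) + 1) ^ (max α β) * (((j : ℝ) + 1) ^ α) := by ring
        _ ≤ _ := by
          gcongr
          have : 0 ≤ ((m : ℝ) + 1) ^ α := by positivity
          linarith
    -- Here the large index j gives n^α. The excess m^(β-α) is at most n^(max α β - α), which leaves
    -- the summable factor m^α.
    · have hm : (0 : ℝ) < (m : ℝ) + 1 := by positivity
      calc ((j : ℝ) + 1) ^ α * ((m : ℝ) + 1) ^ β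
          = ((j : ℝ) + 1) ^ α * (((m : ℝ) + 1) ^ (β - α) * ((m : ℝ) + 1) ^ α) := by
            rw [← Real.rpow_add hm]; simp
        _ ≤ (D * ((n : ℝ) + 1) ^ α) * (((n : ℝ) + 1) ^ (max α β - α) * ((m : ℝ) + 1) ^ α) := by
            gcongr
            · exact half j α (by simp) (by omega) (by omega)
            · calc ((m : ℝ) + 1) ^ (β - α) ≤ ((m : ℝ) + 1) ^ (max α β - α) := by
                    apply Real.rpow_le_rpow_of_exponent_le (by simp)
                    linarith [le_max_right α β]
                _ ≤ _ := by
                    apply Real.rpow_le_rpow hm.le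
                    · have : m ≤ n := by omega
                      have : (m : ℝ) ≤ n := by exact_mod_cast this
                      linarith
                    · linarith [le_max_left α β]
        _ = D * ((n : ℝ) + 1) ^ (max α β) * (((m : ℝ) + 1) ^ α) := by
            have : ((n : ℝ) + 1) ^ (max α β) = ((n : ℝ) + 1) ^ α * ((n : ℝ) + 1) ^ (max α β - α) := by
              rw [← Real.rpow_add (by positivity)]; simp
            rw [this]; ring
        _ ≤ _ := by
          gcongr
          have : 0 ≤ ((j : ℝ) + 1) ^ α := by positivity
          linarith
  have hsum1 : ∑ p ∈ Finset.HasAntidiagonal.antidiagonal n, ((p.1 : ℝ) + 1) ^ α ≤ Z := by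
    rw [Finset.Nat.sum_antidiagonal_eq_sum_range_succ_mk]
    exact hs.sum_le_tsum _ fun _ _ => by positivity
  have hsum2 : ∑ p ∈ Finset.HasAntidiagonal.antidiagonal n, ((p.2 : ℝ) + 1) ^ α ≤ Z := by
    rw [← Finset.Nat.sum_antidiagonal_swap]
    exact hsum1
  rw [coeff_mul]
  calc ‖∑ p ∈ Finset.HasAntidiagonal.antidiagonal n, coeff p.1 φ * coeff p.2 ψ‖
      ≤ ∑ p ∈ Finset.HasAntidiagonal.antidiagonal n, A * A' * (D * ((n : ℝ) + 1) ^ (max α β) *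
          (((p.1 : ℝ) + 1) ^ α + ((p.2 : ℝ) + 1) ^ α)) := by
        refine norm_sum_le_of_le _ fun p hp => ?_
        rw [norm_mul]
        calc ‖coeff p.1 φ‖ * ‖coeff p.2 ψ‖
            ≤ (A * ((p.1 : ℝ) + 1) ^ α) * (A' * ((p.2 : ℝ) + 1) ^ β) := by
              gcongr
              · exact hφ _
              · exact hψ _
          _ = A * A' * (((p.1 : ℝ) + 1) ^ α * ((p.2 : ℝ) + 1) ^ β) := by ring
          _ ≤ _ := by
            refine mul_le_mul_of_nonneg_left ?_ (by positivity)
            exact term _ _ (Finset.HasAntidiagonal.mem_antidiagonal.1 hp)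
    _ = A * A' * D * ((n : ℝ) + 1) ^ (max α β) * (∑ p ∈ Finset.HasAntidiagonal.antidiagonal n, ((p.1 : ℝ) + 1) ^ α
          + ∑ p ∈ Finset.HasAntidiagonal.antidiagonal n, ((p.2 : ℝ) + 1) ^ α) := by
        rw [← Finset.sum_add_distrib, Finset.mul_sum]
        refine Finset.sum_congr rfl fun p _ => ?_; ring
    _ ≤ A * A' * D * ((n : ℝ) + 1) ^ (max α β) * (Z + Z) := by gcongr
    _ ≤ (2 * D * Z + 1) * (A * A') * ((n : ℝ) + 1) ^ (max α β) := by
        have : 0 ≤ A * A' * ((n : ℝ) + 1) ^ (max α β) := by positivity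
        nlinarith

/-- Substituting `κ X ^ 2` with `|κ| ≤ 1` preserves decay. -/
lemma CoeffBound.evenLift {φ : PowerSeries ℂ} {C α : ℝ} (h : CoeffBound φ C α) (hα : α ≤ 0)
    {κ : ℂ} (hκ : ‖κ‖ ≤ 1) : CoeffBound (evenLift κ φ) (C * 2 ^ (-α)) α := by
  have hC := h.nonneg
  intro n
  by_cases hn : Even n
  · obtain ⟨m, rfl⟩ := hn
    rw [show m + m = 2 * m by ring, coeff_evenLift_two_mul, norm_mul, norm_pow]
    calc ‖κ‖ ^ m * ‖coeff m φ‖ ≤ 1 * (C * ((m : ℝ) + 1) ^ α) := by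
          gcongr
          · exact pow_le_one₀ (norm_nonneg _) hκ
          · exact h m
      _ ≤ C * (((2 * m + 1 : ℝ) / 2) ^ α) := by
          rw [one_mul]
          refine mul_le_mul_of_nonneg_left (Real.rpow_le_rpow_of_nonpos (by positivity) ?_ hα) hC
          linarith
      _ = _ := by
          rw [Real.div_rpow (by positivity) (by norm_num), Real.rpow_neg (by norm_num)]
          push_cast; ring
  · rw [coeff_evenLift_of_not_even _ _ hn, norm_zero]; positivity

/-- Substituting `κ X ^ 2` with `|κ| < 1` turns growth into decay of every order. -/
lemma exists_coeffBound_evenLift {κ : ℂ} (hκ : ‖κ‖ < 1) (τ σ : ℝ) : ∃ K : ℝ, 0 < K ∧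
    ∀ (φ : PowerSeries ℂ) (C : ℝ), CoeffBound φ C τ → CoeffBound (evenLift κ φ) (K * C) σ := by
  obtain ⟨K, hK, h⟩ := exists_pow_le_rpow (norm_nonneg κ) hκ (-|σ| - τ)
  refine ⟨K * 2 ^ |σ|, by positivity, fun φ C hφ n => ?_⟩
  have hC := hφ.nonneg
  by_cases hn : Even n
  · obtain ⟨m, rfl⟩ := hn
    have hp : (0 : ℝ) < (m : ℝ) + 1 := by positivity
    rw [show m + m = 2 * m by ring, coeff_evenLift_two_mul, norm_mul, norm_pow]
    calc ‖κ‖ ^ m * ‖coeff m φ‖ ≤ K * ((m : ℝ) + 1) ^ (-|σ| - τ) * (C * ((m : ℝ) + 1) ^ τ) := by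
          gcongr
          · exact h m
          · exact hφ m
      _ = K * C * ((m : ℝ) + 1) ^ (-|σ|) := by
          rw [Real.rpow_sub hp]; field_simp
      _ ≤ K * C * ((2 * m + 1 : ℝ) / 2) ^ (-|σ|) := by
          refine mul_le_mul_of_nonneg_left
            (Real.rpow_le_rpow_of_nonpos (by positivity) ?_ (by simp)) (by positivity)
          linarith
      _ = K * C * 2 ^ |σ| * (2 * m + 1 : ℝ) ^ (-|σ|) := by
          have h2 : (2 : ℝ) ^ |σ| * 2 ^ (-|σ|) = 1 := by
            rw [← Real.rpow_add (by norm_num)]; simp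
          have h3 : (0 : ℝ) < 2 ^ (-|σ|) := by positivity
          rw [Real.div_rpow (by positivity) (by norm_num), mul_div_assoc', div_eq_iff h3.ne']
          linear_combination (-K * C * (2 * m + 1 : ℝ) ^ (-|σ|)) * h2
      _ ≤ K * C * 2 ^ |σ| * (2 * m + 1 : ℝ) ^ σ := by
          gcongr
          · have : (0 : ℝ) ≤ m := by positivity
            linarith
          · exact neg_abs_le σ
      _ = _ := by push_cast; ring
  · rw [coeff_evenLift_of_not_even _ _ hn, norm_zero]; positivity

lemma exists_coeffBound_rescale {c : ℂ} (hc : ‖c‖ < 1) (τ σ : ℝ) : ∃ K : ℝ, 0 < K ∧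
    ∀ (φ : PowerSeries ℂ) (C : ℝ), CoeffBound φ C τ →
      CoeffBound (PowerSeries.rescale c φ) (K * C) σ := by
  obtain ⟨K, hK, h⟩ := exists_pow_le_rpow (norm_nonneg c) hc (σ - τ)
  refine ⟨K, hK, fun φ C hφ n => ?_⟩
  have hC := hφ.nonneg
  have hp : (0 : ℝ) < (n : ℝ) + 1 := by positivity
  rw [coeff_rescale, norm_mul, norm_pow]
  calc ‖c‖ ^ n * ‖coeff n φ‖ ≤ K * ((n : ℝ) + 1) ^ (σ - τ) * (C * ((n : ℝ) + 1) ^ τ) := by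
        gcongr
        · exact h n
        · exact hφ n
    _ = _ := by rw [Real.rpow_sub hp]; field_simp

lemma exists_coeffBound_binSeries (R : ℝ) : ∃ K : ℝ, 0 < K ∧ ∀ α : ℂ, ‖α‖ ≤ R →
    CoeffBound (binSeries α) K (α.re - 1) := by
  obtain ⟨K, hK, h⟩ := exists_norm_pochDivGamma_le (max R 1)
  refine ⟨K, hK, fun α hα n => ?_⟩
  have := h α 1 (hα.trans (le_max_left _ _)) (by simp) n
  rw [pochDivGamma_one] at this
  simpa [binSeries] using this

end

noncomputable section

open PowerSeries

lemma Represents.sub {φ ψ : PowerSeries ℂ} {f g : ℂ → ℂ} {r : ℝ} (hf : Represents φ f r)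
    (hg : Represents ψ g r) : Represents (φ - ψ) (fun z => f z - g z) r := by
  intro z hz
  obtain ⟨f1, f2⟩ := hf z hz
  obtain ⟨g1, g2⟩ := hg z hz
  have e : ∀ n, coeff n (φ - ψ) * z ^ n = coeff n φ * z ^ n - coeff n ψ * z ^ n := by
    intro n; rw [map_sub]; ring
  simp only [e]
  exact ⟨(f1.add g1).of_nonneg_of_le (fun _ => norm_nonneg _) fun n => norm_sub_le _ _, f2.sub g2⟩

/-! ### The series of `1 - √(1 - X)` -/

/-- The power series of `1 - √(1 - X)`, with coefficients given by the Catalan numbers. -/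
def oneSubSqrt : PowerSeries ℝ :=
  X * PowerSeries.mk fun m => (catalan m : ℝ) / (2 * 4 ^ m)

lemma coeff_oneSubSqrt_zero : coeff 0 oneSubSqrt = 0 := by simp [oneSubSqrt]

lemma coeff_oneSubSqrt_succ (m : ℕ) :
    coeff (m + 1) oneSubSqrt = (catalan m : ℝ) / (2 * 4 ^ m) := by
  simp [oneSubSqrt, coeff_succ_X_mul]

/-- The Catalan convolution recurrence in disguise. Writing S for this series, S² = 2S - X says
(1-S)² = 1-X. -/
lemma oneSubSqrt_sq : oneSubSqrt ^ 2 = 2 * oneSubSqrt - X := by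
  set S : PowerSeries ℝ := PowerSeries.mk fun m => (catalan m : ℝ) / (2 * 4 ^ m) with hS
  have h : X * S ^ 2 = 2 * S - 1 := by
    ext n
    rw [map_sub, show (2 : PowerSeries ℝ) * S = S + S by ring, map_add]
    cases n with
    | zero => simp [hS]; norm_num
    | succ m =>
      rw [coeff_succ_X_mul, sq, coeff_mul, coeff_one, if_neg (Nat.succ_ne_zero m)]
      simp only [hS, coeff_mk]
      rw [catalan_succ' m]
      push_cast
      rw [sub_zero, Finset.sum_div, ← Finset.sum_add_distrib]
      refine Finset.sum_congr rfl fun p hp => ?_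
      rw [← Finset.HasAntidiagonal.mem_antidiagonal.1 hp, pow_succ, pow_add]
      field_simp; ring
  have : oneSubSqrt = X * S := rfl
  rw [this]
  linear_combination X * h

lemma coeff_oneSubSqrt_pow_nonneg (k n : ℕ) : 0 ≤ coeff n (oneSubSqrt ^ k) := by
  induction k generalizing n with
  | zero => rw [pow_zero, coeff_one]; split_ifs <;> norm_num
  | succ k ih =>
    rw [pow_succ, coeff_mul]
    refine Finset.sum_nonneg fun p _ => mul_nonneg (ih _) ?_
    rcases p.2 with _ | m
    · rw [coeff_oneSubSqrt_zero]
    · rw [coeff_oneSubSqrt_succ]; positivity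

/-- Half the derivative of S² = 2S - X, that is (1-S) S' = 1/2. It removes derivatives of S at no
cost. -/
lemma oneSubSqrt_mul_derivative :
    oneSubSqrt * derivative ℝ oneSubSqrt = derivative ℝ oneSubSqrt - C (1 / 2 : ℝ) := by
  have h := congrArg (derivative ℝ) oneSubSqrt_sq
  rw [two_mul, sq, Derivation.leibniz, map_sub, map_add, derivative_X] at h
  simp only [smul_eq_mul] at h
  have h3 : 2 * (C (1 / 2 : ℝ)) = (1 : PowerSeries ℝ) := by
    rw [two_mul, ← map_add, ← map_one (C (R := ℝ))]; norm_num
  linear_combination C (1 / 2 : ℝ) * h + (derivative ℝ oneSubSqrt -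
    oneSubSqrt * derivative ℝ oneSubSqrt) * h3

/-- S^(k+1) S' = S^k S' - S^k/2 and S^k has nonnegative coefficients, so the coefficients of S^k S'
decrease with k. With (S^k)' = k S^(k-1) S' this makes the coefficients of S^k grow at most linearly
in k, keeping the decay of those of S. -/
lemma coeff_pow_mul_derivative_le (k n : ℕ) :
    coeff n (oneSubSqrt ^ k * derivative ℝ oneSubSqrt) ≤ coeff n (derivative ℝ oneSubSqrt) := by
  induction k with
  | zero => simp
  | succ k ih =>
    refine le_trans ?_ ih
    rw [pow_succ, mul_assoc, oneSubSqrt_mul_derivative, mul_sub, map_sub, mul_comm _ (C (1 / 2 : ℝ)),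
      coeff_C_mul]
    have := coeff_oneSubSqrt_pow_nonneg k n
    linarith

lemma coeff_derivative_pow (k n : ℕ) : coeff (n + 1) (oneSubSqrt ^ k) * ((n : ℝ) + 1) =
    k * coeff n (oneSubSqrt ^ (k - 1) * derivative ℝ oneSubSqrt) := by
  rw [← coeff_derivative, Derivation.leibniz_pow, nsmul_eq_mul, smul_eq_mul,
    ← map_natCast (C (R := ℝ)), coeff_C_mul]

lemma coeff_oneSubSqrt_pow_le (k n : ℕ) :
    coeff (n + 1) (oneSubSqrt ^ k) ≤ k * coeff (n + 1) oneSubSqrt := by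
  have hp : (0 : ℝ) < (n : ℝ) + 1 := by positivity
  refine le_of_mul_le_mul_right ?_ hp
  rw [coeff_derivative_pow, mul_assoc, ← coeff_derivative]
  gcongr
  exact coeff_pow_mul_derivative_le _ _

lemma coeff_oneSubSqrt_rec (m : ℕ) :
    coeff (m + 2) oneSubSqrt * (2 * (m + 2)) = coeff (m + 1) oneSubSqrt * (2 * m + 1) := by
  rw [coeff_oneSubSqrt_succ, coeff_oneSubSqrt_succ]
  have h1 := succ_mul_catalan_eq_centralBinom m
  have h2 := succ_mul_catalan_eq_centralBinom (m + 1)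
  have h3 := Nat.succ_mul_centralBinom_succ m
  rw [← h1, ← h2] at h3
  have h4 : ((m : ℝ) + 1) * ((m + 2) * catalan (m + 1)) =
      ((m : ℝ) + 1) * (2 * (2 * m + 1) * catalan m) := by
    have := congrArg (Nat.cast (R := ℝ)) h3
    push_cast at this
    linear_combination this
  have h5 := mul_left_cancel₀ (by positivity) h4
  rw [pow_succ]
  field_simp
  linear_combination 2 * h5

lemma coeff_oneSubSqrt_succ_le (m : ℕ) :
    coeff (m + 1) oneSubSqrt ≤ 1 / 2 * ((m : ℝ) + 1) ^ (-(3 / 2) : ℝ) := by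
  -- By the two-term recurrence this quantity is nonincreasing, since (2m+1)²(m+2) ≤ 4(m+1)³; it
  -- equals 1/4 at m = 0. Squaring replaces the half-integral exponent by an integral one.
  have h : ∀ m : ℕ, coeff (m + 1) oneSubSqrt ^ 2 * ((m : ℝ) + 1) ^ 3 ≤ 1 / 4 := by
    intro m
    induction m with
    | zero => rw [coeff_oneSubSqrt_succ]; norm_num
    | succ m ih =>
      refine le_trans ?_ ih
      set s := coeff (m + 1) oneSubSqrt
      have hp : (0 : ℝ) < (m : ℝ) + 2 := by positivity
      have e : coeff (m + 1 + 1) oneSubSqrt = s * (2 * m + 1) / (2 * (m + 2)) := by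
        rw [eq_div_iff (by positivity)]; exact coeff_oneSubSqrt_rec m
      rw [e]
      push_cast
      rw [show (m : ℝ) + 1 + 1 = m + 2 by ring]
      have : (s * (2 * m + 1) / (2 * (m + 2))) ^ 2 * ((m : ℝ) + 2) ^ 3 =
          s ^ 2 * ((2 * m + 1) ^ 2 * (m + 2) / 4) := by field_simp; ring
      rw [this]
      gcongr
      have hm : (0 : ℝ) ≤ m := by positivity
      nlinarith
  have hp : (0 : ℝ) < (m : ℝ) + 1 := by positivity
  refine (abs_le_of_sq_le_sq' ?_ (by positivity)).2
  rw [mul_pow, ← Real.rpow_natCast (((m : ℝ) + 1) ^ (-(3 / 2) : ℝ)), ← Real.rpow_mul hp.le]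
  have : ((m : ℝ) + 1) ^ (-(3 / 2) * ((2 : ℕ) : ℝ)) = (((m : ℝ) + 1) ^ 3)⁻¹ := by
    rw [← Real.rpow_natCast, ← Real.rpow_neg hp.le]; norm_num
  rw [this, ← div_eq_mul_inv, le_div_iff₀ (by positivity)]
  have := h m
  norm_num at this ⊢
  exact this

lemma X_pow_dvd_oneSubSqrt_pow (k : ℕ) : X ^ k ∣ oneSubSqrt ^ k :=
  pow_dvd_pow_of_dvd (Dvd.intro _ rfl) k

lemma coeff_oneSubSqrt_pow_eq_zero {k n : ℕ} (h : n < k) : coeff n (oneSubSqrt ^ k) = 0 :=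
  X_pow_dvd_iff.1 (X_pow_dvd_oneSubSqrt_pow k) n h

lemma succ_rpow_neg_le (m : ℕ) {τ : ℝ} (hτ : 0 ≤ τ) :
    ((m : ℝ) + 1) ^ (-τ) ≤ 2 ^ τ * (((m + 1 : ℕ) : ℝ) + 1) ^ (-τ) := by
  calc ((m : ℝ) + 1) ^ (-τ) ≤ ((((m + 1 : ℕ) : ℝ) + 1) / 2) ^ (-τ) := by
        refine Real.rpow_le_rpow_of_nonpos (by positivity) ?_ (by linarith)
        push_cast
        have : (0 : ℝ) ≤ m := by positivity
        linarith
    _ = _ := by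
        have h2 : (2 : ℝ) ^ τ * 2 ^ (-τ) = 1 := by
          rw [← Real.rpow_add (by norm_num)]; simp
        rw [Real.div_rpow (by positivity) (by norm_num), div_eq_iff (by positivity)]
        linear_combination (-(((m + 1 : ℕ) : ℝ) + 1) ^ (-τ)) * h2

lemma coeff_oneSubSqrt_pow_le_rpow (k n : ℕ) :
    coeff n (oneSubSqrt ^ k) ≤ 2 ^ (3 / 2 : ℝ) * ((k : ℝ) + 1) * ((n : ℝ) + 1) ^ (-(3 / 2) : ℝ) := by
  have h2 : (1 : ℝ) ≤ 2 ^ (3 / 2 : ℝ) := Real.one_le_rpow (by norm_num) (by norm_num)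
  rcases n with _ | n
  · have : coeff 0 (oneSubSqrt ^ k) ≤ 1 := by
      rcases k with _ | k
      · simp
      · rw [coeff_oneSubSqrt_pow_eq_zero (Nat.succ_pos k)]; norm_num
    refine this.trans ?_
    have : (0 : ℝ) ≤ k := by positivity
    simp only [Nat.cast_zero, zero_add, Real.one_rpow, mul_one]
    nlinarith
  · calc coeff (n + 1) (oneSubSqrt ^ k) ≤ k * coeff (n + 1) oneSubSqrt := coeff_oneSubSqrt_pow_le k n
      _ ≤ k * (1 / 2 * (2 ^ (3 / 2 : ℝ) * (((n + 1 : ℕ) : ℝ) + 1) ^ (-(3 / 2) : ℝ))) := by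
          gcongr
          refine (coeff_oneSubSqrt_succ_le n).trans ?_
          gcongr
          exact succ_rpow_neg_le n (by norm_num)
      _ ≤ _ := by
          have h3 : (0 : ℝ) ≤ 2 ^ (3 / 2 : ℝ) * (((n + 1 : ℕ) : ℝ) + 1) ^ (-(3 / 2) : ℝ) := by positivity
          have : (0 : ℝ) ≤ k := by positivity
          nlinarith

/-- Since 1-X = (1-S)² and (1-S) S' = 1/2, the derivative of (1-X) S^k is a combination of S^(k-1)
and S^k without S'. Its coefficients are thus still O(n^(-3/2)), and dividing by n gives the
exponent -5/2. -/
lemma abs_coeff_one_sub_X_mul_oneSubSqrt_pow_le (k n : ℕ) :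
    |coeff n ((1 - X) * oneSubSqrt ^ k)| ≤
      100 * ((k : ℝ) + 1) ^ 2 * ((n : ℝ) + 1) ^ (-(5 / 2) : ℝ) := by
  have hk : (0 : ℝ) ≤ k := by positivity
  have h2 : (2 : ℝ) ^ (3 / 2 : ℝ) ≤ 4 :=
    (Real.rpow_le_rpow_of_exponent_le (by norm_num) (by norm_num : (3 / 2 : ℝ) ≤ (2 : ℕ))).trans
      (by rw [Real.rpow_natCast]; norm_num)
  have h5 : (2 : ℝ) ^ (5 / 2 : ℝ) ≤ 8 :=
    (Real.rpow_le_rpow_of_exponent_le (by norm_num) (by norm_num : (5 / 2 : ℝ) ≤ (3 : ℕ))).trans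
      (by rw [Real.rpow_natCast]; norm_num)
  rcases n with _ | n
  · rw [sub_mul, one_mul, map_sub, coeff_zero_X_mul, sub_zero,
      abs_of_nonneg (coeff_oneSubSqrt_pow_nonneg _ _)]
    refine (coeff_oneSubSqrt_pow_le_rpow k 0).trans ?_
    simp only [Nat.cast_zero, zero_add, Real.one_rpow, mul_one]
    nlinarith
  · have hp : (0 : ℝ) < (n : ℝ) + 1 := by positivity
    set b := ((n : ℝ) + 1) ^ (-(3 / 2) : ℝ) with hb
    have hb0 : 0 ≤ b := by positivity
    have hc : ∀ j : ℕ, j ≤ k → coeff n (oneSubSqrt ^ j) ≤ 4 * (k + 1) * b := by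
      intro j hj
      refine (coeff_oneSubSqrt_pow_le_rpow j n).trans ?_
      gcongr
    have hd : derivative ℝ ((1 - X) * oneSubSqrt ^ k) =
        C ((k : ℝ) / 2) * (oneSubSqrt ^ (k - 1) - oneSubSqrt ^ k) - oneSubSqrt ^ k := by
      rw [Derivation.leibniz, Derivation.leibniz_pow, map_sub, derivative_X, Derivation.map_one_eq_zero]
      simp only [smul_eq_mul, nsmul_eq_mul]
      rcases k with _ | k
      · simp
      · simp only [Nat.add_one_sub_one]
        have e1 : C (((k + 1 : ℕ) : ℝ) / 2) = ((k + 1 : ℕ) : PowerSeries ℝ) * C (1 / 2 : ℝ) := by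
          rw [← map_natCast (C (R := ℝ)), ← map_mul]; congr 1; ring
        rw [e1]
        linear_combination ((k + 1 : ℕ) : PowerSeries ℝ) * oneSubSqrt ^ k *
          ((oneSubSqrt - 1) * oneSubSqrt_mul_derivative - derivative ℝ oneSubSqrt * oneSubSqrt_sq)
    have h := coeff_derivative ((1 - X) * oneSubSqrt ^ k) n
    rw [hd, map_sub, coeff_C_mul, map_sub] at h
    have hA : |coeff (n + 1) ((1 - X) * oneSubSqrt ^ k) * ((n : ℝ) + 1)| ≤
        12 * (k + 1) ^ 2 * b := by
      rw [← h]
      have a1 := hc k le_rfl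
      have a2 := hc (k - 1) (Nat.sub_le _ _)
      have a3 := coeff_oneSubSqrt_pow_nonneg k n
      have a4 := coeff_oneSubSqrt_pow_nonneg (k - 1) n
      have a5 : 0 ≤ k * b := by positivity
      rw [abs_le]
      constructor <;> nlinarith [mul_nonneg hk a3, mul_nonneg hk a4, mul_le_mul_of_nonneg_left a1 hk,
        mul_le_mul_of_nonneg_left a2 hk, mul_nonneg hk a5]
    rw [abs_mul, abs_of_pos hp, ← le_div_iff₀ hp] at hA
    refine hA.trans ?_
    have e : 12 * ((k : ℝ) + 1) ^ 2 * b / (n + 1) =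
        12 * ((k : ℝ) + 1) ^ 2 * ((n : ℝ) + 1) ^ (-(5 / 2) : ℝ) := by
      rw [hb, show (-(5 / 2) : ℝ) = -(3 / 2) - 1 by norm_num, Real.rpow_sub_one hp.ne']; ring
    rw [e]
    calc 12 * ((k : ℝ) + 1) ^ 2 * ((n : ℝ) + 1) ^ (-(5 / 2) : ℝ)
        ≤ 12 * ((k : ℝ) + 1) ^ 2 * (8 * (((n + 1 : ℕ) : ℝ) + 1) ^ (-(5 / 2) : ℝ)) := by
          gcongr
          refine (succ_rpow_neg_le n (by norm_num)).trans ?_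
          gcongr
      _ ≤ _ := by
          have : (0 : ℝ) ≤ ((k : ℝ) + 1) ^ 2 * (((n + 1 : ℕ) : ℝ) + 1) ^ (-(5 / 2) : ℝ) := by positivity
          nlinarith

/-- The complex version of `oneSubSqrt`. -/
def oneSubSqrtC : PowerSeries ℂ := PowerSeries.map Complex.ofRealHom oneSubSqrt

lemma coeff_oneSubSqrtC_pow (k n : ℕ) :
    coeff n (oneSubSqrtC ^ k) = ((coeff n (oneSubSqrt ^ k) : ℝ) : ℂ) := by
  rw [oneSubSqrtC, ← map_pow, coeff_map]; rfl

/-- Both sides obey the same two-term recurrence. The Catalan form supplies positivity and algebra,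
the binomial form the analytic function. -/
lemma oneSubSqrtC_eq : oneSubSqrtC = 1 - binSeries (-(1 / 2)) := by
  have hs : ∀ (α : ℂ) (m : ℕ), binCoeff α (m + 1) * (m + 1) = binCoeff α m * (α + m) := by
    intro α m
    have h1 : ((m.factorial : ℕ) : ℂ) ≠ 0 := by exact_mod_cast m.factorial_ne_zero
    have h2 : ((m : ℂ) + 1) ≠ 0 := by exact_mod_cast m.succ_ne_zero
    simp only [binCoeff, poch_succ, Nat.factorial_succ]
    push_cast
    field_simp
  have h : ∀ m : ℕ, ((coeff (m + 1) oneSubSqrt : ℝ) : ℂ) = -binCoeff (-(1 / 2)) (m + 1) := by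
    intro m
    induction m with
    | zero =>
      have := hs (-(1 / 2)) 0
      rw [binCoeff_zero] at this
      simp only [Nat.cast_zero, zero_add, mul_one] at this
      rw [zero_add, this]
      have := coeff_oneSubSqrt_succ 0
      rw [zero_add] at this
      rw [this]; norm_num
    | succ m ih =>
      have h1 := hs (-(1 / 2)) (m + 1)
      have h2 := congrArg (fun r : ℝ => (r : ℂ)) (coeff_oneSubSqrt_rec m)
      push_cast at h1 h2
      rw [ih] at h2
      have h3 : (m : ℂ) + 2 ≠ 0 := by exact_mod_cast (by omega : m + 2 ≠ 0)
      apply mul_right_cancel₀ h3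
      rw [show m + 1 + 1 = m + 2 by ring] at *
      linear_combination (1 / 2) * h2 + h1
  ext n
  rw [oneSubSqrtC, coeff_map, map_sub, coeff_one]
  rcases n with _ | m
  · rw [coeff_oneSubSqrt_zero]; simp [binSeries, binCoeff_zero]
  · simp only [Nat.add_eq_zero_iff, one_ne_zero, and_false, if_false, zero_sub, binSeries, coeff_mk]
    exact h m

lemma represents_oneSubSqrtC : Represents oneSubSqrtC (fun v => 1 - (1 - v) ^ (1 / 2 : ℂ)) 1 := by
  rw [oneSubSqrtC_eq]
  simpa using Represents.one.sub (represents_binSeries (-(1 / 2)))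

lemma re_cpow_half_nonneg (z : ℂ) : 0 ≤ (z ^ (1 / 2 : ℂ)).re := by
  rw [one_div, Complex.cpow_inv_two_re]; exact Real.sqrt_nonneg _

lemma cpow_half_sq (z : ℂ) : (z ^ (1 / 2 : ℂ)) ^ 2 = z := by
  rw [one_div]; exact Complex.cpow_nat_inv_pow z two_ne_zero

/-- With w the principal root, (1-w)(1+w) = v and Re w ≥ 0 forces |1+w| ≥ 1. Hence v ↦ 1 - √(1-v)
maps the unit disc into itself. -/
lemma norm_one_sub_cpow_half_le (v : ℂ) : ‖1 - (1 - v) ^ (1 / 2 : ℂ)‖ ≤ ‖v‖ := by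
  set w := (1 - v) ^ (1 / 2 : ℂ)
  have h1 : (1 - w) * (1 + w) = v := by
    have := cpow_half_sq (1 - v); linear_combination -this
  have h2 : 1 ≤ ‖1 + w‖ := by
    have h3 : 0 ≤ w.re := re_cpow_half_nonneg (1 - v)
    have := Complex.re_le_norm (1 + w)
    simp at this; linarith
  rw [← h1, norm_mul]
  exact le_mul_of_one_le_right (norm_nonneg _) h2

/-! ### Composition with `1 - √(1 - X)` -/

/-- The composition of `φ` with the series of `1 - √(1 - X)`. -/
def compOneSubSqrt (φ : PowerSeries ℂ) : PowerSeries ℂ :=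
  PowerSeries.mk fun m => ∑ k ∈ Finset.range (m + 1), coeff k φ * coeff m (oneSubSqrtC ^ k)

lemma coeff_compOneSubSqrt (φ : PowerSeries ℂ) {m N : ℕ} (h : m < N) :
    coeff m (compOneSubSqrt φ) = ∑ k ∈ Finset.range N, coeff k φ * coeff m (oneSubSqrtC ^ k) := by
  rw [compOneSubSqrt, coeff_mk]
  refine Finset.sum_subset (Finset.range_mono h) fun k _ hk => ?_
  rw [coeff_oneSubSqrtC_pow, coeff_oneSubSqrt_pow_eq_zero (by simpa using hk)]; simp

/-- The sums over powers and over exponents are interchanged. As the coefficients of S^k are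
nonnegative, the row of absolute values sums to the value of S^k at |v|, which is at most 1;
summability of the coefficients of φ then suffices. -/
lemma Represents.compOneSubSqrt {φ : PowerSeries ℂ} {f : ℂ → ℂ} (hf : Represents φ f 1)
    (hφ : Summable fun k => ‖coeff k φ‖) :
    Represents (compOneSubSqrt φ) (fun v => f (1 - (1 - v) ^ (1 / 2 : ℂ))) 1 := by
  intro v hv
  set F : ℕ × ℕ → ℂ := fun p => coeff p.1 φ * coeff p.2 (oneSubSqrtC ^ p.1) * v ^ p.2 with hF
  have hv' : ‖((‖v‖ : ℝ) : ℂ)‖ < 1 := by simpa using hv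
  have hrow : ∀ k, HasSum (fun m => ‖F (k, m)‖)
      (‖coeff k φ‖ * ‖(1 - (1 - ((‖v‖ : ℝ) : ℂ)) ^ (1 / 2 : ℂ)) ^ k‖) := by
    intro k
    obtain ⟨h1, h2⟩ := (represents_oneSubSqrtC.pow k) _ hv'
    have e : ∀ m, coeff m (oneSubSqrtC ^ k) * ((‖v‖ : ℝ) : ℂ) ^ m =
        ((‖coeff m (oneSubSqrtC ^ k) * v ^ m‖ : ℝ) : ℂ) := by
      intro m
      rw [coeff_oneSubSqrtC_pow, norm_mul, norm_pow, Complex.norm_real,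
        Real.norm_of_nonneg (coeff_oneSubSqrt_pow_nonneg _ _)]
      push_cast; ring
    have h3 : HasSum (fun m => ‖coeff m (oneSubSqrtC ^ k) * v ^ m‖)
        ‖(1 - (1 - ((‖v‖ : ℝ) : ℂ)) ^ (1 / 2 : ℂ)) ^ k‖ := by
      simp only [e] at h2
      have h4 : Summable fun m => ‖coeff m (oneSubSqrtC ^ k) * v ^ m‖ := by
        refine h1.congr fun m => ?_
        rw [e, Complex.norm_real, norm_norm]
      have h5 := h2.unique (Complex.hasSum_ofReal.2 h4.hasSum)
      rw [h5, Complex.norm_real, Real.norm_of_nonneg (tsum_nonneg fun _ => norm_nonneg _)]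
      exact h4.hasSum
    have := h3.mul_left ‖coeff k φ‖
    simpa only [hF, mul_assoc, norm_mul] using this
  have hle : ∀ k, ‖(1 - (1 - ((‖v‖ : ℝ) : ℂ)) ^ (1 / 2 : ℂ)) ^ k‖ ≤ 1 := by
    intro k
    rw [norm_pow]
    exact pow_le_one₀ (norm_nonneg _) ((norm_one_sub_cpow_half_le _).trans hv'.le)
  have hsum : Summable fun p => ‖F p‖ := by
    rw [summable_prod_of_nonneg fun p => norm_nonneg _]
    refine ⟨fun k => (hrow k).summable, ?_⟩
    refine Summable.of_nonneg_of_le (fun k => tsum_nonneg fun _ => norm_nonneg _) (fun k => ?_) hφ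
    rw [(hrow k).tsum_eq]
    exact mul_le_of_le_one_right (norm_nonneg _) (hle k)
  have hS := hsum.of_norm.hasSum
  have hv1 : ‖1 - (1 - v) ^ (1 / 2 : ℂ)‖ < 1 := (norm_one_sub_cpow_half_le v).trans_lt hv
  have hk : ∀ k, HasSum (fun m => F (k, m)) (coeff k φ * (1 - (1 - v) ^ (1 / 2 : ℂ)) ^ k) := by
    intro k
    have := ((represents_oneSubSqrtC.pow k) v hv).2.mul_left (coeff k φ)
    simpa only [hF, mul_assoc] using this
  have hval := (hS.prod_fiberwise hk).unique (hf _ hv1).2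
  have hm : ∀ m, HasSum (fun k => F (k, m)) (coeff m (_root_.compOneSubSqrt φ) * v ^ m) := by
    intro m
    rw [coeff_compOneSubSqrt φ (Nat.lt_succ_self m), Finset.sum_mul]
    refine hasSum_sum_of_ne_finset_zero fun k hk => ?_
    rw [hF]
    simp only
    rw [coeff_oneSubSqrtC_pow, coeff_oneSubSqrt_pow_eq_zero (by simpa using hk)]; simp
  have hS' : HasSum (fun p : ℕ × ℕ => F p.swap) (∑' p, F p) := (Equiv.prodComm ℕ ℕ).hasSum_iff.2 hS
  have hsum' : Summable fun p : ℕ × ℕ => ‖F p.swap‖ := (Equiv.prodComm ℕ ℕ).summable_iff.2 hsum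
  refine ⟨?_, ?_⟩
  · have h1 := (summable_prod_of_nonneg fun p => norm_nonneg _).1 hsum'
    refine Summable.of_nonneg_of_le (fun _ => norm_nonneg _) (fun m => ?_) h1.2
    rw [← (hm m).tsum_eq]
    exact norm_tsum_le_tsum_norm (h1.1 m)
  · rw [hval] at hS'
    exact hS'.prod_fiberwise hm

/-- The decay (k+1)^(-4) pays for the growth (k+1)² of the bounds on S^k and leaves a convergent sum
over k. -/
lemma exists_coeffBound_compOneSubSqrt : ∃ K : ℝ, 0 < K ∧ ∀ (φ : PowerSeries ℂ) (A : ℝ),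
    CoeffBound φ A (-4) → CoeffBound (compOneSubSqrt φ) (K * A) (-(3 / 2)) ∧
      CoeffBound ((1 - X) * compOneSubSqrt φ) (K * A) (-(5 / 2)) := by
  set Z := ∑' n : ℕ, ((n : ℝ) + 1) ^ (-2 : ℝ)
  have hs := summable_add_one_rpow (show (-2 : ℝ) < -1 by norm_num)
  have hZ : 0 ≤ Z := tsum_nonneg fun n => by positivity
  refine ⟨100 * Z + 1, by positivity, fun φ A hφ => ?_⟩
  have hA := hφ.nonneg
  have main : ∀ (n : ℕ) (τ : ℝ) (c : ℕ → ℂ), (∀ k, ‖c k‖ ≤ 100 * ((k : ℝ) + 1) ^ 2 *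
      ((n : ℝ) + 1) ^ τ) → ‖∑ k ∈ Finset.range (n + 1), coeff k φ * c k‖ ≤
      (100 * Z + 1) * A * ((n : ℝ) + 1) ^ τ := by
    intro n τ c hc
    calc ‖∑ k ∈ Finset.range (n + 1), coeff k φ * c k‖
        ≤ ∑ k ∈ Finset.range (n + 1), 100 * A * ((n : ℝ) + 1) ^ τ * ((k : ℝ) + 1) ^ (-2 : ℝ) := by
          refine norm_sum_le_of_le _ fun k _ => ?_
          have hk : (0 : ℝ) < (k : ℝ) + 1 := by positivity
          rw [norm_mul]
          calc ‖coeff k φ‖ * ‖c k‖ ≤ (A * ((k : ℝ) + 1) ^ (-4 : ℝ)) *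
                (100 * ((k : ℝ) + 1) ^ 2 * ((n : ℝ) + 1) ^ τ) := by
                gcongr
                · exact hφ k
                · exact hc k
            _ = _ := by
                have : ((k : ℝ) + 1) ^ (-4 : ℝ) * ((k : ℝ) + 1) ^ 2 = ((k : ℝ) + 1) ^ (-2 : ℝ) := by
                  rw [← Real.rpow_natCast, ← Real.rpow_add hk]; norm_num
                rw [← this]; ring
      _ = 100 * A * ((n : ℝ) + 1) ^ τ * ∑ k ∈ Finset.range (n + 1), ((k : ℝ) + 1) ^ (-2 : ℝ) := by
          rw [Finset.mul_sum]
      _ ≤ 100 * A * ((n : ℝ) + 1) ^ τ * Z := by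
          gcongr
          exact hs.sum_le_tsum _ fun _ _ => by positivity
      _ ≤ _ := by
          have : 0 ≤ A * ((n : ℝ) + 1) ^ τ := by positivity
          nlinarith
  constructor
  · intro n
    rw [coeff_compOneSubSqrt φ (Nat.lt_succ_self n)]
    refine main n _ _ fun k => ?_
    rw [coeff_oneSubSqrtC_pow, Complex.norm_real, Real.norm_of_nonneg (coeff_oneSubSqrt_pow_nonneg _ _)]
    refine (coeff_oneSubSqrt_pow_le_rpow k n).trans ?_
    have h2 : (2 : ℝ) ^ (3 / 2 : ℝ) ≤ 4 :=
      (Real.rpow_le_rpow_of_exponent_le (by norm_num) (by norm_num : (3 / 2 : ℝ) ≤ (2 : ℕ))).trans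
        (by rw [Real.rpow_natCast]; norm_num)
    gcongr
    · linarith
    · exact le_self_pow₀ (by simp) two_ne_zero
  · intro n
    have e : coeff n ((1 - X) * compOneSubSqrt φ) =
        ∑ k ∈ Finset.range (n + 1), coeff k φ * coeff n ((1 - X) * oneSubSqrtC ^ k) := by
      rcases n with _ | n
      · rw [sub_mul, one_mul, map_sub, coeff_zero_X_mul, sub_zero,
          coeff_compOneSubSqrt φ (Nat.lt_succ_self 0)]
        simp [sub_mul]
      · simp only [sub_mul, one_mul, map_sub, coeff_succ_X_mul, mul_sub, Finset.sum_sub_distrib]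
        rw [coeff_compOneSubSqrt φ (show n < n + 1 + 1 by omega),
          coeff_compOneSubSqrt φ (show n + 1 < n + 1 + 1 by omega)]
    rw [e]
    refine main n _ _ fun k => ?_
    have e2 : coeff n ((1 - X) * oneSubSqrtC ^ k) = ((coeff n ((1 - X) * oneSubSqrt ^ k) : ℝ) : ℂ) := by
      have : (1 - X) * oneSubSqrtC ^ k = PowerSeries.map Complex.ofRealHom ((1 - X) * oneSubSqrt ^ k) := by
        simp [oneSubSqrtC]
      rw [this, coeff_map]; rfl
    rw [e2, Complex.norm_real]
    exact abs_coeff_one_sub_X_mul_oneSubSqrt_pow_le k n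

end

noncomputable section

open PowerSeries

/-! ### Holomorphic dependence of coefficients on parameters -/

/-- All coefficients of `Φ z` are holomorphic functions of `z ∈ U`. -/
def CoeffDifferentiableOn (Φ : ℂ → PowerSeries ℂ) (U : Set ℂ) : Prop :=
  ∀ n, DifferentiableOn ℂ (fun z => coeff n (Φ z)) U

namespace CoeffDifferentiableOn

variable {Φ Ψ : ℂ → PowerSeries ℂ} {U : Set ℂ}

lemma mul (h : CoeffDifferentiableOn Φ U) (h' : CoeffDifferentiableOn Ψ U) :
    CoeffDifferentiableOn (fun z => Φ z * Ψ z) U := by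
  intro n
  simp only [coeff_mul]
  exact DifferentiableOn.fun_sum fun p _ => (h p.1).mul (h' p.2)

lemma rescale (h : CoeffDifferentiableOn Φ U) {c : ℂ → ℂ} (hc : DifferentiableOn ℂ c U) :
    CoeffDifferentiableOn (fun z => PowerSeries.rescale (c z) (Φ z)) U := by
  intro n
  simp only [coeff_rescale]
  exact (hc.pow n).mul (h n)

lemma evenLift (h : CoeffDifferentiableOn Φ U) {c : ℂ → ℂ} (hc : DifferentiableOn ℂ c U) :
    CoeffDifferentiableOn (fun z => _root_.evenLift (c z) (Φ z)) U := by
  intro n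
  by_cases hn : Even n
  · simp only [_root_.evenLift, coeff_mk, if_pos hn]
    exact (hc.pow _).mul (h _)
  · simp only [_root_.evenLift, coeff_mk, if_neg hn]
    exact differentiableOn_const _

lemma compOneSubSqrt (h : CoeffDifferentiableOn Φ U) :
    CoeffDifferentiableOn (fun z => _root_.compOneSubSqrt (Φ z)) U := by
  intro n
  simp only [_root_.compOneSubSqrt, coeff_mk]
  exact DifferentiableOn.fun_sum fun k _ => (h k).mul_const _

lemma binSeries {α : ℂ → ℂ} (hα : DifferentiableOn ℂ α U) :
    CoeffDifferentiableOn (fun z => _root_.binSeries (α z)) U := by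
  intro n
  simp only [_root_.binSeries, coeff_mk]
  exact (differentiable_binCoeff n).comp_differentiableOn hα

end CoeffDifferentiableOn

/-! ### The two coefficient families -/

/-- The series of `(1 + s) ^ ν (1 + t s) ^ (-ν) (1 - t s²) ^ (-μ)`. -/
def eulerSeries (t μ ν : ℂ) : PowerSeries ℂ :=
  rescale (-1) (binSeries (-ν)) * (rescale (-t) (binSeries ν) * evenLift t (binSeries μ))

/-- The series of `(1 - θ w) ^ ν (1 - w / 2) ^ (-μ)`. -/
def quadraticSeries (θ μ ν : ℂ) : PowerSeries ℂ :=
  rescale θ (binSeries (-ν)) * rescale (1 / 2) (binSeries μ)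

/-- The series of `(1 + y) ^ (-ν) (1 - θ w) ^ ν (1 - w / 2) ^ (-μ)`, `w = 1 - √(1 - κ y²)`. -/
def quadraticInvSeries (θ κ μ ν : ℂ) : PowerSeries ℂ :=
  rescale (-1) (binSeries ν) * evenLift κ (compOneSubSqrt (quadraticSeries θ μ ν))

lemma represents_rescale_binSeries (α c : ℂ) {s : ℝ} (hs : ‖c‖ * s ≤ 1) :
    Represents (rescale c (binSeries α)) (fun z => (1 - c * z) ^ (-α)) s :=
  (represents_binSeries α).rescale c hs one_pos

lemma norm_mul_sq_lt {κ : ℂ} {s : ℝ} (h1 : ‖κ‖ * s ^ 2 ≤ 1) {z : ℂ}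
    (hz : ‖z‖ < s) : ‖κ * z ^ 2‖ < 1 := by
  rw [norm_mul, norm_pow]
  rcases (norm_nonneg κ).eq_or_lt with h | h
  · rw [← h]; simp
  · refine lt_of_lt_of_le ?_ h1
    gcongr

lemma represents_eulerSeries {t : ℂ} (ht : ‖t‖ < 1) (μ ν : ℂ) : Represents (eulerSeries t μ ν)
    (fun s => (1 + s) ^ ν * ((1 + t * s) ^ (-ν) * (1 - t * s ^ 2) ^ (-μ))) 1 := by
  have h1 := represents_rescale_binSeries (-ν) (-1) (s := 1) (by simp)
  have h2 := represents_rescale_binSeries ν (-t) (s := 1) (by simpa using ht.le)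
  have h3 := (represents_binSeries μ).evenLift t (s := 1)
    (fun z hz => norm_mul_sq_lt (by simpa using ht.le) hz)
  refine (h1.mul (h2.mul h3)).congr fun z _ => ?_
  simp

lemma represents_quadraticSeries {θ : ℂ} (hθ : ‖θ‖ < 1) (μ ν : ℂ) :
    Represents (quadraticSeries θ μ ν) (fun w => (1 - θ * w) ^ ν * (1 - 1 / 2 * w) ^ (-μ)) 1 := by
  have h1 := represents_rescale_binSeries (-ν) θ (s := 1) (by simpa using hθ.le)
  have h2 := represents_rescale_binSeries μ (1 / 2) (s := 1) (by norm_num)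
  exact (h1.mul h2).congr fun z _ => by simp

lemma exists_coeffBound_binSeries' (R : ℝ) : ∃ K : ℝ, 0 < K ∧ ∀ α : ℂ, ‖α‖ ≤ R →
    CoeffBound (binSeries α) K R := by
  obtain ⟨K, hK, h⟩ := exists_coeffBound_binSeries R
  exact ⟨K, hK, fun α hα => (h α hα).mono le_rfl (by linarith [Complex.re_le_norm α])⟩

lemma exists_coeffBound_quadraticSeries {θ : ℂ} (hθ : ‖θ‖ < 1) (R : ℝ) : ∃ K : ℝ, 0 < K ∧
    ∀ μ ν : ℂ, ‖μ‖ ≤ R → ‖ν‖ ≤ R → CoeffBound (quadraticSeries θ μ ν) K (-4) := by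
  obtain ⟨K, hK, h⟩ := exists_coeffBound_binSeries' R
  obtain ⟨K1, hK1, h1⟩ := exists_coeffBound_rescale hθ R (-4)
  obtain ⟨K2, hK2, h2⟩ := exists_coeffBound_rescale (show ‖(1 / 2 : ℂ)‖ < 1 by norm_num) R (-4)
  obtain ⟨K3, hK3, h3⟩ := exists_coeffBound_mul (show (-4 : ℝ) < -1 by norm_num) 4
  refine ⟨K3 * (K1 * K * (K2 * K)), by positivity, fun μ ν hμ hν => ?_⟩
  have := h3 (-4) (by norm_num) _ _ _ _ (h1 _ _ (h (-ν) (by simpa using hν))) (h2 _ _ (h μ hμ))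
  rwa [max_self] at this

lemma summable_of_coeffBound {φ : PowerSeries ℂ} {K α : ℝ} (h : CoeffBound φ K α) (hα : α < -1) :
    Summable fun k => ‖coeff k φ‖ :=
  ((summable_add_one_rpow hα).mul_left K).of_nonneg_of_le (fun _ => norm_nonneg _) h

lemma represents_quadraticInvSeries {θ κ : ℂ} (hθ : ‖θ‖ < 1) {s : ℝ} (h1 : s ≤ 1)
    (hκ : ‖κ‖ * s ^ 2 ≤ 1) (μ ν : ℂ) : Represents (quadraticInvSeries θ κ μ ν)
    (fun y => (1 + y) ^ (-ν) * ((1 - θ * (1 - (1 - κ * y ^ 2) ^ (1 / 2 : ℂ))) ^ ν *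
      (1 - 1 / 2 * (1 - (1 - κ * y ^ 2) ^ (1 / 2 : ℂ))) ^ (-μ))) s := by
  have a1 := represents_rescale_binSeries ν (-1) (s := s) (by simpa using h1)
  obtain ⟨K, -, hK⟩ := exists_coeffBound_quadraticSeries hθ (max ‖μ‖ ‖ν‖)
  have hsum := summable_of_coeffBound (hK μ ν (le_max_left _ _) (le_max_right _ _)) (by norm_num)
  have a2 := ((represents_quadraticSeries hθ μ ν).compOneSubSqrt hsum).evenLift κ
    (fun z hz => norm_mul_sq_lt hκ hz)
  refine (a1.mul a2).congr fun z _ => ?_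
  simp

lemma one_sub_X_mul_binSeries (α : ℂ) : (1 - X) * binSeries α = binSeries (α - 1) := by
  ext n
  rcases n with _ | n
  · rw [sub_mul, one_mul, map_sub, coeff_zero_X_mul]; simp [binSeries, binCoeff_zero]
  · rw [sub_mul, one_mul, map_sub, coeff_succ_X_mul]
    simp only [binSeries, coeff_mk]
    exact binCoeff_succ_sub α n

lemma one_add_X_mul_rescale_binSeries (α : ℂ) :
    (1 + X) * rescale (-1 : ℂ) (binSeries α) = rescale (-1 : ℂ) (binSeries (α - 1)) := by
  rw [← one_sub_X_mul_binSeries, map_mul, map_sub, map_one, rescale_X]; simp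

lemma CoeffBound.rescale_neg_one {φ : PowerSeries ℂ} {K α : ℝ} (h : CoeffBound φ K α) :
    CoeffBound (rescale (-1 : ℂ) φ) K α := by
  intro n
  rw [coeff_rescale, norm_mul, norm_pow]; simpa using h n

/-- Only (1+s)^ν is singular on the unit circle; the other factors have larger radius of
convergence, so their coefficients decay faster than any power. Multiplying by 1+X replaces ν by ν+1
in that factor and gains one power of n. -/
lemma exists_coeffBound_eulerSeries {t : ℂ} (ht : ‖t‖ < 1) (R : ℝ) : ∃ K : ℝ, 0 < K ∧
    ∀ μ ν : ℂ, ‖μ‖ ≤ R → ‖ν‖ ≤ R → CoeffBound (eulerSeries t μ ν) K (-ν.re - 1) ∧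
      CoeffBound ((1 + X) * eulerSeries t μ ν) K (-ν.re - 2) := by
  -- Low enough to lie below -1 and below every exponent -Re ν - 2 with |ν| ≤ R, so that the maximum
  -- in the product bound is always the exponent of the singular factor.
  set σ : ℝ := -(|R| + 3) with hσ
  have hσ1 : σ < -1 := by linarith [abs_nonneg R]
  obtain ⟨K, hK, h⟩ := exists_coeffBound_binSeries' R
  obtain ⟨K0, hK0, h0⟩ := exists_coeffBound_binSeries (R + 1)
  obtain ⟨K1, hK1, h1⟩ := exists_coeffBound_rescale (c := -t) (by simpa using ht) R σ
  obtain ⟨K2, hK2, h2⟩ := exists_coeffBound_evenLift ht R σ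
  obtain ⟨K3, hK3, h3⟩ := exists_coeffBound_mul hσ1 (|R| + 3)
  refine ⟨K3 * (K3 * (K1 * K * (K2 * K)) * K0), by positivity, fun μ ν hμ hν => ?_⟩
  have a1 := h3 σ (by rw [hσ, abs_neg, abs_of_nonneg (by positivity)]) _ _ _ _
    (h1 _ _ (h ν hν)) (h2 _ _ (h μ hμ))
  rw [max_self] at a1
  have hR : |R| = R := abs_of_nonneg ((norm_nonneg _).trans hν)
  have hre := abs_le.1 ((Complex.abs_re_le_norm ν).trans hν)
  have b1 := (h0 (-ν) (by rw [norm_neg]; linarith)).rescale_neg_one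
  have b2 := (h0 (-ν - 1) (by
    refine (norm_sub_le _ _).trans ?_; rw [norm_neg, norm_one]; linarith)).rescale_neg_one
  constructor
  · have := h3 ((-ν).re - 1) (by
      rw [Complex.neg_re, hR, abs_le]; constructor <;> linarith) _ _ _ _ a1 b1
    rw [max_eq_right (by rw [Complex.neg_re, hσ, hR]; linarith), mul_comm] at this
    simpa [eulerSeries] using this
  · have := h3 ((-ν - 1).re - 1) (by
      rw [Complex.sub_re, Complex.neg_re, hR, abs_le]; simp only [Complex.one_re]
      constructor <;> linarith) _ _ _ _ a1 b2
    rw [max_eq_right (by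
      rw [Complex.sub_re, Complex.neg_re, hσ, hR]; simp only [Complex.one_re]; linarith),
      mul_comm] at this
    rw [eulerSeries, ← mul_assoc, one_add_X_mul_rescale_binSeries]
    convert this using 1
    simp; ring

/-- For |κ| < 1 the square-root factor has its branch points outside the closed unit disc, and only
(1+y)^(-ν) determines the growth. -/
lemma exists_coeffBound_quadraticInvSeries {θ κ : ℂ} (hθ : ‖θ‖ < 1) (hκ : ‖κ‖ < 1) (R : ℝ) :
    ∃ K : ℝ, 0 < K ∧ ∀ μ ν : ℂ, ‖μ‖ ≤ R → ‖ν‖ ≤ R →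
      CoeffBound (quadraticInvSeries θ κ μ ν) K (ν.re - 1) := by
  set σ : ℝ := -(|R| + 3) with hσ
  have hσ1 : σ < -1 := by linarith [abs_nonneg R]
  obtain ⟨K0, hK0, h0⟩ := exists_coeffBound_binSeries R
  obtain ⟨K1, hK1, h1⟩ := exists_coeffBound_quadraticSeries hθ R
  obtain ⟨K2, hK2, h2⟩ := exists_coeffBound_compOneSubSqrt
  obtain ⟨K3, hK3, h3⟩ := exists_coeffBound_evenLift hκ (-(3 / 2)) σ
  obtain ⟨K4, hK4, h4⟩ := exists_coeffBound_mul hσ1 (|R| + 3)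
  refine ⟨K4 * (K3 * (K2 * K1) * K0), by positivity, fun μ ν hμ hν => ?_⟩
  have hR : |R| = R := abs_of_nonneg ((norm_nonneg _).trans hν)
  have hre := abs_le.1 ((Complex.abs_re_le_norm ν).trans hν)
  have a := h3 _ _ (h2 _ _ (h1 μ ν hμ hν)).1
  have := h4 (ν.re - 1) (by rw [hR, abs_le]; constructor <;> linarith) _ _ _ _ a
    (h0 ν hν).rescale_neg_one
  rw [max_eq_right (by rw [hσ, hR]; linarith), mul_comm] at this
  simpa [quadraticInvSeries] using this

/-- At κ = -1 the branch points ±i of √(1+y²) lie on the unit circle and contribute n^(-3/2). The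
factor 1+X² vanishes there and improves this to n^(-5/2). The contribution n^(Re ν-1) of y = -1 is
unaffected. -/
lemma exists_coeffBound_quadraticInvSeries_critical {θ : ℂ} (hθ : ‖θ‖ < 1) (R : ℝ) :
    ∃ K : ℝ, 0 < K ∧ ∀ μ ν : ℂ, ‖μ‖ ≤ R → ‖ν‖ ≤ R →
      CoeffBound (quadraticInvSeries θ (-1) μ ν) K (max (-(3 / 2)) (ν.re - 1)) ∧
      CoeffBound ((1 + X ^ 2) * quadraticInvSeries θ (-1) μ ν) K (max (-(5 / 2)) (ν.re - 1)) := by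
  obtain ⟨K0, hK0, h0⟩ := exists_coeffBound_binSeries R
  obtain ⟨K1, hK1, h1⟩ := exists_coeffBound_quadraticSeries hθ R
  obtain ⟨K2, hK2, h2⟩ := exists_coeffBound_compOneSubSqrt
  obtain ⟨K4, hK4, h4⟩ := exists_coeffBound_mul (show (-(3 / 2) : ℝ) < -1 by norm_num) (|R| + 3)
  obtain ⟨K5, hK5, h5⟩ := exists_coeffBound_mul (show (-(5 / 2) : ℝ) < -1 by norm_num) (|R| + 3)
  refine ⟨max (K4 * (K2 * K1 * 2 ^ (-(-(3 / 2) : ℝ)) * K0))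
    (K5 * (K2 * K1 * 2 ^ (-(-(5 / 2) : ℝ)) * K0)), by positivity, fun μ ν hμ hν => ?_⟩
  have hR : |R| = R := abs_of_nonneg ((norm_nonneg _).trans hν)
  have hre := abs_le.1 ((Complex.abs_re_le_norm ν).trans hν)
  have hb : |ν.re - 1| ≤ |R| + 3 := by rw [hR, abs_le]; constructor <;> linarith
  obtain ⟨c1, c2⟩ := h2 _ _ (h1 μ ν hμ hν)
  have d1 := c1.evenLift (by norm_num) (κ := -1) (by simp)
  have d2 := c2.evenLift (by norm_num) (κ := -1) (by simp)
  -- The factor 1+X² is the lift of 1-X under the substitution of -X², which brings in the improved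
  -- bound for the composition.
  have e : (1 + X ^ 2) * evenLift (-1) (compOneSubSqrt (quadraticSeries θ μ ν)) =
      evenLift (-1) ((1 - X) * compOneSubSqrt (quadraticSeries θ μ ν)) := by
    ext n
    rcases n with _ | _ | n
    · rw [add_mul, one_mul, map_add, sq, mul_assoc, coeff_zero_X_mul]
      have := coeff_evenLift_two_mul (-1) (compOneSubSqrt (quadraticSeries θ μ ν)) 0
      have h' := coeff_evenLift_two_mul (-1) ((1 - X) * compOneSubSqrt (quadraticSeries θ μ ν)) 0
      rw [mul_zero] at this h'
      rw [this, h', sub_mul, one_mul, map_sub, coeff_zero_X_mul]; simp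
    · rw [add_mul, one_mul, map_add, sq, mul_assoc, coeff_succ_X_mul, coeff_zero_X_mul,
        coeff_evenLift_of_not_even _ _ (by simp), coeff_evenLift_of_not_even _ _ (by simp), add_zero]
    · rw [← one_sub_mul_evenLift, add_mul, one_mul, map_add, sq, mul_assoc, coeff_succ_X_mul,
        coeff_succ_X_mul]; ring
  constructor
  · have := h4 _ hb _ _ _ _ d1 (h0 ν hν).rescale_neg_one
    rw [mul_comm (evenLift _ _)] at this
    exact this.mono (le_max_left _ _) le_rfl
  · have := h5 _ hb _ _ _ _ d2 (h0 ν hν).rescale_neg_one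
    rw [← e, mul_assoc, mul_comm (evenLift _ _)] at this
    exact this.mono (le_max_right _ _) le_rfl

end

noncomputable section

/-! ### The regularized hypergeometric series -/

lemma regHyp_eq_tsum (a b c t : ℂ) :
    regHyp a b c t = ∑' j : ℕ, pochDivGamma b c j * binCoeff a j * t ^ j := by
  refine tsum_congr fun j => ?_
  simp only [pochDivGamma, binCoeff]
  rw [div_mul_div_comm, mul_comm (poch b j)]

/-- One majorant valid on a whole ball of parameters gives convergence, boundedness and holomorphy
together. -/
lemma exists_summable_hyp_bound (R : ℝ) {ρ : ℝ} (h0 : 0 ≤ ρ) (h1 : ρ < 1) :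
    ∃ u : ℕ → ℝ, Summable u ∧ ∀ a b c t : ℂ, ‖a‖ ≤ R → ‖b‖ ≤ R → ‖c‖ ≤ R → ‖t‖ ≤ ρ →
      ∀ j, ‖pochDivGamma b c j * binCoeff a j * t ^ j‖ ≤ u j := by
  obtain ⟨K, hK, h⟩ := exists_norm_pochDivGamma_le (max R 1)
  -- The exponent cancels the polynomial growth 2R and R+1 of the two coefficient factors and leaves
  -- the summable exponent -2.
  obtain ⟨K', hK', h'⟩ := exists_pow_le_rpow h0 h1 (-2 - (2 * R + (R + 1)))
  refine ⟨fun j => K * K * K' * ((j : ℝ) + 1) ^ (-2 : ℝ),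
    (summable_add_one_rpow (by norm_num)).mul_left _, fun a b c t ha hb hc ht j => ?_⟩
  have hj : (0 : ℝ) < (j : ℝ) + 1 := by positivity
  have e1 := h b c (hb.trans (le_max_left _ _)) (hc.trans (le_max_left _ _)) j
  have e2 := h a 1 (ha.trans (le_max_left _ _)) (by simp) j
  rw [pochDivGamma_one] at e2
  have r1 : (b - c).re ≤ 2 * R := (Complex.re_le_norm _).trans ((norm_sub_le _ _).trans (by linarith))
  have r2 : (a - 1).re ≤ R + 1 :=
    (Complex.re_le_norm _).trans ((norm_sub_le _ _).trans (by simpa using ha))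
  rw [norm_mul, norm_mul, norm_pow]
  calc ‖pochDivGamma b c j‖ * ‖binCoeff a j‖ * ‖t‖ ^ j
      ≤ (K * ((j : ℝ) + 1) ^ (2 * R)) * (K * ((j : ℝ) + 1) ^ (R + 1)) *
        (K' * ((j : ℝ) + 1) ^ (-2 - (2 * R + (R + 1)))) := by
        gcongr
        · refine e1.trans ?_
          gcongr
          simp
        · refine e2.trans ?_
          gcongr
          simp
        · exact (pow_le_pow_left₀ (norm_nonneg _) ht j).trans (h' j)
    _ = _ := by
        have e : ((j : ℝ) + 1) ^ (2 * R) * ((j : ℝ) + 1) ^ (R + 1) *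
            ((j : ℝ) + 1) ^ (-2 - (2 * R + (R + 1))) = ((j : ℝ) + 1) ^ (-2 : ℝ) := by
          rw [← Real.rpow_add hj, ← Real.rpow_add hj]; congr 1; ring
        beta_reduce; rw [← e]; ring

lemma summable_regHyp (a b c : ℂ) {t : ℂ} (ht : ‖t‖ < 1) :
    Summable fun j : ℕ => pochDivGamma b c j * binCoeff a j * t ^ j := by
  obtain ⟨u, hu, h⟩ := exists_summable_hyp_bound (max ‖a‖ (max ‖b‖ ‖c‖)) (norm_nonneg t) ht
  exact hu.of_norm_bounded (h a b c t (by simp) (by simp) (by simp) le_rfl)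

lemma exists_norm_regHyp_le (R : ℝ) {t : ℂ} (ht : ‖t‖ < 1) :
    ∃ K : ℝ, 0 < K ∧ ∀ a b c : ℂ, ‖a‖ ≤ R → ‖b‖ ≤ R → ‖c‖ ≤ R → ‖regHyp a b c t‖ ≤ K := by
  obtain ⟨u, hu, h⟩ := exists_summable_hyp_bound R (norm_nonneg t) ht
  refine ⟨|∑' j, u j| + 1, by positivity, fun a b c ha hb hc => ?_⟩
  rw [regHyp_eq_tsum]
  refine (tsum_of_norm_bounded hu.hasSum (h a b c t ha hb hc le_rfl)).trans ?_
  linarith [le_abs_self (∑' j, u j)]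

lemma differentiable_pochDivGamma_right (j : ℕ) {U : Set ℂ} {b c : ℂ → ℂ}
    (hb : DifferentiableOn ℂ b U) (hc : DifferentiableOn ℂ c U) :
    DifferentiableOn ℂ (fun z => pochDivGamma (b z) (c z) j) U := by
  simp only [pochDivGamma, div_eq_mul_inv]
  exact ((differentiable_poch j).comp_differentiableOn hb).mul
    (Complex.differentiable_one_div_Gamma.comp_differentiableOn (hc.add_const _))

/-- Joint dependence on all four arguments is needed: continuation runs in (μ, ν) in general, but in
t for the terminating case. -/
theorem differentiableOn_regHyp {U : Set ℂ} (hU : IsOpen U) {a b c t : ℂ → ℂ}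
    (ha : DifferentiableOn ℂ a U) (hb : DifferentiableOn ℂ b U) (hc : DifferentiableOn ℂ c U)
    (ht : DifferentiableOn ℂ t U) (ht1 : ∀ z ∈ U, ‖t z‖ < 1) :
    DifferentiableOn ℂ (fun z => regHyp (a z) (b z) (c z) (t z)) U := by
  intro z₀ hz₀
  obtain ⟨ρ, hρ1, hρ2⟩ := exists_between (ht1 z₀ hz₀)
  set R := max ‖a z₀‖ (max ‖b z₀‖ ‖c z₀‖) + 1
  have hmem : U ∈ 𝓝 z₀ := hU.mem_nhds hz₀
  have ev : ∀ {f : ℂ → ℂ} {r : ℝ}, DifferentiableOn ℂ f U → ‖f z₀‖ < r → ∀ᶠ z in 𝓝 z₀, ‖f z‖ < r :=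
    fun hf h => (hf.continuousOn.continuousAt hmem).norm.eventually_lt_const h
  have hRa : ‖a z₀‖ < R := lt_add_of_le_of_pos (le_max_left _ _) one_pos
  have hRb : ‖b z₀‖ < R := lt_add_of_le_of_pos ((le_max_left _ _).trans (le_max_right _ _)) one_pos
  have hRc : ‖c z₀‖ < R := lt_add_of_le_of_pos ((le_max_right _ _).trans (le_max_right _ _)) one_pos
  have hev := (((ev ha hRa).and (ev hb hRb)).and ((ev hc hRc).and (ev ht hρ1))).and hmem
  obtain ⟨V, hV, hVo, hzV⟩ := eventually_nhds_iff.1 hev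
  obtain ⟨u, hu, h⟩ := exists_summable_hyp_bound R ((norm_nonneg _).trans hρ1.le) hρ2
  have hVU : V ⊆ U := fun z hz => (hV z hz).2
  have hd : DifferentiableOn ℂ (fun z => regHyp (a z) (b z) (c z) (t z)) V := by
    simp only [regHyp_eq_tsum]
    refine Complex.differentiableOn_tsum_of_summable_norm hu (fun j => ?_) hVo fun j z hz => ?_
    · refine DifferentiableOn.mul (DifferentiableOn.mul ?_ ?_) ((ht.mono hVU).pow j)
      · exact differentiable_pochDivGamma_right j (hb.mono hVU) (hc.mono hVU)
      · exact (differentiable_binCoeff j).comp_differentiableOn (ha.mono hVU)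
    · obtain ⟨⟨⟨h1, h2⟩, h3, h4⟩, -⟩ := hV z hz
      exact h _ _ _ _ h1.le h2.le h3.le h4.le j
  exact ((hd z₀ hzV).differentiableAt (hVo.mem_nhds hzV)).differentiableWithinAt

/-! ### Moments of the Euler kernel -/

/-- Up to normalization, `∫₀¹ s ^ (μ-ν+n-1) (1-s) ^ ν (1+ts) ^ ν ds`. -/
def eulerMoment (t μ ν : ℂ) (n : ℕ) : ℂ :=
  poch (μ - ν) n * regHyp (-ν) (μ - ν + n) (1 + μ + n) (-t)

/-- The series `∑ⱼ (b)ₙ₊ⱼ (δ)ⱼ tʲ / (Γ(c + n + j) j!)`. -/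
def shiftedHyp (b c δ t : ℂ) (n : ℕ) : ℂ :=
  ∑' j : ℕ, pochDivGamma b c (n + j) * binCoeff δ j * t ^ j

lemma pochDivGamma_shift (b c : ℂ) (n j : ℕ) :
    pochDivGamma b c (n + j) = poch b n * pochDivGamma (b + n) (c + n) j := by
  simp only [pochDivGamma, poch_add]
  push_cast
  rw [add_assoc]; ring

lemma shiftedHyp_eq (b c δ t : ℂ) (n : ℕ) :
    shiftedHyp b c δ t n = poch b n * regHyp δ (b + n) (c + n) t := by
  rw [shiftedHyp, regHyp_eq_tsum, ← tsum_mul_left]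
  refine tsum_congr fun j => ?_
  rw [pochDivGamma_shift]; ring

lemma eulerMoment_eq (t μ ν : ℂ) (n : ℕ) :
    eulerMoment t μ ν n = shiftedHyp (μ - ν) (1 + μ) (-ν) (-t) n := (shiftedHyp_eq ..).symm

lemma summable_shiftedHyp (b c δ : ℂ) {t : ℂ} (ht : ‖t‖ < 1) (n : ℕ) :
    Summable fun j : ℕ => pochDivGamma b c (n + j) * binCoeff δ j * t ^ j := by
  refine ((summable_regHyp δ (b + n) (c + n) ht).mul_left (poch b n)).congr fun j => ?_
  rw [pochDivGamma_shift]; ring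

lemma shiftedHyp_sub_succ (b c δ : ℂ) {t : ℂ} (ht : ‖t‖ < 1) (n : ℕ) :
    shiftedHyp b c δ t n - shiftedHyp b c δ t (n + 1) = (c - b) * shiftedHyp b (c + 1) δ t n := by
  rw [shiftedHyp, shiftedHyp, shiftedHyp, ← tsum_mul_left,
    ← (summable_shiftedHyp b c δ ht n).tsum_sub (summable_shiftedHyp b c δ ht (n + 1))]
  refine tsum_congr fun j => ?_
  have := pochDivGamma_sub_succ b c (n + j)
  rw [show n + 1 + j = n + j + 1 by ring]
  linear_combination binCoeff δ j * t ^ j * this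

lemma add_rpow_le_mul_rpow (n j : ℕ) {σ B : ℝ} (hσ : |σ| ≤ B) :
    (((n + j : ℕ) : ℝ) + 1) ^ σ ≤ ((n : ℝ) + 1) ^ σ * ((j : ℝ) + 1) ^ B := by
  have hB : 0 ≤ B := (abs_nonneg _).trans hσ
  have hn : (0 : ℝ) ≤ n := by positivity
  have hj : (0 : ℝ) ≤ j := by positivity
  have hj1 : (1 : ℝ) ≤ (j : ℝ) + 1 := by linarith
  push_cast
  rcases le_total 0 σ with h | h
  · calc ((n : ℝ) + j + 1) ^ σ ≤ (((n : ℝ) + 1) * (j + 1)) ^ σ := by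
          gcongr; nlinarith
      _ = ((n : ℝ) + 1) ^ σ * ((j : ℝ) + 1) ^ σ := Real.mul_rpow (by linarith) (by linarith)
      _ ≤ _ := by
          gcongr
          exact (le_abs_self σ).trans hσ
  · calc ((n : ℝ) + j + 1) ^ σ ≤ ((n : ℝ) + 1) ^ σ * 1 := by
          rw [mul_one]
          exact Real.rpow_le_rpow_of_nonpos (by linarith) (by linarith) h
      _ ≤ _ := by
          gcongr
          exact Real.one_le_rpow hj1 hB

lemma exists_norm_shiftedHyp_le (R : ℝ) {t : ℂ} (ht : ‖t‖ < 1) : ∃ K : ℝ, 0 < K ∧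
    ∀ b c δ : ℂ, ‖b‖ ≤ R → ‖c‖ ≤ R → ‖δ‖ ≤ R → ∀ n : ℕ,
      ‖shiftedHyp b c δ t n‖ ≤ K * ((n : ℝ) + 1) ^ (b - c).re := by
  obtain ⟨K, hK, h⟩ := exists_norm_pochDivGamma_le (max R 1)
  obtain ⟨K', hK', h'⟩ := exists_pow_le_rpow (norm_nonneg t) ht (-2 - (2 * R + (R + 1)))
  have hs := summable_add_one_rpow (show (-2 : ℝ) < -1 by norm_num)
  set Z := ∑' j : ℕ, ((j : ℝ) + 1) ^ (-2 : ℝ)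
  have hZ : 0 ≤ Z := tsum_nonneg fun n => by positivity
  refine ⟨K * K * K' * Z + 1, by positivity, fun b c δ hb hc hδ n => ?_⟩
  set σ := (b - c).re
  have hσ : |σ| ≤ 2 * R := (Complex.abs_re_le_norm _).trans ((norm_sub_le _ _).trans (by linarith))
  have hterm : ∀ j, ‖pochDivGamma b c (n + j) * binCoeff δ j * t ^ j‖ ≤
      K * K * K' * ((n : ℝ) + 1) ^ σ * ((j : ℝ) + 1) ^ (-2 : ℝ) := by
    intro j
    have hj : (0 : ℝ) < (j : ℝ) + 1 := by positivity
    have e1 := h b c (hb.trans (le_max_left _ _)) (hc.trans (le_max_left _ _)) (n + j)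
    have e2 := h δ 1 (hδ.trans (le_max_left _ _)) (by simp) j
    rw [pochDivGamma_one] at e2
    have r2 : (δ - 1).re ≤ R + 1 :=
      (Complex.re_le_norm _).trans ((norm_sub_le _ _).trans (by simpa using hδ))
    rw [norm_mul, norm_mul, norm_pow]
    calc ‖pochDivGamma b c (n + j)‖ * ‖binCoeff δ j‖ * ‖t‖ ^ j
        ≤ (K * (((n : ℝ) + 1) ^ σ * ((j : ℝ) + 1) ^ (2 * R))) * (K * ((j : ℝ) + 1) ^ (R + 1)) *
          (K' * ((j : ℝ) + 1) ^ (-2 - (2 * R + (R + 1)))) := by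
          gcongr
          · refine e1.trans ?_
            gcongr
            exact add_rpow_le_mul_rpow n j hσ
          · refine e2.trans ?_
            gcongr
            simp
          · exact h' j
      _ = _ := by
          have e : ((j : ℝ) + 1) ^ (2 * R) * ((j : ℝ) + 1) ^ (R + 1) *
              ((j : ℝ) + 1) ^ (-2 - (2 * R + (R + 1))) = ((j : ℝ) + 1) ^ (-2 : ℝ) := by
            rw [← Real.rpow_add hj, ← Real.rpow_add hj]; congr 1; ring
          rw [← e]; ring
  have := tsum_of_norm_bounded ((hs.mul_left (K * K * K' * ((n : ℝ) + 1) ^ σ)).hasSum) hterm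
  rw [tsum_mul_left] at this
  refine this.trans ?_
  have h0 : 0 ≤ ((n : ℝ) + 1) ^ σ := by positivity
  nlinarith

/-- Absorbing (μ-ν)ₙ into the series gives terms with b - c = -ν - 1, whence the first exponent. The
difference in n raises c by one, whence the second. -/
lemma exists_norm_eulerMoment_le (R : ℝ) {t : ℂ} (ht : ‖t‖ < 1) : ∃ K : ℝ, 0 < K ∧
    ∀ μ ν : ℂ, ‖μ‖ ≤ R → ‖ν‖ ≤ R → ∀ n : ℕ,
      ‖eulerMoment t μ ν n‖ ≤ K * ((n : ℝ) + 1) ^ (-ν.re - 1) ∧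
      ‖eulerMoment t μ ν n - eulerMoment t μ ν (n + 1)‖ ≤ K * ((n : ℝ) + 1) ^ (-ν.re - 2) := by
  have ht' : ‖-t‖ < 1 := by rwa [norm_neg]
  obtain ⟨K, hK, h⟩ := exists_norm_shiftedHyp_le (2 * R + 2) ht'
  refine ⟨K * (1 + |R| + 1), by positivity, fun μ ν hμ hν n => ?_⟩
  have hR : 0 ≤ R := (norm_nonneg _).trans hμ
  have b1 : ‖μ - ν‖ ≤ 2 * R + 2 := (norm_sub_le _ _).trans (by linarith)
  have b2 : ‖1 + μ‖ ≤ 2 * R + 2 := (norm_add_le _ _).trans (by rw [norm_one]; linarith)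
  have b3 : ‖1 + μ + 1‖ ≤ 2 * R + 2 :=
    (norm_add_le _ _).trans (by rw [norm_one]; linarith [norm_add_le 1 μ, norm_one (α := ℂ)])
  have b4 : ‖-ν‖ ≤ 2 * R + 2 := by rw [norm_neg]; linarith
  rw [eulerMoment_eq, eulerMoment_eq]
  constructor
  · refine (h _ _ _ b1 b2 b4 n).trans ?_
    have e : (μ - ν - (1 + μ)).re = -ν.re - 1 := by simp; ring
    rw [e]
    have : 0 ≤ ((n : ℝ) + 1) ^ (-ν.re - 1) := by positivity
    have := abs_nonneg R
    gcongr
    nlinarith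
  · rw [shiftedHyp_sub_succ _ _ _ ht', norm_mul]
    have e : (μ - ν - (1 + μ + 1)).re = -ν.re - 2 := by simp; ring
    have := h _ _ _ b1 b3 b4 n
    rw [e] at this
    have hn : ‖1 + μ - (μ - ν)‖ ≤ 1 + |R| + 1 := by
      rw [show 1 + μ - (μ - ν) = 1 + ν by ring]
      refine (norm_add_le _ _).trans ?_
      rw [norm_one]; linarith [le_abs_self R]
    calc _ ≤ (1 + |R| + 1) * (K * ((n : ℝ) + 1) ^ (-ν.re - 2)) := by gcongr
      _ = _ := by ring

lemma differentiable_eulerMoment {t : ℂ} (ht : ‖t‖ < 1) {μ ν : ℂ → ℂ} (hμ : Differentiable ℂ μ)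
    (hν : Differentiable ℂ ν) (n : ℕ) : Differentiable ℂ fun z => eulerMoment t (μ z) (ν z) n := by
  simp only [eulerMoment]
  refine ((differentiable_poch n).comp (hμ.sub hν)).mul ?_
  rw [← differentiableOn_univ]
  refine differentiableOn_regHyp isOpen_univ ?_ ?_ ?_ (differentiableOn_const _)
    fun _ _ => by rwa [norm_neg]
  all_goals fun_prop

end

noncomputable section

/-! ### Moments of the quadratic kernel -/

/-- Up to normalization, `∫₀¹ s ^ (μ-ν-1) (1-s²) ^ ν (1-ts²) ^ (-μ) (s / (1-ts²)) ^ n ds`. -/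
def quadraticMoment (t μ ν : ℂ) (n : ℕ) : ℂ :=
  poch (μ - ν) n / (2 ^ n * Complex.Gamma ((μ - ν + n + 1) / 2)) *
    regHyp (1 - (μ - ν + n) / 2) (ν + 1) ((μ - ν + n) / 2 + ν + 1) t

lemma differentiableOn_quadraticMoment {U : Set ℂ} (hU : IsOpen U) {t μ ν : ℂ → ℂ}
    (ht1 : ∀ z ∈ U, ‖t z‖ < 1) (ht : DifferentiableOn ℂ t U)
    (hμ : DifferentiableOn ℂ μ U) (hν : DifferentiableOn ℂ ν U) (n : ℕ) :
    DifferentiableOn ℂ (fun z => quadraticMoment (t z) (μ z) (ν z) n) U := by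
  simp only [quadraticMoment, div_eq_mul_inv, mul_inv]
  refine DifferentiableOn.mul (DifferentiableOn.mul ?_ (DifferentiableOn.const_mul ?_ _)) ?_
  · exact (differentiable_poch n).comp_differentiableOn (hμ.sub hν)
  · refine Complex.differentiable_one_div_Gamma.comp_differentiableOn ?_
    fun_prop
  · refine differentiableOn_regHyp hU ?_ ?_ ?_ ht ht1
    all_goals fun_prop

/-- The Gamma quotient in `quadraticMoment`. -/
def gammaFactor (a ν : ℂ) (n : ℕ) : ℂ :=
  poch a n / (2 ^ n * Complex.Gamma ((a + n + 1) / 2) * Complex.Gamma ((a + n) / 2 + ν + 1))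

lemma poch_two_mul (a : ℂ) (m : ℕ) :
    poch a (2 * m) = 4 ^ m * poch (a / 2) m * poch ((a + 1) / 2) m := by
  induction m with
  | zero => simp [poch_zero]
  | succ m ih =>
    rw [show 2 * (m + 1) = 2 * m + 1 + 1 by ring, poch_succ, poch_succ, ih, poch_succ, poch_succ]
    push_cast; ring

/-- The duplication of the Pochhammer symbol cancels the power of 2. The first quotient has equal
parameters and is bounded; the second carries the growth exponent -Re ν - 1. -/
lemma gammaFactor_even (a ν : ℂ) (m : ℕ) : gammaFactor a ν (2 * m) =
    pochDivGamma ((a + 1) / 2) ((a + 1) / 2) m * pochDivGamma (a / 2) (a / 2 + ν + 1) m := by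
  simp only [gammaFactor, pochDivGamma, poch_two_mul]
  push_cast
  rw [show (a + 2 * m + 1) / 2 = (a + 1) / 2 + m by ring,
    show (a + 2 * m) / 2 + ν + 1 = a / 2 + ν + 1 + m by ring, pow_mul]
  norm_num only
  simp only [div_eq_mul_inv, mul_inv]
  have : (4 : ℂ) ^ m * ((4 : ℂ) ^ m)⁻¹ = 1 := mul_inv_cancel₀ (pow_ne_zero _ (by norm_num))
  linear_combination (poch (a * 2⁻¹) m * poch ((a + 1) * 2⁻¹) m *
    (Complex.Gamma ((a + 1) * 2⁻¹ + m))⁻¹ * (Complex.Gamma (a * 2⁻¹ + ν + 1 + m))⁻¹) * this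

lemma gammaFactor_odd (a ν : ℂ) (m : ℕ) : gammaFactor a ν (2 * m + 1) =
    a / 2 * (pochDivGamma (a / 2 + 1) (a / 2 + 1) m *
      pochDivGamma ((a + 1) / 2) ((a + 1) / 2 + ν + 1) m) := by
  simp only [gammaFactor, pochDivGamma, poch_succ_left, poch_two_mul]
  push_cast
  rw [show (a + (2 * m + 1) + 1) / 2 = a / 2 + 1 + m by ring,
    show (a + (2 * m + 1)) / 2 + ν + 1 = (a + 1) / 2 + ν + 1 + m by ring, pow_succ, pow_mul,
    show (a + 1 + 1) / 2 = a / 2 + 1 by ring]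
  norm_num only
  simp only [div_eq_mul_inv, mul_inv]
  have : (4 : ℂ) ^ m * ((4 : ℂ) ^ m)⁻¹ = 1 := mul_inv_cancel₀ (pow_ne_zero _ (by norm_num))
  linear_combination (a * 2⁻¹ * poch (a * 2⁻¹ + 1) m * poch ((a + 1) * 2⁻¹) m *
    (Complex.Gamma (a * 2⁻¹ + 1 + m))⁻¹ * (Complex.Gamma ((a + 1) * 2⁻¹ + ν + 1 + m))⁻¹) * this

/-- The relative change over two steps is O(1/n). Step two is natural because n enters the Gamma
arguments through n/2. -/
lemma gammaFactor_add_two (a ν : ℂ) (n : ℕ) :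
    gammaFactor a ν (n + 2) * (a + n + 2 * ν + 2) = gammaFactor a ν n * (a + n) := by
  simp only [gammaFactor, div_eq_mul_inv, mul_inv]
  rw [inv_Gamma_eq ((a + n + 1) * 2⁻¹), inv_Gamma_eq ((a + n) * 2⁻¹ + ν + 1), poch_succ, poch_succ,
    pow_succ, pow_succ]
  push_cast
  rw [show (a + (n + 2) + 1) * 2⁻¹ = (a + n + 1) * 2⁻¹ + 1 by ring,
    show (a + (n + 2)) * 2⁻¹ + ν + 1 = (a + n) * 2⁻¹ + ν + 1 + 1 by ring, mul_inv, mul_inv]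
  ring

lemma rpow_half_le {m n : ℕ} (h1 : m ≤ n) (h2 : n ≤ 2 * m + 1) {τ B : ℝ} (hτ : |τ| ≤ B) :
    ((m : ℝ) + 1) ^ τ ≤ 2 ^ B * ((n : ℝ) + 1) ^ τ := by
  have hB : 0 ≤ B := (abs_nonneg _).trans hτ
  have h1' : (m : ℝ) ≤ n := by exact_mod_cast h1
  have h2' : (n : ℝ) ≤ 2 * m + 1 := by exact_mod_cast h2
  rcases le_total 0 τ with h | h
  · calc ((m : ℝ) + 1) ^ τ ≤ 1 * ((n : ℝ) + 1) ^ τ := by rw [one_mul]; gcongr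
      _ ≤ _ := by
        gcongr
        exact Real.one_le_rpow (by norm_num) hB
  · calc ((m : ℝ) + 1) ^ τ ≤ (((n : ℝ) + 1) / 2) ^ τ :=
          Real.rpow_le_rpow_of_nonpos (by positivity) (by linarith) h
      _ = 2 ^ (-τ) * ((n : ℝ) + 1) ^ τ := by
          rw [Real.div_rpow (by positivity) (by norm_num), Real.rpow_neg (by norm_num)]; ring
      _ ≤ _ := by
          gcongr
          · norm_num
          · exact (neg_le_abs τ).trans hτ

lemma exists_norm_gammaFactor_le (R : ℝ) : ∃ K : ℝ, 0 < K ∧ ∀ a ν : ℂ, ‖a‖ ≤ R → ‖ν‖ ≤ R →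
    ∀ n : ℕ, ‖gammaFactor a ν n‖ ≤ K * ((n : ℝ) + 1) ^ (-ν.re - 1) := by
  obtain ⟨K, hK, h⟩ := exists_norm_pochDivGamma_le (2 * R + 2)
  refine ⟨(|R| + 1) * (K * (K * 2 ^ (R + 1))), by positivity, fun a ν ha hν n => ?_⟩
  have hR : 0 ≤ R := (norm_nonneg _).trans ha
  have hre := abs_le.1 ((Complex.abs_re_le_norm ν).trans hν)
  have hτ : |-ν.re - 1| ≤ R + 1 := by rw [abs_le]; constructor <;> linarith
  have n1 : ‖a / 2‖ ≤ R / 2 := by rw [norm_div]; norm_num; linarith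
  have n2 : ‖(a + 1) / 2‖ ≤ (R + 1) / 2 := by
    rw [norm_div]; norm_num; linarith [norm_add_le a 1, norm_one (α := ℂ)]
  have n3 : ∀ z : ℂ, ‖z‖ ≤ (R + 1) / 2 → ‖z + ν + 1‖ ≤ 2 * R + 2 := fun z hz => by
    linarith [norm_add_le (z + ν) 1, norm_add_le z ν, norm_one (α := ℂ)]
  have n4 : ‖a / 2 + 1‖ ≤ 2 * R + 2 := by linarith [norm_add_le (a / 2) 1, norm_one (α := ℂ)]
  have hR1 : (1 : ℝ) ≤ |R| + 1 := by simp
  rcases Nat.even_or_odd' n with ⟨m, rfl | rfl⟩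
  · have e1 := h ((a + 1) / 2) ((a + 1) / 2) (by linarith) (by linarith) m
    have e2 := h (a / 2) (a / 2 + ν + 1) (by linarith) (n3 _ (by linarith)) m
    rw [sub_self, Complex.zero_re, Real.rpow_zero, mul_one] at e1
    rw [show (a / 2 - (a / 2 + ν + 1)).re = -ν.re - 1 by simp; ring] at e2
    rw [gammaFactor_even, norm_mul]
    calc _ ≤ K * (K * ((m : ℝ) + 1) ^ (-ν.re - 1)) := by gcongr
      _ ≤ K * (K * (2 ^ (R + 1) * (((2 * m : ℕ) : ℝ) + 1) ^ (-ν.re - 1))) := by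
        gcongr
        exact rpow_half_le (by omega) (by omega) hτ
      _ = 1 * (K * (K * 2 ^ (R + 1))) * (((2 * m : ℕ) : ℝ) + 1) ^ (-ν.re - 1) := by ring
      _ ≤ _ := by gcongr
  · have e1 := h (a / 2 + 1) (a / 2 + 1) n4 n4 m
    have e2 := h ((a + 1) / 2) ((a + 1) / 2 + ν + 1) (by linarith) (n3 _ n2) m
    rw [sub_self, Complex.zero_re, Real.rpow_zero, mul_one] at e1
    rw [show ((a + 1) / 2 - ((a + 1) / 2 + ν + 1)).re = -ν.re - 1 by
      rw [show (a + 1) / 2 - ((a + 1) / 2 + ν + 1) = -ν - 1 by ring]; simp] at e2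
    rw [gammaFactor_odd, norm_mul, norm_mul]
    have n5 : ‖a / 2‖ ≤ |R| + 1 := by linarith [le_abs_self R]
    calc _ ≤ (|R| + 1) * (K * (K * ((m : ℝ) + 1) ^ (-ν.re - 1))) := by gcongr
      _ ≤ (|R| + 1) * (K * (K * (2 ^ (R + 1) * (((2 * m + 1 : ℕ) : ℝ) + 1) ^ (-ν.re - 1)))) := by
        gcongr
        exact rpow_half_le (by omega) (by omega) hτ
      _ = _ := by ring

/-- `Γ(c) F(1-A, ν+1; c; t) / Γ(c)` written with Pochhammer quotients. -/
def pochQuotientHyp (A c δ t : ℂ) : ℂ :=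
  ∑' j : ℕ, poch (1 - A) j / poch c j * binCoeff δ j * t ^ j

lemma poch_ne_zero {c : ℂ} (hc : 0 < c.re) (j : ℕ) : poch c j ≠ 0 := by
  induction j with
  | zero => simp [poch_zero]
  | succ j ih =>
    rw [poch_succ]
    refine mul_ne_zero ih fun h => ?_
    have := congrArg Complex.re h
    simp at this
    have : (0 : ℝ) ≤ j := by positivity
    linarith

/-- Here n moves parameters inside the hypergeometric series, so the size is separated from a factor
that stays bounded. Dividing by Γ(c) requires c to avoid poles, which holds for large n. -/
lemma quadraticMoment_eq_gammaFactor_mul {t μ ν : ℂ} {n : ℕ}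
    (hc : 0 < ((μ - ν + n) / 2 + ν + 1).re) :
    quadraticMoment t μ ν n = gammaFactor (μ - ν) ν n *
      pochQuotientHyp ((μ - ν + n) / 2) ((μ - ν + n) / 2 + ν + 1) (ν + 1) t := by
  rw [quadraticMoment, gammaFactor, pochQuotientHyp, regHyp, ← tsum_mul_left, ← tsum_mul_left]
  refine tsum_congr fun j => ?_
  rw [Gamma_add_nat _ hc]
  simp only [binCoeff, div_eq_mul_inv, mul_inv]
  ring

/-- The domain on which the Pochhammer quotients grow slowly. -/
lemma exists_nat_norm_le {ε : ℝ} (hε : 0 < ε) (R : ℝ) : ∃ n₀ : ℕ, ∀ n ≥ n₀, ∀ a ν : ℂ,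
    ‖a‖ ≤ R → ‖ν‖ ≤ R → 0 < ((a + n) / 2 + ν + 1).re ∧
      ∀ i : ℕ, ((n : ℝ) + 1) / 4 ≤ ‖(a + n) / 2 + ν + 1 + i‖ ∧ 1 ≤ ‖(a + n) / 2 + ν + 1 + i‖ ∧
        ‖1 - (a + n) / 2 + i‖ ≤ (1 + ε) * ‖(a + n) / 2 + ν + 1 + i‖ := by
  refine ⟨⌈8 * |R| + 4 + 2 * (|R| + 2 * |R| * (1 + ε)) / ε⌉₊, fun n hn a ν ha hν => ?_⟩
  have hn' : 8 * |R| + 4 + 2 * (|R| + 2 * |R| * (1 + ε)) / ε ≤ n := (Nat.le_ceil _).trans (by exact_mod_cast hn)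
  have hR : |R| = R := abs_of_nonneg ((norm_nonneg _).trans hν)
  rw [hR] at hn'
  have hR0 : 0 ≤ R := hR ▸ abs_nonneg R
  have hq : 0 ≤ 2 * (R + 2 * R * (1 + ε)) / ε := by positivity
  have hare := abs_le.1 ((Complex.abs_re_le_norm a).trans ha)
  have hνre := abs_le.1 ((Complex.abs_re_le_norm ν).trans hν)
  have hre : ∀ i : ℕ, ((a + n) / 2 + ν + 1 + i).re = (a.re + n) / 2 + ν.re + 1 + i := by
    intro i; simp
  have hlow : ∀ i : ℕ, (n : ℝ) / 2 + i + 1 - 2 * R ≤ ‖(a + n) / 2 + ν + 1 + i‖ := by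
    intro i
    refine le_trans ?_ (Complex.re_le_norm _)
    rw [hre]; linarith
  refine ⟨?_, fun i => ?_⟩
  · have := hre 0
    simp only [Nat.cast_zero, add_zero] at this
    rw [this]; linarith
  have hi : (0 : ℝ) ≤ i := by positivity
  refine ⟨le_trans ?_ (hlow i), le_trans ?_ (hlow i), ?_⟩
  · linarith
  · linarith
  · have h1 : ‖1 - (a + n) / 2 + i‖ ≤ n / 2 + i + 1 + R := by
      have e : 1 - (a + n) / 2 + i = ((1 + i : ℕ) : ℂ) - (n : ℂ) / 2 - a / 2 := by push_cast; ring
      rw [e]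
      have h3 := norm_sub_le (((1 + i : ℕ) : ℂ) - (n : ℂ) / 2) (a / 2)
      have h4 := norm_sub_le ((1 + i : ℕ) : ℂ) ((n : ℂ) / 2)
      rw [Complex.norm_natCast, norm_div, Complex.norm_natCast] at h4
      rw [norm_div] at h3
      push_cast at h3 h4 ⊢
      norm_num at h3 h4
      linarith
    have h2 : 2 * (R + 2 * R * (1 + ε)) / ε ≤ n := by linarith
    rw [div_le_iff₀ hε] at h2
    calc _ ≤ _ := h1
      _ ≤ (1 + ε) * (n / 2 + i + 1 - 2 * R) := by nlinarith
      _ ≤ _ := by gcongr; exact hlow i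

lemma norm_poch_div_le {A c : ℂ} {ε : ℝ} (hε : 0 < ε) (h1 : ∀ i : ℕ, 1 ≤ ‖c + i‖)
    (h : ∀ i : ℕ, ‖1 - A + i‖ ≤ (1 + ε) * ‖c + i‖) (j : ℕ) :
    ‖poch (1 - A) j / poch c j‖ ≤ (1 + ε) ^ j := by
  induction j with
  | zero => simp [poch_zero]
  | succ j ih =>
    rw [poch_succ, poch_succ, mul_div_mul_comm, norm_mul, pow_succ]
    have : ‖(1 - A + j) / (c + j)‖ ≤ 1 + ε := by
      rw [norm_div, div_le_iff₀ (by linarith [h1 j])]; exact h j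
    gcongr

/-- Raising A and c together by one is the step n → n+2. The exact difference shows a relative
change of order i²/n, because c - A = ν + 1 does not depend on n. -/
lemma poch_div_shift_sub {A c : ℂ} (hc : 0 < c.re) (i : ℕ) :
    poch (1 - (A + 1)) (i + 1) / poch (c + 1) (i + 1) - poch (1 - A) (i + 1) / poch c (i + 1) =
      -(poch (1 - A) i / poch c i * ((i + 1) * (c - A + i + 1) / ((c + i) * (c + i + 1)))) := by
  have hne : ∀ i : ℕ, c + i ≠ 0 := by
    intro i h
    have := congrArg Complex.re h
    simp at this
    have : (0 : ℝ) ≤ i := by positivity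
    linarith
  have h0 : c ≠ 0 := by simpa using hne 0
  have h1 := hne i
  have h2 : c + i + 1 ≠ 0 := by have := hne (i + 1); push_cast at this; rwa [← add_assoc] at this
  have hp := poch_ne_zero hc i
  have hp1 : poch (c + 1) (i + 1) ≠ 0 := poch_ne_zero (by simp; linarith) _
  have e1 : poch (1 - (A + 1)) (i + 1) = -A * poch (1 - A) i := by
    rw [poch_succ_left]; congr 2 <;> ring
  have e2 : poch (c + 1) (i + 1) = poch c i * (c + i) * (c + i + 1) / c := by
    rw [eq_div_iff h0, mul_comm, ← poch_succ_left, poch_succ, poch_succ]; push_cast; ring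
  rw [e1, e2, poch_succ, poch_succ]
  field_simp
  ring

lemma exists_norm_le_of_eventually {ι : Type*} {S : Set ι} {u : ι → ℕ → ℂ} {τ : ι → ℝ} {B K : ℝ}
    {n₀ : ℕ} (hK : 0 < K) (hτ : ∀ p ∈ S, |τ p| ≤ B) (hfin : ∀ n, ∃ C : ℝ, ∀ p ∈ S, ‖u p n‖ ≤ C)
    (h : ∀ p ∈ S, ∀ n ≥ n₀, ‖u p n‖ ≤ K * ((n : ℝ) + 1) ^ τ p) :
    ∃ K' : ℝ, 0 < K' ∧ ∀ p ∈ S, ∀ n, ‖u p n‖ ≤ K' * ((n : ℝ) + 1) ^ τ p := by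
  choose C hC using hfin
  set M := ∑ n ∈ Finset.range n₀, |C n| * ((n : ℝ) + 1) ^ B with hM
  have hM0 : 0 ≤ M := Finset.sum_nonneg fun _ _ => by positivity
  refine ⟨K + M, by positivity, fun p hp n => ?_⟩
  have hn : (0 : ℝ) < (n : ℝ) + 1 := by positivity
  rcases le_or_gt n₀ n with hnn | hnn
  · refine (h p hp n hnn).trans ?_
    gcongr
    linarith
  · have h1 : 1 ≤ ((n : ℝ) + 1) ^ B * ((n : ℝ) + 1) ^ τ p := by
      rw [← Real.rpow_add hn]
      exact Real.one_le_rpow (by simp) (by linarith [neg_abs_le (τ p), hτ p hp])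
    calc ‖u p n‖ ≤ |C n| * 1 := by rw [mul_one]; exact (hC n p hp).trans (le_abs_self _)
      _ ≤ |C n| * (((n : ℝ) + 1) ^ B * ((n : ℝ) + 1) ^ τ p) := by gcongr
      _ = (|C n| * ((n : ℝ) + 1) ^ B) * ((n : ℝ) + 1) ^ τ p := by ring
      _ ≤ (K + M) * ((n : ℝ) + 1) ^ τ p := by
        gcongr
        have := Finset.single_le_sum (f := fun n : ℕ => |C n| * ((n : ℝ) + 1) ^ B)
          (fun _ _ => by positivity) (Finset.mem_range.2 hnn)
        linarith

lemma exists_norm_quadraticMoment_le_const (R : ℝ) {t : ℂ} (ht : ‖t‖ < 1) (n : ℕ) :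
    ∃ K : ℝ, ∀ μ ν : ℂ, ‖μ‖ ≤ R → ‖ν‖ ≤ R → ‖quadraticMoment t μ ν n‖ ≤ K := by
  set R' := 3 * |R| + n + 2
  obtain ⟨K1, hK1, h1⟩ := exists_norm_regHyp_le R' ht
  obtain ⟨K2, hK2, h2⟩ := exists_norm_pochDivGamma_le R'
  refine ⟨K2 * ((n : ℝ) + 1) ^ (2 * |R| + 1) * n.factorial * (1 * (K2 * 1)) * K1,
    fun μ ν hμ hν => ?_⟩
  have hR : |R| = R := abs_of_nonneg ((norm_nonneg _).trans hν)
  have hR0 : 0 ≤ R := hR ▸ abs_nonneg R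
  have hn : (0 : ℝ) ≤ n := by positivity
  have hR' : R' = 3 * R + n + 2 := by simp only [R', hR]
  have a1 : ‖μ - ν‖ ≤ 2 * R := (norm_sub_le _ _).trans (by linarith)
  have a2 : ‖(μ - ν + n) / 2‖ ≤ (2 * R + n) / 2 := by
    rw [norm_div]
    have := norm_add_le (μ - ν) n
    rw [Complex.norm_natCast] at this
    norm_num; linarith
  have a3 : ‖1 - (μ - ν + n) / 2‖ ≤ R' := by
    linarith [norm_sub_le 1 ((μ - ν + n) / 2), norm_one (α := ℂ)]
  have a4 : ‖ν + 1‖ ≤ R' := by linarith [norm_add_le ν 1, norm_one (α := ℂ)]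
  have a5 : ‖(μ - ν + n) / 2 + ν + 1‖ ≤ R' := by
    linarith [norm_add_le ((μ - ν + n) / 2 + ν) 1, norm_add_le ((μ - ν + n) / 2) ν,
      norm_one (α := ℂ)]
  have a6 : ‖(μ - ν + n + 1) / 2‖ ≤ R' := by
    rw [add_div]
    have h3 := norm_add_le ((μ - ν + n) / 2) (1 / 2)
    have h4 : ‖(1 / 2 : ℂ)‖ ≤ 1 := by norm_num
    linarith
  have p1 : ‖poch (μ - ν) n‖ ≤ K2 * ((n : ℝ) + 1) ^ (2 * |R| + 1) * n.factorial := by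
    have := h2 (μ - ν) 1 (by linarith) (by rw [norm_one]; linarith) n
    rw [pochDivGamma_one, binCoeff, norm_div, Complex.norm_natCast,
      div_le_iff₀ (by positivity)] at this
    refine this.trans ?_
    gcongr
    · simp
    · rw [hR]
      have := (Complex.re_le_norm (μ - ν - 1)).trans (norm_sub_le _ _)
      rw [norm_one] at this; linarith
  have p2 : ‖(Complex.Gamma ((μ - ν + n + 1) / 2))⁻¹‖ ≤ K2 * 1 := by
    have := h2 1 ((μ - ν + n + 1) / 2) (by rw [norm_one]; linarith) a6 0
    rw [pochDivGamma, poch_zero, Nat.cast_zero, Nat.cast_zero, add_zero, one_div, zero_add, Real.one_rpow] at this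
    exact this
  have p3 : ‖((2 : ℂ) ^ n)⁻¹‖ ≤ 1 := by
    rw [norm_inv, norm_pow]
    exact inv_le_one_of_one_le₀ (one_le_pow₀ (by norm_num))
  rw [quadraticMoment, norm_mul, div_eq_mul_inv, norm_mul, mul_inv, norm_mul]
  gcongr
  exact h1 _ _ _ a3 a4 a5

/-- For large n the quotient (1-A)ⱼ/(c)ⱼ is at most (1+ε)^j, so the hypergeometric factor is bounded
uniformly, and its change over two steps is O(1/n). The Gamma factor behaves likewise, with size
n^(-Re ν-1). The remaining n are covered by a constant. -/
lemma exists_norm_quadraticMoment_le (R : ℝ) {t : ℂ} (ht : ‖t‖ < 1) : ∃ K : ℝ, 0 < K ∧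
    ∀ μ ν : ℂ, ‖μ‖ ≤ R → ‖ν‖ ≤ R → ∀ n : ℕ,
      ‖quadraticMoment t μ ν n‖ ≤ K * ((n : ℝ) + 1) ^ (-ν.re - 1) ∧
      ‖quadraticMoment t μ ν n - quadraticMoment t μ ν (n + 2)‖ ≤
        K * ((n : ℝ) + 1) ^ (-ν.re - 2) := by
  obtain ⟨ρ, hρ1, hρ2⟩ := exists_between ht
  have hρ0 : 0 < ρ := (norm_nonneg t).trans_lt hρ1
  obtain ⟨ε, hε, hερ⟩ : ∃ ε : ℝ, 0 < ε ∧ (1 + ε) * ‖t‖ ≤ ρ := by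
    refine ⟨(ρ - ‖t‖), by linarith, ?_⟩
    nlinarith [norm_nonneg t]
  obtain ⟨n₀, hn₀⟩ := exists_nat_norm_le hε (2 * |R|)
  obtain ⟨KG, hKG, hG⟩ := exists_norm_gammaFactor_le (2 * |R|)
  obtain ⟨KB, hKB, hB⟩ := exists_norm_pochDivGamma_le (|R| + 1)
  obtain ⟨Kρ, hKρ, hρ⟩ := exists_pow_le_rpow hρ0.le hρ2 (-2 - (|R| + 2))
  have hs := summable_add_one_rpow (show (-2 : ℝ) < -1 by norm_num)
  set Z := ∑' j : ℕ, ((j : ℝ) + 1) ^ (-2 : ℝ)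
  have hZ : 0 ≤ Z := tsum_nonneg fun n => by positivity
  -- The additional factor (j+1)^(-2) is held in reserve for the factor quadratic in j that appears
  -- in the difference estimate.
  have hbin : ∀ ν : ℂ, ‖ν‖ ≤ |R| → ∀ j : ℕ, ‖binCoeff (ν + 1) j‖ * ρ ^ j ≤
      KB * Kρ * (((j : ℝ) + 1) ^ (-2 : ℝ) * (((j : ℝ) + 1) ^ 2)⁻¹) := by
    intro ν hν j
    have hj : (0 : ℝ) < (j : ℝ) + 1 := by positivity
    have := hB (ν + 1) 1 ((norm_add_le _ _).trans (by rw [norm_one]; linarith)) (by simp) j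
    rw [pochDivGamma_one, add_sub_cancel_right] at this
    calc _ ≤ (KB * ((j : ℝ) + 1) ^ |R|) * (Kρ * ((j : ℝ) + 1) ^ (-2 - (|R| + 2))) := by
          gcongr
          · refine this.trans ?_
            gcongr
            · simp
            · exact (Complex.re_le_norm _).trans hν
          · exact hρ j
      _ = _ := by
          have e : ((j : ℝ) + 1) ^ |R| * ((j : ℝ) + 1) ^ (-2 - (|R| + 2)) =
              ((j : ℝ) + 1) ^ (-2 : ℝ) * (((j : ℝ) + 1) ^ 2)⁻¹ := by
            rw [← Real.rpow_natCast (_ + 1) 2, ← Real.rpow_neg hj.le, ← Real.rpow_add hj,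
              ← Real.rpow_add hj]
            congr 1; push_cast; ring
          linear_combination KB * Kρ * e
  -- the hypergeometric factor
  have hterm : ∀ n ≥ n₀, ∀ μ ν : ℂ, ‖μ‖ ≤ R → ‖ν‖ ≤ R → ∀ j : ℕ,
      ‖poch (1 - (μ - ν + n) / 2) j / poch ((μ - ν + n) / 2 + ν + 1) j * binCoeff (ν + 1) j * t ^ j‖ ≤
        KB * Kρ * (((j : ℝ) + 1) ^ (-2 : ℝ) * (((j : ℝ) + 1) ^ 2)⁻¹) := by
    intro n hn μ ν hμ hν j
    have hR : |R| = R := abs_of_nonneg ((norm_nonneg _).trans hν)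
    obtain ⟨-, hi⟩ := hn₀ n hn (μ - ν) ν (by rw [hR]; exact (norm_sub_le _ _).trans (by linarith))
      (by linarith [abs_nonneg R])
    refine le_trans ?_ (hbin ν (by rwa [hR]) j)
    rw [norm_mul, norm_mul, norm_pow]
    calc _ ≤ (1 + ε) ^ j * ‖binCoeff (ν + 1) j‖ * ‖t‖ ^ j := by
          gcongr
          exact norm_poch_div_le hε (fun i => (hi i).2.1) (fun i => (hi i).2.2) j
      _ = ‖binCoeff (ν + 1) j‖ * ((1 + ε) * ‖t‖) ^ j := by rw [mul_pow]; ring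
      _ ≤ _ := by gcongr
  have hinv : ∀ j : ℕ, (((j : ℝ) + 1) ^ 2)⁻¹ ≤ 1 := fun j =>
    inv_le_one_of_one_le₀ (one_le_pow₀ (by simp))
  have hterm' : ∀ n ≥ n₀, ∀ μ ν : ℂ, ‖μ‖ ≤ R → ‖ν‖ ≤ R → ∀ j : ℕ,
      ‖poch (1 - (μ - ν + n) / 2) j / poch ((μ - ν + n) / 2 + ν + 1) j * binCoeff (ν + 1) j * t ^ j‖ ≤
        KB * Kρ * ((j : ℝ) + 1) ^ (-2 : ℝ) := by
    intro n hn μ ν hμ hν j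
    refine (hterm n hn μ ν hμ hν j).trans ?_
    have : 0 ≤ ((j : ℝ) + 1) ^ (-2 : ℝ) := by positivity
    gcongr
    exact mul_le_of_le_one_right this (hinv j)
  have hF : ∀ n ≥ n₀, ∀ μ ν : ℂ, ‖μ‖ ≤ R → ‖ν‖ ≤ R →
      ‖pochQuotientHyp ((μ - ν + n) / 2) ((μ - ν + n) / 2 + ν + 1) (ν + 1) t‖ ≤ KB * Kρ * Z := by
    intro n hn μ ν hμ hν
    have := tsum_of_norm_bounded (hs.mul_left (KB * Kρ)).hasSum (hterm' n hn μ ν hμ hν)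
    rwa [tsum_mul_left] at this
  have hdiff : ∀ n ≥ n₀, ∀ μ ν : ℂ, ‖μ‖ ≤ R → ‖ν‖ ≤ R →
      ‖pochQuotientHyp ((μ - ν + n) / 2) ((μ - ν + n) / 2 + ν + 1) (ν + 1) t -
        pochQuotientHyp ((μ - ν + (n + 2 : ℕ)) / 2) ((μ - ν + (n + 2 : ℕ)) / 2 + ν + 1) (ν + 1) t‖ ≤
        4 * (|R| + 2) * (KB * Kρ * Z) / (n + 1) := by
    intro n hn μ ν hμ hν
    have hR : |R| = R := abs_of_nonneg ((norm_nonneg _).trans hν)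
    have hR0 : 0 ≤ R := hR ▸ abs_nonneg R
    obtain ⟨hc, hi⟩ := hn₀ n hn (μ - ν) ν (by rw [hR]; exact (norm_sub_le _ _).trans (by linarith))
      (by linarith [abs_nonneg R])
    have s1 := (hs.mul_left (KB * Kρ)).of_norm_bounded (hterm' n hn μ ν hμ hν)
    have s2 := (hs.mul_left (KB * Kρ)).of_norm_bounded (hterm' (n + 2) (by omega) μ ν hμ hν)
    rw [pochQuotientHyp, pochQuotientHyp, ← s1.tsum_sub s2]
    have hb : ∀ j : ℕ, ‖poch (1 - (μ - ν + n) / 2) j / poch ((μ - ν + n) / 2 + ν + 1) j *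
        binCoeff (ν + 1) j * t ^ j - poch (1 - (μ - ν + (n + 2 : ℕ)) / 2) j /
        poch ((μ - ν + (n + 2 : ℕ)) / 2 + ν + 1) j * binCoeff (ν + 1) j * t ^ j‖ ≤
        4 * (|R| + 2) * (KB * Kρ) / (n + 1) * ((j : ℝ) + 1) ^ (-2 : ℝ) := by
      intro j
      rw [show (μ - ν + (n + 2 : ℕ)) / 2 = (μ - ν + n) / 2 + 1 by push_cast; ring,
        show (μ - ν + n) / 2 + 1 + ν + 1 = (μ - ν + n) / 2 + ν + 1 + 1 by ring]
      rcases j with _ | i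
      · simp only [poch_zero, sub_self, norm_zero]; positivity
      · rw [← sub_mul, ← sub_mul, ← neg_sub, poch_div_shift_sub hc, neg_neg, norm_mul, norm_mul,
          norm_pow, norm_mul]
        have hip : (0 : ℝ) ≤ i := by positivity
        have e1 : ‖((i : ℂ) + 1) * ((μ - ν + n) / 2 + ν + 1 - (μ - ν + n) / 2 + i + 1) /
            (((μ - ν + n) / 2 + ν + 1 + i) * ((μ - ν + n) / 2 + ν + 1 + i + 1))‖ ≤
            4 * (|R| + 2) / (n + 1) * (((i + 1 : ℕ) : ℝ) + 1) ^ 2 := by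
          rw [norm_div, norm_mul, norm_mul]
          have a1 : ‖(i : ℂ) + 1‖ = i + 1 := by
            rw [← Nat.cast_succ, Complex.norm_natCast]; simp
          have a2 : ‖(μ - ν + n) / 2 + ν + 1 - (μ - ν + n) / 2 + i + 1‖ ≤ (|R| + 2) * (i + 2) := by
            rw [show (μ - ν + n) / 2 + ν + 1 - (μ - ν + n) / 2 + i + 1 = ν + ((i + 2 : ℕ) : ℂ) by
              push_cast; ring]
            refine (norm_add_le _ _).trans ?_
            rw [Complex.norm_natCast, hR]; push_cast
            nlinarith
          have a3 := (hi i).1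
          have a4 := (hi (i + 1)).2.1
          rw [Nat.cast_succ, ← add_assoc] at a4
          have hn1 : (0 : ℝ) < (n : ℝ) + 1 := by positivity
          rw [a1]
          calc _ ≤ (i + 1) * ((|R| + 2) * (i + 2)) / (((n : ℝ) + 1) / 4 * 1) := by gcongr
            _ = 4 * (|R| + 2) / (n + 1) * ((i + 1) * (i + 2)) := by field_simp
            _ ≤ _ := by
              gcongr
              push_cast
              nlinarith
        have e2 := norm_poch_div_le hε (fun i => (hi i).2.1) (fun i => (hi i).2.2) i
        have e3 := hbin ν (by rwa [hR]) (i + 1)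
        have e4 : (1 + ε) ^ i * ‖t‖ ^ (i + 1) ≤ ρ ^ (i + 1) := by
          calc (1 + ε) ^ i * ‖t‖ ^ (i + 1) ≤ (1 + ε) ^ (i + 1) * ‖t‖ ^ (i + 1) := by
                gcongr
                · linarith
                · omega
            _ = ((1 + ε) * ‖t‖) ^ (i + 1) := by rw [mul_pow]
            _ ≤ _ := by gcongr
        have hi2 : (0 : ℝ) < (((i + 1 : ℕ) : ℝ) + 1) ^ 2 := by positivity
        calc _ ≤ (1 + ε) ^ i * (4 * (|R| + 2) / (n + 1) * (((i + 1 : ℕ) : ℝ) + 1) ^ 2) *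
              ‖binCoeff (ν + 1) (i + 1)‖ * ‖t‖ ^ (i + 1) := by gcongr
          _ = 4 * (|R| + 2) / (n + 1) * (((i + 1 : ℕ) : ℝ) + 1) ^ 2 *
              (‖binCoeff (ν + 1) (i + 1)‖ * ((1 + ε) ^ i * ‖t‖ ^ (i + 1))) := by ring
          _ ≤ 4 * (|R| + 2) / (n + 1) * (((i + 1 : ℕ) : ℝ) + 1) ^ 2 *
              (KB * Kρ * ((((i + 1 : ℕ) : ℝ) + 1) ^ (-2 : ℝ) * ((((i + 1 : ℕ) : ℝ) + 1) ^ 2)⁻¹)) := by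
              refine mul_le_mul_of_nonneg_left ?_ (by positivity)
              exact (mul_le_mul_of_nonneg_left e4 (norm_nonneg _)).trans e3
          _ = _ := by field_simp
    have := tsum_of_norm_bounded (hs.mul_left _).hasSum hb
    rw [tsum_mul_left] at this
    refine this.trans (le_of_eq ?_)
    ring
  set S : Set (ℂ × ℂ) := {p | ‖p.1‖ ≤ R ∧ ‖p.2‖ ≤ R}
  have hfac : ∀ n ≥ n₀, ∀ p ∈ S, quadraticMoment t p.1 p.2 n = gammaFactor (p.1 - p.2) p.2 n *
      pochQuotientHyp ((p.1 - p.2 + n) / 2) ((p.1 - p.2 + n) / 2 + p.2 + 1) (p.2 + 1) t := by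
    intro n hn p hp
    have hR : |R| = R := abs_of_nonneg ((norm_nonneg _).trans hp.1)
    exact quadraticMoment_eq_gammaFactor_mul (hn₀ n hn (p.1 - p.2) p.2
      (by rw [hR]; exact (norm_sub_le _ _).trans (by linarith [hp.1, hp.2]))
      (by linarith [abs_nonneg R, hp.2])).1
  have hGam : ∀ p ∈ S, ∀ n, ‖gammaFactor (p.1 - p.2) p.2 n‖ ≤ KG * ((n : ℝ) + 1) ^ (-p.2.re - 1) := by
    intro p hp n
    have hR : |R| = R := abs_of_nonneg ((norm_nonneg _).trans hp.1)
    exact hG _ _ (by rw [hR]; exact (norm_sub_le _ _).trans (by linarith [hp.1, hp.2]))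
      (by linarith [abs_nonneg R, hp.2]) n
  have hτ : ∀ k : ℝ, 0 ≤ k → ∀ p ∈ S, |-p.2.re - k| ≤ |R| + k := by
    intro k hk p hp
    have := abs_le.1 ((Complex.abs_re_le_norm p.2).trans (hp.2.trans (le_abs_self R)))
    rw [abs_le]; constructor <;> linarith
  have hconst : ∀ n, ∃ C : ℝ, ∀ p ∈ S, ‖quadraticMoment t p.1 p.2 n‖ ≤ C := by
    intro n
    obtain ⟨C, hC⟩ := exists_norm_quadraticMoment_le_const R ht n
    exact ⟨C, fun p hp => hC _ _ hp.1 hp.2⟩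
  obtain ⟨K1, hK1, h1⟩ := exists_norm_le_of_eventually (S := S)
    (u := fun p n => quadraticMoment t p.1 p.2 n) (n₀ := n₀)
    (show 0 < KG * (KB * Kρ * Z) + 1 by positivity) (hτ 1 zero_le_one) hconst (by
      intro p hp n hn
      rw [hfac n hn p hp, norm_mul]
      have h0 : 0 ≤ ((n : ℝ) + 1) ^ (-p.2.re - 1) := by positivity
      calc _ ≤ (KG * ((n : ℝ) + 1) ^ (-p.2.re - 1)) * (KB * Kρ * Z) := by
            gcongr
            · exact hGam p hp n
            · exact hF n hn _ _ hp.1 hp.2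
        _ ≤ _ := by nlinarith)
  obtain ⟨K2, hK2, h2⟩ := exists_norm_le_of_eventually (S := S)
    (u := fun p n => quadraticMoment t p.1 p.2 n - quadraticMoment t p.1 p.2 (n + 2)) (n₀ := n₀)
    (τ := fun p => -p.2.re - 2) (B := |R| + 2)
    (show 0 < KG * 4 * (|R| + 1) * (KB * Kρ * Z) +
      KG * 2 ^ (|R| + 1) * 3 ^ (|R| + 1) * (4 * (|R| + 2) * (KB * Kρ * Z)) + 1 by positivity)
      (hτ 2 zero_le_two) (by
      intro n
      obtain ⟨C, hC⟩ := hconst n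
      obtain ⟨C', hC'⟩ := hconst (n + 2)
      exact ⟨C + C', fun p hp => (norm_sub_le _ _).trans (add_le_add (hC p hp) (hC' p hp))⟩) (by
      intro p hp n hn
      have hn1 : (0 : ℝ) < (n : ℝ) + 1 := by positivity
      rw [hfac n hn p hp, hfac (n + 2) (by omega) p hp]
      set D := gammaFactor (p.1 - p.2) p.2 n with hD
      set D' := gammaFactor (p.1 - p.2) p.2 (n + 2) with hD'
      have hR : |R| = R := abs_of_nonneg ((norm_nonneg _).trans hp.1)
      obtain ⟨-, hi⟩ := hn₀ n hn (p.1 - p.2) p.2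
        (by rw [hR]; exact (norm_sub_le _ _).trans (by linarith [hp.1, hp.2]))
        (by linarith [abs_nonneg R, hp.2])
      have hc := (hi 0).1
      rw [Nat.cast_zero, add_zero] at hc
      have hDD : ‖D - D'‖ ≤ KG * ((n : ℝ) + 1) ^ (-p.2.re - 1) * (|R| + 1) * (4 / (n + 1)) := by
        have e : (D - D') * ((p.1 - p.2 + n) / 2 + p.2 + 1) = D * (p.2 + 1) := by
          have := gammaFactor_add_two (p.1 - p.2) p.2 n
          rw [← hD, ← hD'] at this
          linear_combination (-1 / 2) * this
        have e' := congrArg norm e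
        rw [norm_mul, norm_mul] at e'
        have h3 : ‖p.2 + 1‖ ≤ |R| + 1 :=
          (norm_add_le _ _).trans (by rw [norm_one, hR]; linarith [hp.2])
        have h4 : ‖D - D'‖ * (((n : ℝ) + 1) / 4) ≤ KG * ((n : ℝ) + 1) ^ (-p.2.re - 1) * (|R| + 1) := by
          calc _ ≤ ‖D - D'‖ * ‖(p.1 - p.2 + n) / 2 + p.2 + 1‖ := by gcongr
            _ = _ := e'
            _ ≤ _ := by
              gcongr
              exact hGam p hp n
        rw [← le_div_iff₀ (by positivity)] at h4
        refine h4.trans (le_of_eq ?_)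
        field_simp
      have hD'b : ‖D'‖ ≤ KG * 2 ^ (|R| + 1) * 3 ^ (|R| + 1) * ((n : ℝ) + 1) ^ (-p.2.re - 1) := by
        refine (hGam p hp (n + 2)).trans ?_
        have := add_rpow_le_mul_rpow n 2 (hτ 1 zero_le_one p hp)
        have h3 : (1 : ℝ) ≤ 2 ^ (|R| + 1) := Real.one_le_rpow (by norm_num) (by positivity)
        calc _ ≤ KG * (((n : ℝ) + 1) ^ (-p.2.re - 1) * (((2 : ℕ) : ℝ) + 1) ^ (|R| + 1)) := by gcongr
          _ = KG * 1 * 3 ^ (|R| + 1) * ((n : ℝ) + 1) ^ (-p.2.re - 1) := by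
              norm_num; ring
          _ ≤ _ := by gcongr
      have hpw : ((n : ℝ) + 1) ^ (-p.2.re - 2) = ((n : ℝ) + 1) ^ (-p.2.re - 1) / (n + 1) := by
        rw [← Real.rpow_sub_one hn1.ne']; congr 1; ring
      set F := pochQuotientHyp ((p.1 - p.2 + n) / 2) ((p.1 - p.2 + n) / 2 + p.2 + 1) (p.2 + 1) t with hFd
      set F' := pochQuotientHyp ((p.1 - p.2 + (n + 2 : ℕ)) / 2)
        ((p.1 - p.2 + (n + 2 : ℕ)) / 2 + p.2 + 1) (p.2 + 1) t with hFd'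
      rw [show D * F - D' * F' = (D - D') * F + D' * (F - F') by ring]
      refine (norm_add_le _ _).trans ?_
      rw [norm_mul, norm_mul, hpw]
      have f1 := hF n hn _ _ hp.1 hp.2
      have f2 := hdiff n hn _ _ hp.1 hp.2
      have h0 : 0 ≤ ((n : ℝ) + 1) ^ (-p.2.re - 1) / (n + 1) := by positivity
      calc _ ≤ (KG * ((n : ℝ) + 1) ^ (-p.2.re - 1) * (|R| + 1) * (4 / (n + 1))) * (KB * Kρ * Z) +
            (KG * 2 ^ (|R| + 1) * 3 ^ (|R| + 1) * ((n : ℝ) + 1) ^ (-p.2.re - 1)) *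
              (4 * (|R| + 2) * (KB * Kρ * Z) / (n + 1)) := by gcongr
        _ = (KG * 4 * (|R| + 1) * (KB * Kρ * Z) +
            KG * 2 ^ (|R| + 1) * 3 ^ (|R| + 1) * (4 * (|R| + 2) * (KB * Kρ * Z))) *
            (((n : ℝ) + 1) ^ (-p.2.re - 1) / (n + 1)) := by field_simp
        _ ≤ _ := by nlinarith)
  refine ⟨max K1 K2, by positivity, fun μ ν hμ hν n => ⟨?_, ?_⟩⟩
  · refine (h1 (μ, ν) ⟨hμ, hν⟩ n).trans ?_
    gcongr
    exact le_max_left _ _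
  · refine (h2 (μ, ν) ⟨hμ, hν⟩ n).trans ?_
    gcongr
    exact le_max_right _ _

end

noncomputable section

/-! ### Convergence and analytic continuation of series -/

/-- By Weierstrass the limit S is holomorphic; it agrees with F near z₀, hence on all of U by the
identity theorem. -/
theorem seriesTo_of_eventually {U : Set ℂ} (hU : IsOpen U) (hc : IsPreconnected U)
    {T : ℕ → ℂ → ℂ} {F S : ℂ → ℂ} (hT : ∀ n, DifferentiableOn ℂ (T n) U)
    (hF : DifferentiableOn ℂ F U)
    (hconv : TendstoLocallyUniformlyOn (fun N z => ∑ n ∈ Finset.range N, T n z) S atTop U)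
    {z₀ : ℂ} (hz₀ : z₀ ∈ U) (h₀ : ∀ᶠ z in 𝓝 z₀, SeriesTo (fun n => T n z) (F z))
    {z : ℂ} (hz : z ∈ U) : SeriesTo (fun n => T n z) (F z) := by
  have hS : DifferentiableOn ℂ S U := hconv.differentiableOn
    (Eventually.of_forall fun N => DifferentiableOn.fun_sum fun n _ => hT n) hU
  have heq : S =ᶠ[𝓝 z₀] F := by
    filter_upwards [h₀, hU.mem_nhds hz₀] with w hw hwU
    exact tendsto_nhds_unique (hconv.tendsto_at hwU) hw
  have := (hS.analyticOnNhd hU).eqOn_of_preconnected_of_eventuallyEq (hF.analyticOnNhd hU) hc hz₀ heq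
  rw [SeriesTo, ← this hz]
  exact hconv.tendsto_at hz

lemma summable_const_mul_rpow (C : ℝ) {δ : ℝ} (hδ : 0 < δ) :
    Summable fun n : ℕ => C * ((n : ℝ) + 1) ^ (-1 - δ) :=
  (summable_add_one_rpow (by linarith)).mul_left C

lemma tendstoLocallyUniformlyOn_of_abs {U : Set ℂ} (hU : IsOpen U) {T : ℕ → ℂ → ℂ}
    (h : ∀ K ⊆ U, IsCompact K → ∃ C δ : ℝ, 0 < δ ∧ ∀ z ∈ K, ∀ n : ℕ,
      ‖T n z‖ ≤ C * ((n : ℝ) + 1) ^ (-1 - δ)) :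
    TendstoLocallyUniformlyOn (fun N z => ∑ n ∈ Finset.range N, T n z) (fun z => ∑' n, T n z)
      atTop U := by
  rw [tendstoLocallyUniformlyOn_iff_forall_isCompact hU]
  intro K hKU hK
  obtain ⟨C, δ, hδ, hb⟩ := h K hKU hK
  exact tendstoUniformlyOn_tsum_nat (summable_const_mul_rpow C hδ) fun n z hz => hb z hz n

lemma sum_sub_shift (T : ℕ → ℂ) (d N : ℕ) : ∑ n ∈ Finset.range N, (T n - T (n + d)) =
    ∑ i ∈ Finset.range d, T i - ∑ i ∈ Finset.range d, T (N + i) := by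
  induction N with
  | zero => simp
  | succ N ih =>
    rw [Finset.sum_range_succ, ih]
    have h := Finset.sum_range_succ (fun i => T (N + i)) d
    rw [Finset.sum_range_succ'] at h
    simp only [add_zero] at h
    have e : ∀ i, T (N + 1 + i) = T (N + (i + 1)) := fun i => by congr 1; ring
    simp only [e]
    linear_combination h

/-- A criterion for locally uniform conditional convergence of `∑ gₙ bₙ`, where the `gₙ` oscillate
so that `gₙ + gₙ₊ₔ` is small and the `bₙ` vary slowly. -/
lemma tendstoLocallyUniformlyOn_of_oscillating {U : Set ℂ} (hU : IsOpen U) (d : ℕ)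
    {g b : ℕ → ℂ → ℂ}
    (h : ∀ K ⊆ U, IsCompact K → ∃ C δ : ℝ, 0 < δ ∧ ∀ z ∈ K, ∀ n : ℕ,
      ‖g n z * b n z‖ ≤ C * ((n : ℝ) + 1) ^ (-δ) ∧
      ‖(g n z + g (n + d) z) * b (n + d) z‖ ≤ C * ((n : ℝ) + 1) ^ (-1 - δ) ∧
      ‖g n z * (b n z - b (n + d) z)‖ ≤ C * ((n : ℝ) + 1) ^ (-1 - δ)) :
    ∃ S : ℂ → ℂ, TendstoLocallyUniformlyOn
      (fun N z => ∑ n ∈ Finset.range N, g n z * b n z) S atTop U := by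
  -- With Tₙ = gₙ bₙ this is Tₙ + Tₙ₊ d, summed by parts so that each summand is small. Thus ∑ V is
  -- twice ∑ T up to d initial terms and d final ones that tend to zero, which explains the limit
  -- chosen next.
  set V : ℕ → ℂ → ℂ := fun n z =>
    (g n z + g (n + d) z) * b (n + d) z + g n z * (b n z - b (n + d) z) with hV
  refine ⟨fun z => (1 / 2) * (∑' n, V n z + ∑ i ∈ Finset.range d, g i z * b i z), ?_⟩
  rw [tendstoLocallyUniformlyOn_iff_forall_isCompact hU]
  intro K hKU hK
  obtain ⟨C, δ, hδ, hb⟩ := h K hKU hK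
  have hVb : ∀ n, ∀ z ∈ K, ‖V n z‖ ≤ (C + C) * ((n : ℝ) + 1) ^ (-1 - δ) := by
    intro n z hz
    refine (norm_add_le _ _).trans ?_
    rw [add_mul C]
    exact add_le_add (hb z hz n).2.1 (hb z hz n).2.2
  have h1 := tendstoUniformlyOn_tsum_nat (summable_const_mul_rpow (C + C) hδ) hVb
  rw [Metric.tendstoUniformlyOn_iff] at h1 ⊢
  intro ε hε
  have h2 : Tendsto (fun N : ℕ => (d : ℝ) * (C * ((N : ℝ) + 1) ^ (-δ))) atTop (𝓝 0) := by
    have h3 : Tendsto (fun N : ℕ => ((N : ℝ) + 1) ^ (-δ)) atTop (𝓝 0) :=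
      (tendsto_rpow_neg_atTop hδ).comp (tendsto_atTop_add_const_right _ 1 tendsto_natCast_atTop_atTop)
    simpa using (h3.const_mul C).const_mul (d : ℝ)
  filter_upwards [h1 ε hε, h2.eventually_lt_const hε] with N hN1 hN2 z hz
  have hC : 0 ≤ C := by simpa using (norm_nonneg _).trans (hb z hz 0).1
  have e : 2 * ∑ n ∈ Finset.range N, g n z * b n z = ∑ n ∈ Finset.range N, V n z +
      (∑ i ∈ Finset.range d, g i z * b i z - ∑ i ∈ Finset.range d, g (N + i) z * b (N + i) z) := by
    rw [← sum_sub_shift (fun n => g n z * b n z), ← Finset.sum_add_distrib, Finset.mul_sum]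
    refine Finset.sum_congr rfl fun n _ => ?_
    simp only [hV]; ring
  have htail : ‖∑ i ∈ Finset.range d, g (N + i) z * b (N + i) z‖ < ε := by
    refine lt_of_le_of_lt ?_ hN2
    calc _ ≤ ∑ i ∈ Finset.range d, C * ((N : ℝ) + 1) ^ (-δ) := by
          refine norm_sum_le_of_le _ fun i _ => ((hb z hz (N + i)).1).trans ?_
          refine mul_le_mul_of_nonneg_left ?_ hC
          refine Real.rpow_le_rpow_of_nonpos (by positivity) ?_ (by linarith)
          push_cast
          have : (0 : ℝ) ≤ i := by positivity
          linarith
      _ = _ := by simp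
  have h4 := hN1 z hz
  rw [dist_eq_norm] at h4 ⊢
  have e2 : (1 / 2) * (∑' n, V n z + ∑ i ∈ Finset.range d, g i z * b i z) -
      ∑ n ∈ Finset.range N, g n z * b n z = (1 / 2) * ((∑' n, V n z - ∑ n ∈ Finset.range N, V n z) +
        ∑ i ∈ Finset.range d, g (N + i) z * b (N + i) z) := by
    linear_combination (-1 / 2) * e
  rw [e2, norm_mul]
  have := norm_add_le (∑' n, V n z - ∑ n ∈ Finset.range N, V n z)
    (∑ i ∈ Finset.range d, g (N + i) z * b (N + i) z)
  norm_num
  linarith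

/-- Analytic continuation of an expansion in two complex parameters along the complex line through
a base point at which it is known nearby. -/
theorem seriesTo_of_line {σ : EReal} {T : ℕ → ℂ → ℂ → ℂ} {F : ℂ → ℂ → ℂ} {μ₀ ν₀ μ₁ ν₁ : ℂ}
    (hν₀ : σ < ((ν₀.re : ℝ) : EReal)) (hν₁ : σ < ((ν₁.re : ℝ) : EReal))
    (hT : ∀ n, ∀ μ ν : ℂ → ℂ, Differentiable ℂ μ → Differentiable ℂ ν →
      Differentiable ℂ fun z => T n (μ z) (ν z))
    (hF : ∀ μ ν : ℂ → ℂ, Differentiable ℂ μ → Differentiable ℂ ν →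
      Differentiable ℂ fun z => F (μ z) (ν z))
    (hconv : ∀ (μ ν : ℂ → ℂ) (U : Set ℂ), IsOpen U → Differentiable ℂ μ → Differentiable ℂ ν →
      (∀ z ∈ U, σ < (((ν z).re : ℝ) : EReal)) → ∃ S, TendstoLocallyUniformlyOn
        (fun N z => ∑ n ∈ Finset.range N, T n (μ z) (ν z)) S atTop U)
    (hbase : ∀ᶠ p : ℂ × ℂ in 𝓝 (μ₀, ν₀), SeriesTo (fun n => T n p.1 p.2) (F p.1 p.2)) :
    SeriesTo (fun n => T n μ₁ ν₁) (F μ₁ ν₁) := by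
  set μ : ℂ → ℂ := fun z => μ₀ + z * (μ₁ - μ₀) with hμ
  set ν : ℂ → ℂ := fun z => ν₀ + z * (ν₁ - ν₀) with hν
  have dμ : Differentiable ℂ μ := by simp only [hμ]; fun_prop
  have dν : Differentiable ℂ ν := by simp only [hν]; fun_prop
  set U : Set ℂ := {z | σ < (((ν z).re : ℝ) : EReal)}
  have hU : IsOpen U := isOpen_lt continuous_const
    (continuous_coe_real_ereal.comp (Complex.continuous_re.comp dν.continuous))
  have hconvex : Convex ℝ U := by
    intro x hx y hy a b ha hb hab
    have e : (ν (a • x + b • y)).re = a * (ν x).re + b * (ν y).re := by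
      have : ν (a • x + b • y) = a * ν x + b * ν y := by
        simp only [hν, Complex.real_smul]
        have : (a : ℂ) + b = 1 := by exact_mod_cast hab
        linear_combination -ν₀ * this
      rw [this]; simp
    have hmin : min (ν x).re (ν y).re ≤ (ν (a • x + b • y)).re := by
      rw [e]
      calc min (ν x).re (ν y).re = a * min (ν x).re (ν y).re + b * min (ν x).re (ν y).re := by
            rw [← add_mul, hab, one_mul]
        _ ≤ _ := by gcongr <;> simp
    refine lt_of_lt_of_le ?_ (EReal.coe_le_coe_iff.2 hmin)
    rcases min_choice (ν x).re (ν y).re with h | h <;> rw [h]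
    · exact hx
    · exact hy
  obtain ⟨S, hS⟩ := hconv μ ν U hU dμ dν fun z hz => hz
  have h0 : (0 : ℂ) ∈ U := by simpa [U, hν] using hν₀
  have h1 : (1 : ℂ) ∈ U := by
    have : ν 1 = ν₁ := by simp [hν]
    simpa only [U, Set.mem_ofPred_eq, this] using hν₁
  have hb : ∀ᶠ z in 𝓝 (0 : ℂ), SeriesTo (fun n => T n (μ z) (ν z)) (F (μ z) (ν z)) := by
    have hc : Tendsto (fun z => (μ z, ν z)) (𝓝 0) (𝓝 (μ₀, ν₀)) := by
      have := (dμ.continuous.prodMk dν.continuous).tendsto 0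
      simpa [hμ, hν] using this
    exact hc.eventually hbase
  have := seriesTo_of_eventually hU hconvex.isPreconnected
    (fun n => (hT n μ ν dμ dν).differentiableOn) (hF μ ν dμ dν).differentiableOn hS h0 hb h1
  simpa [hμ, hν] using this

lemma exists_norm_le_on_compact {K : Set ℂ} (hK : IsCompact K) {μ ν : ℂ → ℂ}
    (hμ : Continuous μ) (hν : Continuous ν) : ∃ R : ℝ, ∀ z ∈ K, ‖μ z‖ ≤ R ∧ ‖ν z‖ ≤ R := by
  obtain ⟨R, hR⟩ := hK.exists_bound_of_continuousOn hμ.continuousOn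
  obtain ⟨R', hR'⟩ := hK.exists_bound_of_continuousOn hν.continuousOn
  exact ⟨max R R', fun z hz => ⟨(hR z hz).trans (le_max_left _ _), (hR' z hz).trans (le_max_right _ _)⟩⟩

lemma exists_lt_re_on_compact {K : Set ℂ} (hK : IsCompact K) {ν : ℂ → ℂ} (hν : Continuous ν) {σ : ℝ}
    (h : ∀ z ∈ K, σ < (ν z).re) : ∃ δ : ℝ, 0 < δ ∧ δ ≤ 1 ∧ ∀ z ∈ K, σ + δ ≤ (ν z).re := by
  obtain ⟨s, hs, hle⟩ := hK.exists_forall_le' (Complex.continuous_re.comp hν).continuousOn h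
  refine ⟨min (s - σ) 1, by simp [hs], min_le_right _ _, fun z hz => ?_⟩
  have := hle z hz
  simp only [Function.comp] at this
  linarith [min_le_left (s - σ) 1]

end

noncomputable section

open MeasureTheory

/-! ### Euler integrals -/

/-- All bases occurring in the weights and prefactors are positive reals. Passing to real logarithms
turns products of complex powers into linear identities, with no branches to follow. -/
lemma ofReal_cpow_eq_exp {r : ℝ} (hr : 0 < r) (z : ℂ) :
    (r : ℂ) ^ z = Complex.exp ((Real.log r : ℂ) * z) := by
  rw [Complex.cpow_def_of_ne_zero (by exact_mod_cast hr.ne'), Complex.ofReal_log hr.le]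

lemma ofReal_eq_exp_log {r : ℝ} (hr : 0 < r) : (r : ℂ) = Complex.exp (Real.log r : ℂ) := by
  rw [← Complex.ofReal_exp, Real.exp_log hr]

/-- The beta kernel on `(0, 1)`. -/
def betaKernel (u v : ℂ) (s : ℝ) : ℂ := (s : ℂ) ^ (u - 1) * ((1 - s : ℝ) : ℂ) ^ (v - 1)

lemma integrableOn_betaKernel {u v : ℂ} (hu : 0 < u.re) (hv : 0 < v.re) :
    IntegrableOn (betaKernel u v) (Set.Ioo 0 1) := by
  have := Complex.betaIntegral_convergent hu hv
  rw [intervalIntegrable_iff_integrableOn_Ioo_of_le zero_le_one] at this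
  refine this.congr_fun (fun s _ => ?_) measurableSet_Ioo
  simp [betaKernel]

lemma integral_betaKernel {u v : ℂ} (hu : 0 < u.re) (hv : 0 < v.re) :
    ∫ s in Set.Ioo (0 : ℝ) 1, betaKernel u v s =
      Complex.Gamma u * Complex.Gamma v / Complex.Gamma (u + v) := by
  rw [Complex.Gamma_mul_Gamma_eq_betaIntegral hu hv, mul_div_cancel_left₀ _
    (Complex.Gamma_ne_zero_of_re_pos (by simp; linarith)), Complex.betaIntegral,
    intervalIntegral.integral_of_le zero_le_one, integral_Ioc_eq_integral_Ioo]
  simp [betaKernel]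

/-- Dominated convergence with majorant ‖c n‖ ‖k s‖. As y may approach 1, the coefficients
themselves must be summable, which is what limits the parameters. -/
lemma hasSum_integral_mul {k : ℝ → ℂ} (hk : IntegrableOn k (Set.Ioo 0 1)) {c : ℕ → ℂ}
    (hc : Summable fun n => ‖c n‖) {y : ℝ → ℝ} (hy : ContinuousOn y (Set.Ioo 0 1))
    (hy1 : ∀ s ∈ Set.Ioo (0 : ℝ) 1, |y s| ≤ 1) {f : ℝ → ℂ}
    (hf : ∀ s ∈ Set.Ioo (0 : ℝ) 1, HasSum (fun n => c n * (y s : ℂ) ^ n) (f s)) :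
    HasSum (fun n => c n * ∫ s in Set.Ioo (0 : ℝ) 1, k s * (y s : ℂ) ^ n)
      (∫ s in Set.Ioo (0 : ℝ) 1, k s * f s) := by
  simp only [← integral_const_mul]
  refine hasSum_integral_of_dominated_convergence (fun n s => ‖c n‖ * ‖k s‖) (fun n => ?_)
    (fun n => ?_) ?_ ?_ ?_
  · refine AEStronglyMeasurable.const_mul (hk.aestronglyMeasurable.mul ?_) _
    refine ContinuousOn.aestronglyMeasurable ?_ measurableSet_Ioo
    exact (Complex.continuous_ofReal.comp_continuousOn hy).pow n
  · refine (ae_restrict_iff' measurableSet_Ioo).2 (Eventually.of_forall fun s hs => ?_)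
    rw [norm_mul, norm_mul, norm_pow, Complex.norm_real]
    gcongr
    exact mul_le_of_le_one_right (norm_nonneg _) (pow_le_one₀ (norm_nonneg _) (hy1 s hs))
  · exact Eventually.of_forall fun s => hc.mul_right _
  · simp only [tsum_mul_right]
    exact hk.norm.const_mul _
  · refine (ae_restrict_iff' measurableSet_Ioo).2 (Eventually.of_forall fun s hs => ?_)
    refine ((hf s hs).mul_left (k s)).congr_fun fun n => ?_
    ring

lemma betaKernel_mul_pow (u v : ℂ) {s : ℝ} (hs : s ≠ 0) (n : ℕ) :
    betaKernel u v s * (s : ℂ) ^ n = betaKernel (u + n) v s := by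
  have h : (s : ℂ) ≠ 0 := by exact_mod_cast hs
  rw [betaKernel, betaKernel, show u + (n : ℂ) - 1 = u - 1 + n by ring, Complex.cpow_add _ _ h,
    Complex.cpow_natCast]
  ring

/-- Euler's integral for the regularized hypergeometric function. -/
theorem integral_euler {b v : ℂ} (hb : 0 < b.re) (hv : 0 < v.re) (α : ℂ) {t : ℝ} (ht : |t| < 1) :
    ∫ s in Set.Ioo (0 : ℝ) 1, betaKernel b v s * (1 - (t : ℂ) * s) ^ (-α) =
      Complex.Gamma b * Complex.Gamma v * regHyp α b (b + v) t := by
  have hr := represents_binSeries α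
  have htn : ‖(t : ℂ)‖ < 1 := by simpa using ht
  have hsum : Summable fun n => ‖binCoeff α n * (t : ℂ) ^ n‖ := by
    simpa [binSeries] using (hr t htn).1
  have h := hasSum_integral_mul (integrableOn_betaKernel hb hv) hsum
    (y := fun s => s) continuousOn_id (fun s hs => abs_le.2 ⟨by linarith [hs.1], hs.2.le⟩)
    (f := fun s => (1 - (t : ℂ) * s) ^ (-α)) (fun s hs => by
      have hn : ‖(t : ℂ) * s‖ < 1 := by
        rw [norm_mul, Complex.norm_real s, Real.norm_of_nonneg hs.1.le]
        exact (mul_le_of_le_one_right (norm_nonneg _) hs.2.le).trans_lt htn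
      have := (hr _ hn).2
      simpa [binSeries, mul_pow, mul_assoc] using this)
  rw [← h.tsum_eq, regHyp_eq_tsum, ← tsum_mul_left]
  refine tsum_congr fun n => ?_
  have e : ∫ s in Set.Ioo (0 : ℝ) 1, betaKernel b v s * (s : ℂ) ^ n =
      ∫ s in Set.Ioo (0 : ℝ) 1, betaKernel (b + n) v s :=
    setIntegral_congr_fun measurableSet_Ioo fun s hs => betaKernel_mul_pow b v hs.1.ne' n
  rw [e, integral_betaKernel (by simp; positivity) hv, Gamma_add_nat b hb n, pochDivGamma,
    show b + n + v = b + v + n by ring]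
  ring

/-- The weight `s ^ (μ - ν - 1) (1 - s) ^ ν (1 + t s) ^ ν`. -/
def eulerWeight (t : ℝ) (μ ν : ℂ) (s : ℝ) : ℂ :=
  betaKernel (μ - ν) (ν + 1) s * ((1 + t * s : ℝ) : ℂ) ^ ν

/-- The weight `s ^ (μ - ν - 1) (1 - s²) ^ ν (1 - t s²) ^ (-μ)`. -/
def quadraticWeight (t : ℝ) (μ ν : ℂ) (s : ℝ) : ℂ :=
  betaKernel (μ - ν) (ν + 1) s * (((1 + s : ℝ) : ℂ) ^ ν * ((1 - t * s ^ 2 : ℝ) : ℂ) ^ (-μ))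

/-- The argument `s (1 - t) / (1 - t s²)`. -/
def quadraticArg (t s : ℝ) : ℝ := s * (1 - t) / (1 - t * s ^ 2)

section bounds

variable {t s : ℝ}

lemma one_add_mul_pos (ht : |t| < 1) (h0 : 0 ≤ s) (h1 : s ≤ 1) : 0 < 1 + t * s := by
  nlinarith [abs_lt.1 ht]

lemma one_sub_mul_pos (ht : |t| < 1) (h0 : 0 ≤ s) (h1 : s ≤ 1) : 0 < 1 - t * s := by
  nlinarith [abs_lt.1 ht]

lemma one_sub_mul_sq_pos (ht : |t| < 1) (h0 : 0 ≤ s) (h1 : s ≤ 1) : 0 < 1 - t * s ^ 2 :=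
  one_sub_mul_pos ht (by positivity) (pow_le_one₀ h0 h1)

lemma quadraticArg_mem (ht : |t| < 1) (hs : s ∈ Set.Ioo (0 : ℝ) 1) :
    quadraticArg t s ∈ Set.Ioo (0 : ℝ) 1 := by
  have h := one_sub_mul_sq_pos ht hs.1.le hs.2.le
  have h' := one_add_mul_pos ht hs.1.le hs.2.le
  have h2 := abs_lt.1 ht
  refine ⟨div_pos (mul_pos hs.1 (by linarith)) h, (div_lt_one h).2 ?_⟩
  nlinarith [hs.1, hs.2, mul_pos h' (sub_pos.2 hs.2)]

end bounds

lemma continuousOn_ofReal_cpow {f : ℝ → ℝ} {S : Set ℝ} (hf : ContinuousOn f S)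
    (h : ∀ s ∈ S, 0 < f s) (z : ℂ) : ContinuousOn (fun s => (f s : ℂ) ^ z) S :=
  (Complex.continuous_ofReal.comp_continuousOn hf).cpow continuousOn_const
    fun s hs => Complex.ofReal_mem_slitPlane.2 (h s hs)

lemma integrableOn_betaKernel_mul {u v : ℂ} (hu : 0 < u.re) (hv : 0 < v.re) {f : ℝ → ℂ}
    (hf : ContinuousOn f (Set.Icc 0 1)) :
    IntegrableOn (fun s => betaKernel u v s * f s) (Set.Ioo 0 1) := by
  have := integrableOn_betaKernel hu hv
  rw [← integrableOn_Icc_iff_integrableOn_Ioo] at this ⊢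
  exact this.mul_continuousOn hf isCompact_Icc

lemma integrableOn_eulerWeight {t : ℝ} (ht : |t| < 1) {μ ν : ℂ} (hμ : 0 < (μ - ν).re)
    (hν : -1 < ν.re) : IntegrableOn (eulerWeight t μ ν) (Set.Ioo 0 1) :=
  integrableOn_betaKernel_mul hμ (by simp; linarith) (continuousOn_ofReal_cpow (by fun_prop)
    (fun _ hs => one_add_mul_pos ht hs.1 hs.2) _)

lemma integrableOn_quadraticWeight {t : ℝ} (ht : |t| < 1) {μ ν : ℂ} (hμ : 0 < (μ - ν).re)
    (hν : -1 < ν.re) : IntegrableOn (quadraticWeight t μ ν) (Set.Ioo 0 1) :=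
  integrableOn_betaKernel_mul hμ (by simp; linarith) ((continuousOn_ofReal_cpow (by fun_prop)
    (fun s hs => by linarith [hs.1]) _).mul (continuousOn_ofReal_cpow (by fun_prop)
    (fun _ hs => one_sub_mul_sq_pos ht hs.1 hs.2) _))

lemma integral_eulerWeight_mul_pow {t : ℝ} (ht : |t| < 1) {μ ν : ℂ} (hμ : 0 < (μ - ν).re)
    (hν : -1 < ν.re) (n : ℕ) : ∫ s in Set.Ioo (0 : ℝ) 1, eulerWeight t μ ν s * (s : ℂ) ^ n =
      Complex.Gamma (μ - ν) * Complex.Gamma (ν + 1) * eulerMoment t μ ν n := by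
  have h := integral_euler (b := μ - ν + n) (v := ν + 1) (t := -t) (by
    rw [Complex.add_re, Complex.natCast_re]; positivity) (by simp; linarith) (-ν) (by simpa using ht)
  rw [Gamma_add_nat _ hμ, show μ - ν + n + (ν + 1) = 1 + μ + n by ring] at h
  rw [eulerMoment, show (-t : ℂ) = ((-t : ℝ) : ℂ) by simp]
  rw [show ∀ a b c d : ℂ, a * b * (c * d) = c * a * b * d by intros; ring, ← h]
  refine setIntegral_congr_fun measurableSet_Ioo fun s hs => ?_
  simp only [eulerWeight, ← betaKernel_mul_pow (μ - ν) (ν + 1) hs.1.ne' n]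
  push_cast
  rw [neg_neg, neg_mul, sub_neg_eq_add]
  ring

/-- The map s ↦ (1-s²)/(1-ts²) is a decreasing bijection of (0,1), with inverse u ↦ √((1-u)/(1-tu)).
-/
lemma quadratic_substitution {t : ℝ} (ht : |t| < 1) (g : ℝ → ℂ) :
    ∫ u in Set.Ioo (0 : ℝ) 1, g u = ∫ s in Set.Ioo (0 : ℝ) 1,
      ((2 * s * (1 - t) / (1 - t * s ^ 2) ^ 2 : ℝ) : ℂ) * g ((1 - s ^ 2) / (1 - t * s ^ 2)) := by
  have h2 := abs_lt.1 ht
  have himg : (fun s : ℝ => (1 - s ^ 2) / (1 - t * s ^ 2)) '' Set.Ioo 0 1 = Set.Ioo 0 1 := by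
    ext u
    constructor
    · rintro ⟨s, hs, rfl⟩
      have h := one_sub_mul_sq_pos ht hs.1.le hs.2.le
      have h3 : s ^ 2 < 1 := by nlinarith [hs.1, hs.2]
      have h4 : 0 < s ^ 2 := pow_pos hs.1 2
      exact ⟨div_pos (by linarith) h, (div_lt_one h).2 (by nlinarith)⟩
    · intro hu
      have h := one_sub_mul_pos ht hu.1.le hu.2.le
      have h5 : 0 < (1 - u) / (1 - t * u) := div_pos (by linarith [hu.2]) h
      refine ⟨√((1 - u) / (1 - t * u)), ⟨Real.sqrt_pos.2 h5, ?_⟩, ?_⟩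
      · rw [Real.sqrt_lt' one_pos, one_pow, div_lt_one h]
        nlinarith [hu.1, hu.2]
      · simp only [Real.sq_sqrt h5.le]
        have : 1 - t * u - t * (1 - u) ≠ 0 := by
          have : 1 - t * u - t * (1 - u) = 1 - t := by ring
          rw [this]; linarith
        have h6 : 1 - t * ((1 - u) / (1 - t * u)) ≠ 0 := by
          have : 1 - t * ((1 - u) / (1 - t * u)) = (1 - t) / (1 - t * u) := by
            field_simp; ring
          rw [this]; exact (div_pos (by linarith) h).ne'
        have h7 := h.ne'
        rw [div_eq_iff h6, ← mul_left_inj' h7, sub_mul, div_mul_cancel₀ _ h7, mul_assoc, sub_mul,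
          mul_assoc t, div_mul_cancel₀ _ h7]
        ring
  have hinj : Set.InjOn (fun s : ℝ => (1 - s ^ 2) / (1 - t * s ^ 2)) (Set.Ioo 0 1) := by
    intro s hs r hr he
    have h := one_sub_mul_sq_pos ht hs.1.le hs.2.le
    have h' := one_sub_mul_sq_pos ht hr.1.le hr.2.le
    simp only [div_eq_div_iff h.ne' h'.ne'] at he
    have : (1 - t) * (s ^ 2 - r ^ 2) = 0 := by linear_combination -he
    rcases mul_eq_zero.1 this with h3 | h3
    · linarith
    · exact (pow_left_inj₀ hs.1.le hr.1.le two_ne_zero).1 (by linarith)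
  have hd : ∀ s ∈ Set.Ioo (0 : ℝ) 1, HasDerivWithinAt (fun s : ℝ => (1 - s ^ 2) / (1 - t * s ^ 2))
      (-(2 * s * (1 - t) / (1 - t * s ^ 2) ^ 2)) (Set.Ioo 0 1) s := by
    intro s hs
    have h := one_sub_mul_sq_pos ht hs.1.le hs.2.le
    have h3 : HasDerivAt (fun s : ℝ => 1 - s ^ 2) (-(2 * s)) s := by
      simpa using (hasDerivAt_pow 2 s).const_sub 1
    have h4 : HasDerivAt (fun s : ℝ => 1 - t * s ^ 2) (-(t * (2 * s))) s := by
      simpa using ((hasDerivAt_pow 2 s).const_mul t).const_sub 1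
    refine ((h3.div h4 h.ne').congr_deriv ?_).hasDerivWithinAt
    have h5 := h.ne'
    field_simp
    ring
  rw [← himg, integral_image_eq_integral_abs_deriv_smul measurableSet_Ioo hd hinj, himg]
  refine setIntegral_congr_fun measurableSet_Ioo fun s hs => ?_
  have h := one_sub_mul_sq_pos ht hs.1.le hs.2.le
  have : 0 ≤ 2 * s * (1 - t) / (1 - t * s ^ 2) ^ 2 :=
    div_nonneg (mul_nonneg (by linarith [hs.1]) (by linarith)) (by positivity)
  simp only [abs_neg, abs_of_nonneg this, Complex.real_smul]

lemma quadraticWeight_mul_pow {t : ℝ} (ht : |t| < 1) (μ ν : ℂ) (n : ℕ) {s : ℝ}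
    (hs : s ∈ Set.Ioo (0 : ℝ) 1) :
    ((2 * s * (1 - t) / (1 - t * s ^ 2) ^ 2 : ℝ) : ℂ) *
      (betaKernel (ν + 1) ((μ - ν + n) / 2) ((1 - s ^ 2) / (1 - t * s ^ 2)) *
        (1 - (t : ℂ) * ((1 - s ^ 2) / (1 - t * s ^ 2) : ℝ)) ^ (-(1 - (μ - ν + n) / 2))) =
      2 * (1 - t : ℂ) ^ (μ - ν - 1) * (quadraticWeight t μ ν s * (quadraticArg t s : ℂ) ^ n) := by
  have ht2 := abs_lt.1 ht
  have h := one_sub_mul_sq_pos ht hs.1.le hs.2.le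
  have p1 : 0 < 1 - s := by linarith [hs.2]
  have p2 : 0 < 1 + s := by linarith [hs.1]
  have p3 : 0 < 1 - t := by linarith
  have hs0 := hs.1
  have e1 : (1 - s ^ 2) / (1 - t * s ^ 2) = (1 - s) * (1 + s) / (1 - t * s ^ 2) := by ring
  have e2 : 1 - (1 - s ^ 2) / (1 - t * s ^ 2) = s ^ 2 * (1 - t) / (1 - t * s ^ 2) := by
    rw [eq_div_iff h.ne', sub_mul, div_mul_cancel₀ _ h.ne']; ring
  have e3 : 1 - (t : ℂ) * ((1 - s ^ 2) / (1 - t * s ^ 2) : ℝ) =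
      (((1 - t) / (1 - t * s ^ 2) : ℝ) : ℂ) := by
    rw [← Complex.ofReal_mul, ← Complex.ofReal_one, ← Complex.ofReal_sub]
    congr 1; field_simp; ring
  have q1 : 0 < (1 - s) * (1 + s) / (1 - t * s ^ 2) := by positivity
  have q2 : 0 < s ^ 2 * (1 - t) / (1 - t * s ^ 2) := by positivity
  have q3 : 0 < (1 - t) / (1 - t * s ^ 2) := by positivity
  have q4 : 0 < s * (1 - t) / (1 - t * s ^ 2) := by positivity
  have q5 : 0 < s * (1 - t) / (1 - t * s ^ 2) ^ 2 := by positivity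
  rw [show (1 - t : ℂ) = ((1 - t : ℝ) : ℂ) by push_cast; rfl, e3]
  simp only [betaKernel, quadraticWeight, quadraticArg, e2]
  rw [e1, show 2 * s * (1 - t) / (1 - t * s ^ 2) ^ 2 = 2 * (s * (1 - t) / (1 - t * s ^ 2) ^ 2) by ring,
    Complex.ofReal_mul, ← Complex.cpow_natCast, ofReal_eq_exp_log q5]
  simp only [ofReal_cpow_eq_exp q1, ofReal_cpow_eq_exp q2, ofReal_cpow_eq_exp q3,
    ofReal_cpow_eq_exp q4, ofReal_cpow_eq_exp p1, ofReal_cpow_eq_exp p2, ofReal_cpow_eq_exp p3,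
    ofReal_cpow_eq_exp hs0, ofReal_cpow_eq_exp h]
  simp only [Complex.ofReal_ofNat, mul_assoc, ← Complex.exp_add]
  congr 2
  rw [Real.log_div (by positivity) (by positivity), Real.log_mul hs0.ne' p3.ne',
    Real.log_div (by positivity) (by positivity), Real.log_mul p1.ne' p2.ne',
    Real.log_div (by positivity) (by positivity), Real.log_mul (by positivity) p3.ne',
    Real.log_div (by positivity) (by positivity), Real.log_div (by positivity) (by positivity),
    Real.log_mul hs0.ne' p3.ne', Real.log_pow, Real.log_pow]
  push_cast
  ring

lemma integral_quadraticWeight_mul_pow {t : ℝ} (ht : |t| < 1) {μ ν : ℂ} (hμ : 0 < (μ - ν).re)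
    (hν : -1 < ν.re) (n : ℕ) :
    ∫ s in Set.Ioo (0 : ℝ) 1, quadraticWeight t μ ν s * (quadraticArg t s : ℂ) ^ n =
      Complex.Gamma (μ - ν) * Complex.Gamma (ν + 1) *
        ((1 - t : ℂ) ^ (1 - (μ - ν)) * 2 ^ (-(μ - ν)) * √Real.pi * quadraticMoment t μ ν n) := by
  set A : ℂ := (μ - ν + n) / 2 with hA
  have hn : (0 : ℝ) ≤ n := n.cast_nonneg
  have hre : 0 < A.re := by
    have : A.re = ((μ - ν).re + n) / 2 := by
      rw [hA, show (2 : ℂ) = ((2 : ℝ) : ℂ) by simp, Complex.div_ofReal_re]; simp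
    rw [this]; positivity
  have h := integral_euler (b := ν + 1) (v := A) (by simp; linarith) hre (1 - A) ht
  rw [quadratic_substitution ht, setIntegral_congr_fun measurableSet_Ioo
    (fun s hs => quadraticWeight_mul_pow ht μ ν n hs), integral_const_mul] at h
  -- Legendre duplication trades Γ(A), A = (μ-ν+n)/2, for (μ-ν)ₙ Γ(μ-ν) / Γ(A+1/2). This is the
  -- source of the Gamma value and the power of 2 in the normalization of the moment.
  have hG := Complex.Gamma_mul_Gamma_add_half A
  rw [show 2 * A = μ - ν + n by rw [hA]; ring, Gamma_add_nat _ hμ,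
    show A + 1 / 2 = (μ - ν + n + 1) / 2 by rw [hA]; ring] at hG
  have hne : Complex.Gamma ((μ - ν + n + 1) / 2) ≠ 0 := by
    refine Complex.Gamma_ne_zero_of_re_pos ?_
    rw [show (μ - ν + n + 1) / 2 = A + ((1 / 2 : ℝ) : ℂ) by rw [hA]; push_cast; ring,
      Complex.add_re, Complex.ofReal_re]
    positivity
  have h1t : (1 - t : ℂ) ≠ 0 := by
    have : (1 - t : ℝ) ≠ 0 := by linarith [abs_lt.1 ht]
    exact_mod_cast this
  have e2 : (2 : ℂ) ^ (1 - (μ - ν + n)) = 2 * (2 ^ (-(μ - ν)) * (2 ^ n)⁻¹) := by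
    rw [show 1 - (μ - ν + n) = 1 + -(μ - ν) + -(n : ℂ) by ring,
      Complex.cpow_add _ _ two_ne_zero, Complex.cpow_add _ _ two_ne_zero, Complex.cpow_one,
      Complex.cpow_neg 2 (n : ℂ), Complex.cpow_natCast]
    ring
  have e3 : (1 - t : ℂ) ^ (μ - ν - 1) * (1 - t : ℂ) ^ (1 - (μ - ν)) = 1 := by
    rw [← Complex.cpow_add _ _ h1t]; simp
  rw [e2] at hG
  rw [quadraticMoment, ← hA, show A + ν + 1 = ν + 1 + A by ring]
  have hG' : Complex.Gamma A = poch (μ - ν) n * Complex.Gamma (μ - ν) *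
      (2 * (2 ^ (-(μ - ν)) * (2 ^ n)⁻¹)) * √Real.pi / Complex.Gamma ((μ - ν + n + 1) / 2) := by
    rw [eq_div_iff hne]; exact_mod_cast hG
  rw [hG'] at h
  set I := ∫ s in Set.Ioo (0 : ℝ) 1, quadraticWeight t μ ν s * (quadraticArg t s : ℂ) ^ n
  have : I = (1 / 2) * (1 - t : ℂ) ^ (1 - (μ - ν)) * (2 * (1 - t : ℂ) ^ (μ - ν - 1) * I) := by
    linear_combination -I * e3
  rw [this, h]
  field_simp

lemma eulerWeight_mul {t : ℝ} (ht : |t| < 1) (μ ν : ℂ) {s : ℝ} (hs : s ∈ Set.Ioo (0 : ℝ) 1) :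
    eulerWeight t μ ν s * ((1 + (s : ℂ)) ^ ν * ((1 + (t : ℂ) * s) ^ (-ν) *
      (1 - (t : ℂ) * s ^ 2) ^ (-μ))) = quadraticWeight t μ ν s := by
  have h : (1 + (t : ℂ) * s) ≠ 0 := by exact_mod_cast (one_add_mul_pos ht hs.1.le hs.2.le).ne'
  have e : (1 + (t : ℂ) * s) ^ ν * (1 + (t : ℂ) * s) ^ (-ν) = 1 := by
    rw [← Complex.cpow_add _ _ h]; simp
  simp only [eulerWeight, quadraticWeight]
  push_cast
  linear_combination betaKernel (μ - ν) (ν + 1) s * (1 + (s : ℂ)) ^ ν *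
    (1 - (t : ℂ) * s ^ 2) ^ (-μ) * e

/-- In terms of s, 1+y = (1+s)(1-ts)/(1-ts²), 1-θw = (1-ts)(1+ts)/(1-ts²) and 1-w/2 = 1/(1-ts²). The
factors 1-ts cancel and the weights match. -/
lemma quadraticWeight_mul {t : ℝ} (ht : |t| < 1) (μ ν : ℂ) {s : ℝ} (hs : s ∈ Set.Ioo (0 : ℝ) 1)
    {κ θ : ℂ} (hκ : κ = -4 * t / (1 - t) ^ 2) (hθ : θ = (1 - t) / 2) :
    quadraticWeight t μ ν s * ((1 + (quadraticArg t s : ℂ)) ^ (-ν) *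
      ((1 - θ * (1 - (1 - κ * (quadraticArg t s : ℂ) ^ 2) ^ (1 / 2 : ℂ))) ^ ν *
      (1 - 1 / 2 * (1 - (1 - κ * (quadraticArg t s : ℂ) ^ 2) ^ (1 / 2 : ℂ))) ^ (-μ))) =
      eulerWeight t μ ν s := by
  have ht2 := abs_lt.1 ht
  have h := one_sub_mul_sq_pos ht hs.1.le hs.2.le
  have p2 : 0 < 1 + s := by linarith [hs.1]
  have p3 : 0 < 1 - t := by linarith
  have p4 := one_add_mul_pos ht hs.1.le hs.2.le
  have p5 := one_sub_mul_pos ht hs.1.le hs.2.le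
  have p6 : 0 < 1 + t * s ^ 2 := one_add_mul_pos ht (by positivity) (pow_le_one₀ hs.1.le hs.2.le)
  have c1 : (1 - t : ℂ) ≠ 0 := by exact_mod_cast p3.ne'
  have c2 : (1 - t * s ^ 2 : ℂ) ≠ 0 := by exact_mod_cast h.ne'
  -- The radicand is the square of a positive number, so the principal root is that number.
  have hw : (1 - κ * (quadraticArg t s : ℂ) ^ 2) ^ (1 / 2 : ℂ) =
      (((1 + t * s ^ 2) / (1 - t * s ^ 2) : ℝ) : ℂ) := by
    have : 1 - κ * (quadraticArg t s : ℂ) ^ 2 =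
        (((1 + t * s ^ 2) / (1 - t * s ^ 2) : ℝ) : ℂ) ^ 2 := by
      rw [hκ, quadraticArg]; push_cast; field_simp; ring
    rw [this, one_div, Complex.sq_cpow_two_inv]
    rw [Complex.ofReal_re]; positivity
  have f1 : 1 + (quadraticArg t s : ℂ) =
      (((1 + s) * (1 - t * s) / (1 - t * s ^ 2) : ℝ) : ℂ) := by
    rw [quadraticArg]; push_cast; rw [eq_div_iff c2, add_mul, div_mul_cancel₀ _ c2]; ring
  have f2 : 1 - θ * (1 - (((1 + t * s ^ 2) / (1 - t * s ^ 2) : ℝ) : ℂ)) =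
      (((1 - t * s) * (1 + t * s) / (1 - t * s ^ 2) : ℝ) : ℂ) := by
    rw [hθ]; push_cast; field_simp; ring
  have f3 : 1 - 1 / 2 * (1 - (((1 + t * s ^ 2) / (1 - t * s ^ 2) : ℝ) : ℂ)) =
      ((1 / (1 - t * s ^ 2) : ℝ) : ℂ) := by
    push_cast; field_simp; ring
  have q1 : 0 < (1 + s) * (1 - t * s) / (1 - t * s ^ 2) := by positivity
  have q2 : 0 < (1 - t * s) * (1 + t * s) / (1 - t * s ^ 2) := by positivity
  have q3 : 0 < 1 / (1 - t * s ^ 2) := by positivity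
  rw [hw, f1, f2, f3, quadraticWeight, eulerWeight]
  simp only [ofReal_cpow_eq_exp q1, ofReal_cpow_eq_exp q2, ofReal_cpow_eq_exp q3,
    ofReal_cpow_eq_exp p2, ofReal_cpow_eq_exp p4, ofReal_cpow_eq_exp h]
  simp only [mul_assoc, ← Complex.exp_add]
  congr 2
  rw [Real.log_div (by positivity) (by positivity), Real.log_mul p2.ne' p5.ne',
    Real.log_div (by positivity) (by positivity), Real.log_mul p5.ne' p4.ne',
    Real.log_div (by positivity) (by positivity), Real.log_one]
  push_cast
  ring

/-- The value of the expansion in Euler moments. -/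
def eulerExpansionSum (t μ ν : ℂ) : ℂ :=
  (1 - t) ^ (1 - (μ - ν)) * 2 ^ (-(μ - ν)) * √Real.pi * quadraticMoment t μ ν 0

theorem hasSum_eulerMoment {t : ℝ} (ht : |t| < 1) {μ ν : ℂ} (hμ : 0 < (μ - ν).re)
    (hν : 0 < ν.re) :
    HasSum (fun n => PowerSeries.coeff n (eulerSeries t μ ν) * eulerMoment t μ ν n)
      (eulerExpansionSum t μ ν) := by
  have htn : ‖(t : ℂ)‖ < 1 := by simpa using ht
  obtain ⟨K, -, hK⟩ := exists_coeffBound_eulerSeries htn (max ‖μ‖ ‖ν‖)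
  have hsum := summable_of_coeffBound (hK μ ν (le_max_left _ _) (le_max_right _ _)).1 (by linarith)
  have hν' : -1 < ν.re := by linarith
  have h := hasSum_integral_mul (integrableOn_eulerWeight ht hμ hν') hsum
    (y := fun s => s) continuousOn_id (fun s hs => abs_le.2 ⟨by linarith [hs.1], hs.2.le⟩)
    (f := fun s => (1 + (s : ℂ)) ^ ν * ((1 + (t : ℂ) * s) ^ (-ν) * (1 - (t : ℂ) * s ^ 2) ^ (-μ)))
    (fun s hs => (represents_eulerSeries htn μ ν s (by
      rw [Complex.norm_real, Real.norm_of_nonneg hs.1.le]; exact hs.2)).2)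
  have e : ∫ s in Set.Ioo (0 : ℝ) 1, eulerWeight t μ ν s * ((1 + (s : ℂ)) ^ ν *
      ((1 + (t : ℂ) * s) ^ (-ν) * (1 - (t : ℂ) * s ^ 2) ^ (-μ))) =
      Complex.Gamma (μ - ν) * Complex.Gamma (ν + 1) * eulerExpansionSum t μ ν := by
    rw [eulerExpansionSum, ← integral_quadraticWeight_mul_pow ht hμ hν' 0]
    refine setIntegral_congr_fun measurableSet_Ioo fun s hs => ?_
    rw [pow_zero, mul_one]
    exact eulerWeight_mul ht μ ν hs
  have g0 : Complex.Gamma (μ - ν) * Complex.Gamma (ν + 1) ≠ 0 :=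
    mul_ne_zero (Complex.Gamma_ne_zero_of_re_pos hμ)
      (Complex.Gamma_ne_zero_of_re_pos (by simp; linarith))
  rw [e] at h
  refine (hasSum_mul_left_iff g0).1 (h.congr_fun fun n => ?_)
  rw [integral_eulerWeight_mul_pow ht hμ hν']
  ring

/-- The value of the expansion in quadratic moments. -/
def quadraticExpansionSum (t μ ν : ℂ) : ℂ :=
  (1 - t) ^ (μ - ν - 1) * 2 ^ (μ - ν) / √Real.pi * eulerMoment t μ ν 0

/-- Summability is a hypothesis so that the result serves both |κ| < 1 and κ = -1. -/
theorem hasSum_quadraticMoment {t : ℝ} (ht : |t| < 1) {μ ν κ θ : ℂ} (hμ : 0 < (μ - ν).re)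
    (hν : -1 < ν.re) (hκ : κ = -4 * t / (1 - t) ^ 2) (hθ : θ = (1 - t) / 2) (hκ1 : ‖κ‖ ≤ 1)
    (hsum : Summable fun n => ‖PowerSeries.coeff n (quadraticInvSeries θ κ μ ν)‖) :
    HasSum (fun n => PowerSeries.coeff n (quadraticInvSeries θ κ μ ν) * quadraticMoment t μ ν n)
      (quadraticExpansionSum t μ ν) := by
  have ht2 := abs_lt.1 ht
  have htn : ‖θ‖ < 1 := by
    rw [hθ, show ((1 - t) / 2 : ℂ) = (((1 - t) / 2 : ℝ) : ℂ) by push_cast; rfl, Complex.norm_real,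
      Real.norm_eq_abs, abs_lt]
    constructor <;> linarith
  have p3 : 0 < 1 - t := by linarith
  have c1 : (1 - t : ℂ) ≠ 0 := by exact_mod_cast p3.ne'
  have h := hasSum_integral_mul (integrableOn_quadraticWeight ht hμ hν) hsum
    (y := quadraticArg t) (ContinuousOn.div (by fun_prop) (by fun_prop)
      fun s hs => (one_sub_mul_sq_pos ht hs.1.le hs.2.le).ne')
    (fun s hs => abs_le.2 ⟨by linarith [(quadraticArg_mem ht hs).1], (quadraticArg_mem ht hs).2.le⟩)
    (fun s hs => (represents_quadraticInvSeries htn le_rfl (by simpa using hκ1) μ ν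
      (quadraticArg t s) (by
      rw [Complex.norm_real, Real.norm_of_nonneg (quadraticArg_mem ht hs).1.le]
      exact (quadraticArg_mem ht hs).2)).2)
  rw [setIntegral_congr_fun measurableSet_Ioo (fun s hs => quadraticWeight_mul ht μ ν hs hκ hθ)] at h
  have e := integral_eulerWeight_mul_pow ht hμ hν 0
  simp only [pow_zero, mul_one] at e
  have g0 : Complex.Gamma (μ - ν) * Complex.Gamma (ν + 1) ≠ 0 :=
    mul_ne_zero (Complex.Gamma_ne_zero_of_re_pos hμ)
      (Complex.Gamma_ne_zero_of_re_pos (by simp; linarith))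
  have hpi : (√Real.pi : ℂ) ≠ 0 := by
    exact_mod_cast (Real.sqrt_pos.2 Real.pi_pos).ne'
  have e1 : (1 - t : ℂ) ^ (μ - ν - 1) * (1 - t : ℂ) ^ (1 - (μ - ν)) = 1 := by
    rw [← Complex.cpow_add _ _ c1]; simp
  have e2 : (2 : ℂ) ^ (μ - ν) * 2 ^ (-(μ - ν)) = 1 := by
    rw [← Complex.cpow_add _ _ two_ne_zero]; simp
  rw [e] at h
  have h' := (h.mul_left ((Complex.Gamma (μ - ν) * Complex.Gamma (ν + 1))⁻¹)).mul_left
    ((1 - t : ℂ) ^ (μ - ν - 1) * 2 ^ (μ - ν) / √Real.pi)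
  rw [inv_mul_cancel_left₀ g0] at h'
  refine h'.congr_fun fun n => ?_
  rw [integral_quadraticWeight_mul_pow ht hμ hν]
  have g1 := left_ne_zero_of_mul g0
  have g2 := right_ne_zero_of_mul g0
  field_simp
  linear_combination (-(2 : ℂ) ^ (μ - ν) * 2 ^ (-(μ - ν)) * e1 - e2) *
    PowerSeries.coeff n (quadraticInvSeries θ κ μ ν) * quadraticMoment t μ ν n

end

noncomputable section

open PowerSeries

/-! ### The two expansions -/

lemma norm_mul_le_mul_rpow {x y : ℂ} {A B α β γ : ℝ} {m n : ℕ} (hnm : n ≤ m)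
    (hx : ‖x‖ ≤ A * ((m : ℝ) + 1) ^ α) (hy : ‖y‖ ≤ B * ((m : ℝ) + 1) ^ β) (hA : 0 ≤ A)
    (hB : 0 ≤ B) (hγ : α + β ≤ γ) (hγ0 : γ ≤ 0) : ‖x * y‖ ≤ A * B * ((n : ℝ) + 1) ^ γ := by
  have hm : (0 : ℝ) < (m : ℝ) + 1 := by positivity
  have hm1 : (1 : ℝ) ≤ (m : ℝ) + 1 := by linarith [(m.cast_nonneg : (0 : ℝ) ≤ m)]
  have hnm' : (n : ℝ) ≤ m := by exact_mod_cast hnm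
  calc ‖x * y‖ ≤ (A * ((m : ℝ) + 1) ^ α) * (B * ((m : ℝ) + 1) ^ β) := by
        rw [norm_mul]; gcongr
    _ = A * B * ((m : ℝ) + 1) ^ (α + β) := by rw [Real.rpow_add hm]; ring
    _ ≤ A * B * ((m : ℝ) + 1) ^ γ := by gcongr
    _ ≤ A * B * ((n : ℝ) + 1) ^ γ := by
      refine mul_le_mul_of_nonneg_left ?_ (by positivity)
      exact Real.rpow_le_rpow_of_nonpos (by positivity) (by linarith) hγ0

lemma seriesTo_iff_sum_range {f : ℕ → ℂ} {k : ℕ} (h : ∀ n, k < n → f n = 0) {S : ℂ} :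
    SeriesTo f S ↔ ∑ n ∈ Finset.range (k + 1), f n = S := by
  have : Tendsto (fun N : ℕ => ∑ n ∈ Finset.range N, f n) atTop
      (𝓝 (∑ n ∈ Finset.range (k + 1), f n)) := by
    refine tendsto_const_nhds.congr' ?_
    filter_upwards [eventually_ge_atTop (k + 1)] with N hN
    refine Finset.sum_subset (Finset.range_mono hN) fun n _ hn => h n ?_
    simpa using hn
  exact ⟨fun hf => tendsto_nhds_unique this hf, fun e => e ▸ this⟩

lemma coeffDifferentiableOn_eulerSeries (t : ℂ) {U : Set ℂ} {μ ν : ℂ → ℂ}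
    (hμ : DifferentiableOn ℂ μ U) (hν : DifferentiableOn ℂ ν U) :
    CoeffDifferentiableOn (fun z => eulerSeries t (μ z) (ν z)) U :=
  ((CoeffDifferentiableOn.binSeries hν.neg).rescale (differentiableOn_const _)).mul
    (((CoeffDifferentiableOn.binSeries hν).rescale (differentiableOn_const _)).mul
      ((CoeffDifferentiableOn.binSeries hμ).evenLift (differentiableOn_const _)))

lemma coeffDifferentiableOn_quadraticInvSeries {U : Set ℂ} {θ κ μ ν : ℂ → ℂ}
    (hθ : DifferentiableOn ℂ θ U) (hκ : DifferentiableOn ℂ κ U)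
    (hμ : DifferentiableOn ℂ μ U) (hν : DifferentiableOn ℂ ν U) :
    CoeffDifferentiableOn (fun z => quadraticInvSeries (θ z) (κ z) (μ z) (ν z)) U :=
  ((CoeffDifferentiableOn.binSeries hν).rescale (differentiableOn_const _)).mul
    ((((CoeffDifferentiableOn.binSeries hν.neg).rescale hθ).mul
      ((CoeffDifferentiableOn.binSeries hμ).rescale
        (differentiableOn_const _))).compOneSubSqrt.evenLift hκ)

lemma differentiable_quadraticMoment {t : ℂ} (ht : ‖t‖ < 1) {μ ν : ℂ → ℂ}
    (hμ : Differentiable ℂ μ) (hν : Differentiable ℂ ν) (n : ℕ) :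
    Differentiable ℂ fun z => quadraticMoment t (μ z) (ν z) n := by
  rw [← differentiableOn_univ] at *
  exact differentiableOn_quadraticMoment isOpen_univ (fun _ _ => ht) (differentiableOn_const _)
    hμ hν n

lemma one_sub_ne_zero_of_norm_lt {t : ℂ} (ht : ‖t‖ < 1) : 1 - t ≠ 0 := by
  intro h
  rw [← sub_eq_zero.1 h] at ht
  simp at ht

lemma differentiable_eulerExpansionSum {t : ℂ} (ht : ‖t‖ < 1) {μ ν : ℂ → ℂ}
    (hμ : Differentiable ℂ μ) (hν : Differentiable ℂ ν) :
    Differentiable ℂ fun z => eulerExpansionSum t (μ z) (ν z) := by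
  simp only [eulerExpansionSum]
  refine Differentiable.mul (Differentiable.mul_const (Differentiable.mul ?_ ?_) _)
    (differentiable_quadraticMoment ht hμ hν 0)
  · exact ((hμ.sub hν).const_sub 1).const_cpow (Or.inl (one_sub_ne_zero_of_norm_lt ht))
  · exact (hμ.sub hν).neg.const_cpow (Or.inl two_ne_zero)

lemma differentiable_quadraticExpansionSum {t : ℂ} (ht : ‖t‖ < 1) {μ ν : ℂ → ℂ}
    (hμ : Differentiable ℂ μ) (hν : Differentiable ℂ ν) :
    Differentiable ℂ fun z => quadraticExpansionSum t (μ z) (ν z) := by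
  simp only [quadraticExpansionSum, div_eq_mul_inv]
  refine Differentiable.mul (Differentiable.mul_const (Differentiable.mul ?_ ?_) _)
    (differentiable_eulerMoment ht hμ hν 0)
  · exact ((hμ.sub hν).sub_const 1).const_cpow (Or.inl (one_sub_ne_zero_of_norm_lt ht))
  · exact (hμ.sub hν).const_cpow (Or.inl two_ne_zero)

/-- Continuation starts at (μ, ν) = (3, 1), inside the region of termwise integration. Pairing
neighbours (d = 1) is effective because (1+X) times the generating series has smaller coefficients,
the singularity being at -1. -/
theorem seriesTo_eulerMoment {t : ℝ} (ht : |t| < 1) (μ ν : ℂ) (hν : -1 < ν.re) :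
    SeriesTo (fun n => coeff n (eulerSeries t μ ν) * eulerMoment t μ ν n)
      (eulerExpansionSum t μ ν) := by
  have htn : ‖(t : ℂ)‖ < 1 := by simpa using ht
  refine seriesTo_of_line (σ := ((-1 : ℝ) : EReal)) (μ₀ := 3) (ν₀ := 1)
    (T := fun n μ ν => coeff n (eulerSeries t μ ν) * eulerMoment t μ ν n)
    (F := eulerExpansionSum t) (by simp only [EReal.coe_lt_coe_iff]; norm_num)
    (by simpa only [EReal.coe_lt_coe_iff] using hν) (fun n μ ν hμ hν => ?_)
    (fun μ ν hμ hν => differentiable_eulerExpansionSum htn hμ hν)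
    (fun μ ν U hU hμ hν hUν => ?_) ?_
  · refine Differentiable.mul ?_ (differentiable_eulerMoment htn hμ hν n)
    exact differentiableOn_univ.1
      (coeffDifferentiableOn_eulerSeries t hμ.differentiableOn hν.differentiableOn n)
  · simp only [EReal.coe_lt_coe_iff] at hUν
    refine tendstoLocallyUniformlyOn_of_oscillating hU 1 fun K hKU hK => ?_
    obtain ⟨R, hR⟩ := exists_norm_le_on_compact hK hμ.continuous hν.continuous
    obtain ⟨δ, hδ0, hδ1, hδ⟩ := exists_lt_re_on_compact hK hν.continuous
      (fun z hz => hUν z (hKU hz))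
    obtain ⟨A, hA, hA'⟩ := exists_coeffBound_eulerSeries htn R
    obtain ⟨B, hB, hB'⟩ := exists_norm_eulerMoment_le R htn
    refine ⟨A * B, δ, hδ0, fun z hz n => ?_⟩
    obtain ⟨a1, a2⟩ := hA' _ _ (hR z hz).1 (hR z hz).2
    have b := hB' _ _ (hR z hz).1 (hR z hz).2
    have hd := hδ z hz
    refine ⟨norm_mul_le_mul_rpow le_rfl (a1 n) (b n).1 hA.le hB.le (by linarith) (by linarith),
      norm_mul_le_mul_rpow n.le_succ ?_ (b (n + 1)).1 hA.le hB.le (β := -(ν z).re - 1)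
        (α := -(ν z).re - 2) (by linarith) (by linarith),
      norm_mul_le_mul_rpow le_rfl (a1 n) (b n).2 hA.le hB.le (by linarith) (by linarith)⟩
    have := a2 (n + 1)
    rwa [add_mul, one_mul, map_add, coeff_succ_X_mul, add_comm] at this
  · have h1 : ∀ᶠ p : ℂ × ℂ in 𝓝 (3, 1), 0 < (p.1 - p.2).re :=
      (isOpen_lt continuous_const (by fun_prop)).mem_nhds (by norm_num)
    have h2 : ∀ᶠ p : ℂ × ℂ in 𝓝 (3, 1), 0 < p.2.re :=
      (isOpen_lt continuous_const (by fun_prop)).mem_nhds (by norm_num)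
    filter_upwards [h1, h2] with p hp1 hp2
    exact (hasSum_eulerMoment ht hp1 hp2).tendsto_sum_nat

lemma eulerMoment_eq_zero (t : ℂ) {μ ν : ℂ} {k n : ℕ} (h : ν - μ = k) (hn : k < n) :
    eulerMoment t μ ν n = 0 := by
  rw [eulerMoment, show μ - ν = -(k : ℂ) by rw [← h]; ring, poch_neg_nat k hn, zero_mul]

lemma quadraticMoment_eq_zero (t : ℂ) {μ ν : ℂ} {k n : ℕ} (h : ν - μ = k) (hn : k < n) :
    quadraticMoment t μ ν n = 0 := by
  rw [quadraticMoment, show μ - ν = -(k : ℂ) by rw [← h]; ring, poch_neg_nat k hn, zero_div,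
    zero_mul]

/-- With μ = ν - k the sum is finite and both sides are entire in ν; they agree for Re ν > -1 by the
previous theorem. -/
theorem seriesTo_eulerMoment_of_terminating {t : ℝ} (ht : |t| < 1) {μ ν : ℂ} {k : ℕ}
    (hk : ν - μ = k) :
    SeriesTo (fun n => coeff n (eulerSeries t μ ν) * eulerMoment t μ ν n)
      (eulerExpansionSum t μ ν) := by
  have htn : ‖(t : ℂ)‖ < 1 := by simpa using ht
  have hμ : Differentiable ℂ fun z : ℂ => z - k := by fun_prop
  have hz : ∀ z : ℂ, z - (z - k) = k := fun z => by ring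
  have key : ∀ z : ℂ, ∀ n, k < n →
      coeff n (eulerSeries t (z - k) z) * eulerMoment t (z - k) z n = 0 := fun z n hn => by
    rw [eulerMoment_eq_zero t (hz z) hn, mul_zero]
  obtain rfl : μ = ν - k := by rw [← hk]; ring
  rw [seriesTo_iff_sum_range (key ν)]
  have d1 : Differentiable ℂ fun z : ℂ => ∑ n ∈ Finset.range (k + 1),
      coeff n (eulerSeries t (z - k) z) * eulerMoment t (z - k) z n := by
    refine Differentiable.fun_sum fun n _ => Differentiable.mul ?_
      (differentiable_eulerMoment htn hμ differentiable_id n)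
    exact differentiableOn_univ.1 (coeffDifferentiableOn_eulerSeries t hμ.differentiableOn
      differentiableOn_id n)
  have d2 : Differentiable ℂ fun z : ℂ => eulerExpansionSum t (z - k) z :=
    differentiable_eulerExpansionSum htn hμ differentiable_id
  refine congr_fun (AnalyticOnNhd.eq_of_eventuallyEq (𝕜 := ℂ) (z₀ := 0)
    (d1.differentiableOn.analyticOnNhd isOpen_univ)
    (d2.differentiableOn.analyticOnNhd isOpen_univ) ?_) ν
  have h1 : ∀ᶠ z : ℂ in 𝓝 0, -1 < z.re :=
    (isOpen_lt continuous_const Complex.continuous_re).mem_nhds (by norm_num)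
  filter_upwards [h1] with z hz1
  exact (seriesTo_iff_sum_range (key z)).1 (seriesTo_eulerMoment ht _ z hz1)

lemma norm_half_one_sub_lt {t : ℝ} (ht : |t| < 1) : ‖((1 - t : ℂ) / 2)‖ < 1 := by
  have ht2 := abs_lt.1 ht
  rw [show ((1 - t) / 2 : ℂ) = (((1 - t) / 2 : ℝ) : ℂ) by push_cast; rfl, Complex.norm_real,
    Real.norm_eq_abs, abs_lt]
  constructor <;> linarith

/-- The base region for the inverse expansions: Re ν > -1 keeps the weight integrable, Re ν < 0
makes the coefficients n^(Re ν-1) summable. -/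
lemma eventually_nhds_one_neg_half : ∀ᶠ p : ℂ × ℂ in 𝓝 (1, ((-(1 / 2) : ℝ) : ℂ)),
    0 < (p.1 - p.2).re ∧ -1 < p.2.re ∧ p.2.re < 0 := by
  have h1 : ∀ᶠ p : ℂ × ℂ in 𝓝 (1, ((-(1 / 2) : ℝ) : ℂ)), 0 < (p.1 - p.2).re := by
    refine (isOpen_lt continuous_const (by fun_prop)).mem_nhds ?_
    simp only [Set.mem_ofPred_eq, Complex.sub_re, Complex.one_re, Complex.ofReal_re]; norm_num
  have h2 : ∀ᶠ p : ℂ × ℂ in 𝓝 (1, ((-(1 / 2) : ℝ) : ℂ)), -1 < p.2.re := by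
    refine (isOpen_lt continuous_const (by fun_prop)).mem_nhds ?_
    simp only [Set.mem_ofPred_eq, Complex.ofReal_re]; norm_num
  have h3 : ∀ᶠ p : ℂ × ℂ in 𝓝 (1, ((-(1 / 2) : ℝ) : ℂ)), p.2.re < 0 := by
    refine (isOpen_lt (by fun_prop) continuous_const).mem_nhds ?_
    simp only [Set.mem_ofPred_eq, Complex.ofReal_re]; norm_num
  exact h1.and (h2.and h3)

/-- Coefficients n^(Re ν-1) against moments n^(-Re ν-1) give n^(-2) whatever ν is, so the
continuation meets no obstacle. -/
theorem seriesTo_quadraticMoment {t : ℝ} (ht : |t| < 1) {κ θ : ℂ}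
    (hκ : κ = -4 * t / (1 - t) ^ 2) (hθ : θ = (1 - t) / 2) (hκ1 : ‖κ‖ < 1) (μ ν : ℂ) :
    SeriesTo (fun n => coeff n (quadraticInvSeries θ κ μ ν) * quadraticMoment t μ ν n)
      (quadraticExpansionSum t μ ν) := by
  have htn : ‖(t : ℂ)‖ < 1 := by simpa using ht
  have hθ1 : ‖θ‖ < 1 := hθ ▸ norm_half_one_sub_lt ht
  refine seriesTo_of_line (σ := ⊥) (μ₀ := 1) (ν₀ := ((-(1 / 2) : ℝ) : ℂ))
    (T := fun n μ ν => coeff n (quadraticInvSeries θ κ μ ν) * quadraticMoment t μ ν n)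
    (F := quadraticExpansionSum t) (EReal.bot_lt_coe _) (EReal.bot_lt_coe _)
    (fun n μ ν hμ hν => ?_) (fun μ ν hμ hν => differentiable_quadraticExpansionSum htn hμ hν)
    (fun μ ν U hU hμ hν _ => ⟨_, tendstoLocallyUniformlyOn_of_abs hU fun K hKU hK => ?_⟩) ?_
  · refine Differentiable.mul ?_ (differentiable_quadraticMoment htn hμ hν n)
    exact differentiableOn_univ.1 (coeffDifferentiableOn_quadraticInvSeries
      (differentiableOn_const θ) (differentiableOn_const κ) hμ.differentiableOn
      hν.differentiableOn n)
  · obtain ⟨R, hR⟩ := exists_norm_le_on_compact hK hμ.continuous hν.continuous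
    obtain ⟨A, hA, hA'⟩ := exists_coeffBound_quadraticInvSeries hθ1 hκ1 R
    obtain ⟨B, hB, hB'⟩ := exists_norm_quadraticMoment_le R htn
    refine ⟨A * B, 1, one_pos, fun z hz n => ?_⟩
    exact norm_mul_le_mul_rpow le_rfl (hA' _ _ (hR z hz).1 (hR z hz).2 n)
      (hB' _ _ (hR z hz).1 (hR z hz).2 n).1 hA.le hB.le (by linarith) (by linarith)
  · filter_upwards [eventually_nhds_one_neg_half] with p ⟨hp1, hp2, hp3⟩
    obtain ⟨A, -, hA'⟩ := exists_coeffBound_quadraticInvSeries hθ1 hκ1 (max ‖p.1‖ ‖p.2‖)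
    exact (hasSum_quadraticMoment ht hp1 hp2 hκ hθ hκ1.le (summable_of_coeffBound
      (hA' _ _ (le_max_left _ _) (le_max_right _ _)) (by linarith))).tendsto_sum_nat

theorem seriesTo_quadraticMoment_critical {t : ℝ} (ht : |t| < 1) {θ : ℂ}
    (hκ : (-1 : ℂ) = -4 * t / (1 - t) ^ 2) (hθ : θ = (1 - t) / 2) (μ ν : ℂ)
    (hν : -(5 / 2) < ν.re) :
    SeriesTo (fun n => coeff n (quadraticInvSeries θ (-1) μ ν) * quadraticMoment t μ ν n)
      (quadraticExpansionSum t μ ν) := by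
  have htn : ‖(t : ℂ)‖ < 1 := by simpa using ht
  have hθ1 : ‖θ‖ < 1 := hθ ▸ norm_half_one_sub_lt ht
  refine seriesTo_of_line (σ := ((-(5 / 2) : ℝ) : EReal)) (μ₀ := 1) (ν₀ := ((-(1 / 2) : ℝ) : ℂ))
    (T := fun n μ ν => coeff n (quadraticInvSeries θ (-1) μ ν) * quadraticMoment t μ ν n)
    (F := quadraticExpansionSum t)
    (by rw [Complex.ofReal_re, EReal.coe_lt_coe_iff]; norm_num)
    (by rwa [EReal.coe_lt_coe_iff])
    (fun n μ ν hμ hν => ?_) (fun μ ν hμ hν => differentiable_quadraticExpansionSum htn hμ hν)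
    (fun μ ν U hU hμ hν hUν => ?_) ?_
  · refine Differentiable.mul ?_ (differentiable_quadraticMoment htn hμ hν n)
    exact differentiableOn_univ.1 (coeffDifferentiableOn_quadraticInvSeries
      (differentiableOn_const θ) (differentiableOn_const _) hμ.differentiableOn
      hν.differentiableOn n)
  · simp only [EReal.coe_lt_coe_iff] at hUν
    -- The slowly decaying part comes from y = ±i, where the coefficients change sign from n to n+2;
    -- hence d = 2.
    refine tendstoLocallyUniformlyOn_of_oscillating hU 2 fun K hKU hK => ?_
    obtain ⟨R, hR⟩ := exists_norm_le_on_compact hK hμ.continuous hν.continuous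
    obtain ⟨δ, hδ0, hδ1, hδ⟩ := exists_lt_re_on_compact hK hν.continuous
      (fun z hz => hUν z (hKU hz))
    obtain ⟨A, hA, hA'⟩ := exists_coeffBound_quadraticInvSeries_critical hθ1 R
    obtain ⟨B, hB, hB'⟩ := exists_norm_quadraticMoment_le R htn
    refine ⟨A * B, δ, hδ0, fun z hz n => ?_⟩
    obtain ⟨a1, a2⟩ := hA' _ _ (hR z hz).1 (hR z hz).2
    have b := hB' _ _ (hR z hz).1 (hR z hz).2
    have hd := hδ z hz
    have m1 : max (-(3 / 2)) ((ν z).re - 1) + (-(ν z).re - 1) ≤ -δ := by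
      rw [← le_sub_iff_add_le, max_le_iff]; constructor <;> linarith
    have m2 : max (-(5 / 2)) ((ν z).re - 1) + (-(ν z).re - 1) ≤ -1 - δ := by
      rw [← le_sub_iff_add_le, max_le_iff]; constructor <;> linarith
    have m3 : max (-(3 / 2)) ((ν z).re - 1) + (-(ν z).re - 2) ≤ -1 - δ := by
      rw [← le_sub_iff_add_le, max_le_iff]; constructor <;> linarith
    refine ⟨norm_mul_le_mul_rpow le_rfl (a1 n) (b n).1 hA.le hB.le m1 (by linarith),
      norm_mul_le_mul_rpow (n.le_add_right 2) ?_ (b (n + 2)).1 hA.le hB.le m2 (by linarith),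
      norm_mul_le_mul_rpow le_rfl (a1 n) (b n).2 hA.le hB.le m3 (by linarith)⟩
    have := a2 (n + 2)
    rwa [add_mul, one_mul, map_add, coeff_X_pow_mul, add_comm] at this
  · filter_upwards [eventually_nhds_one_neg_half] with p ⟨hp1, hp2, hp3⟩
    obtain ⟨A, -, hA'⟩ := exists_coeffBound_quadraticInvSeries_critical hθ1 (max ‖p.1‖ ‖p.2‖)
    exact (hasSum_quadraticMoment ht hp1 hp2 hκ hθ (by simp) (summable_of_coeffBound
      (hA' _ _ (le_max_left _ _) (le_max_right _ _)).1
      (max_lt (by norm_num) (by linarith)))).tendsto_sum_nat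

/-- The coefficients are polynomials in θ and κ, so the finite sum is holomorphic in |t| < 1 even
where |κ| > 1 and the series no longer converges on the unit disc. The identity for small positive t
therefore spreads to the whole disc. -/
theorem seriesTo_quadraticMoment_of_terminating {t : ℝ} (ht : |t| < 1) {μ ν : ℂ} {k : ℕ}
    (hk : ν - μ = k) :
    SeriesTo (fun n => coeff n (quadraticInvSeries ((1 - t) / 2) (-4 * t / (1 - t) ^ 2) μ ν) *
      quadraticMoment t μ ν n) (quadraticExpansionSum t μ ν) := by
  have htn : ‖(t : ℂ)‖ < 1 := by simpa using ht
  have key : ∀ t : ℂ, ∀ n, k < n →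
      coeff n (quadraticInvSeries ((1 - t) / 2) (-4 * t / (1 - t) ^ 2) μ ν) *
        quadraticMoment t μ ν n = 0 := fun t n hn => by
    rw [quadraticMoment_eq_zero t hk hn, mul_zero]
  rw [seriesTo_iff_sum_range (key t)]
  set U : Set ℂ := Metric.ball 0 1
  have hU : IsOpen U := Metric.isOpen_ball
  have hU1 : ∀ z ∈ U, ‖z‖ < 1 := fun z hz => by simpa [U] using hz
  have d1 : DifferentiableOn ℂ (fun z : ℂ => ∑ n ∈ Finset.range (k + 1),
      coeff n (quadraticInvSeries ((1 - z) / 2) (-4 * z / (1 - z) ^ 2) μ ν) *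
        quadraticMoment z μ ν n) U := by
    refine DifferentiableOn.fun_sum fun n _ => DifferentiableOn.mul ?_
      (differentiableOn_quadraticMoment hU hU1 differentiableOn_id (differentiableOn_const _)
        (differentiableOn_const _) n)
    refine coeffDifferentiableOn_quadraticInvSeries (by fun_prop) ?_ (differentiableOn_const _)
      (differentiableOn_const _) n
    exact DifferentiableOn.div (by fun_prop) (by fun_prop)
      fun z hz => pow_ne_zero 2 (one_sub_ne_zero_of_norm_lt (hU1 z hz))
  have d2 : DifferentiableOn ℂ (fun z : ℂ => quadraticExpansionSum z μ ν) U := by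
    simp only [quadraticExpansionSum, eulerMoment]
    refine DifferentiableOn.mul (DifferentiableOn.div_const (DifferentiableOn.mul_const ?_ _) _)
      (DifferentiableOn.const_mul (differentiableOn_regHyp hU (differentiableOn_const _)
        (differentiableOn_const _) (differentiableOn_const _) differentiableOn_id.neg ?_) _)
    · refine DifferentiableOn.cpow (by fun_prop) (differentiableOn_const _) fun z hz => ?_
      refine Complex.mem_slitPlane_iff.2 (Or.inl ?_)
      have := (Complex.re_le_norm z).trans_lt (hU1 z hz)
      simpa using this
    · intro z hz
      simpa using hU1 z hz
  refine (d1.analyticOnNhd hU).eqOn_of_preconnected_of_frequently_eq (d2.analyticOnNhd hU)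
    (convex_ball _ _).isPreconnected (z₀ := 0) (by simp [U]) ?_ (by simpa [U] using ht)
  -- The identity is known for real t only, so a sequence of real points accumulating at 0 is used.
  -- For r < 1/10, |κ| = 4r/(1-r)² < 1.
  have hlim : Tendsto (fun m : ℕ => ((1 / ((m : ℝ) + 1) : ℝ) : ℂ)) atTop (𝓝[≠] 0) := by
    refine tendsto_nhdsWithin_iff.2 ⟨?_, Eventually.of_forall fun m => ?_⟩
    · have := (Complex.continuous_ofReal.tendsto 0).comp
        (tendsto_one_div_add_atTop_nhds_zero_nat (𝕜 := ℝ))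
      simpa [Function.comp_def] using this
    · have : (1 / ((m : ℝ) + 1)) ≠ 0 := by positivity
      exact Complex.ofReal_ne_zero.2 this
  refine hlim.frequently (Eventually.frequently ?_)
  have hev : ∀ᶠ m : ℕ in atTop, 1 / ((m : ℝ) + 1) < 1 / 10 :=
    tendsto_one_div_add_atTop_nhds_zero_nat.eventually_lt_const (by norm_num)
  filter_upwards [hev] with m hm
  have hpos : 0 < 1 / ((m : ℝ) + 1) := by positivity
  set r := 1 / ((m : ℝ) + 1)
  refine (seriesTo_iff_sum_range (key r)).1 (seriesTo_quadraticMoment (t := r)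
    (abs_lt.2 ⟨by linarith, by linarith⟩) rfl rfl ?_ μ ν)
  rw [show (-4 * r / (1 - r) ^ 2 : ℂ) = ((-4 * r / (1 - r) ^ 2 : ℝ) : ℂ) by push_cast; rfl,
    Complex.norm_real, Real.norm_eq_abs, neg_mul, neg_div, abs_neg, abs_of_pos (by
      have : 0 < 1 - r := by linarith
      positivity), div_lt_one (by nlinarith)]
  nlinarith

end

noncomputable section

open PowerSeries

/-! ### Maclaurin coefficients of the generating functions -/

lemma ofReal_mul_cpow {c : ℝ} (hc : 0 < c) (z s : ℂ) : ((c : ℂ) * z) ^ s = (c : ℂ) ^ s * z ^ s := by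
  have hc0 : (c : ℂ) ≠ 0 := by exact_mod_cast hc.ne'
  rcases eq_or_ne z 0 with rfl | hz
  · rcases eq_or_ne s 0 with rfl | hs
    · simp
    · simp [Complex.zero_cpow hs]
  · rw [Complex.cpow_def_of_ne_zero (mul_ne_zero hc0 hz), Complex.log_ofReal_mul hc hz,
      Complex.cpow_def_of_ne_zero hc0, Complex.cpow_def_of_ne_zero hz, ← Complex.exp_add,
      Complex.ofReal_log hc.le, add_mul]

lemma maclaurinCoeff_eulerSeries {t w : ℂ} (hw : w ≠ 0) (ht : ‖t‖ < 1) (μ ν : ℂ) (n : ℕ) :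
    maclaurinCoeff (fun z => (1 + w⁻¹ * z) ^ ν * ((1 + t * (w⁻¹ * z)) ^ (-ν) *
      (1 - t * (w⁻¹ * z) ^ 2) ^ (-μ))) n = w⁻¹ ^ n * coeff n (eulerSeries t μ ν) := by
  have h := (represents_eulerSeries ht μ ν).rescale w⁻¹ (s := ‖w‖)
    (by rw [norm_inv, inv_mul_cancel₀ (norm_ne_zero_iff.2 hw)]) one_pos
  rw [h.maclaurinCoeff_eq (norm_pos_iff.2 hw), coeff_rescale]

lemma calG_eq {w : ℂ} (hw : w ≠ 0) (hw1 : ‖w ^ 2‖ < 1) (μ ν : ℂ) (n : ℕ) :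
    calG n (-ν) μ w = w⁻¹ ^ n * coeff n (eulerSeries (-w ^ 2) μ ν) := by
  rw [← maclaurinCoeff_eulerSeries hw (by rwa [norm_neg]), calG]
  congr 1
  funext z
  rw [neg_neg, show 1 + -w ^ 2 * (w⁻¹ * z) = 1 - w * z by field_simp; ring,
    show 1 - -w ^ 2 * (w⁻¹ * z) ^ 2 = 1 + z ^ 2 by field_simp; ring, inv_mul_eq_div]
  ring

lemma calGHat_eq {w : ℂ} (hw : w ≠ 0) (hw1 : ‖w ^ 2‖ < 1) (μ ν : ℂ) (n : ℕ) :
    calGHat n (-ν) μ w = w⁻¹ ^ n * coeff n (eulerSeries (w ^ 2) μ ν) := by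
  rw [← maclaurinCoeff_eulerSeries hw hw1, calGHat]
  congr 1
  funext z
  rw [neg_neg, show 1 + w ^ 2 * (w⁻¹ * z) = 1 + w * z by field_simp,
    show 1 - w ^ 2 * (w⁻¹ * z) ^ 2 = 1 - z ^ 2 by field_simp, inv_mul_eq_div]
  ring

lemma maclaurinCoeff_quadraticInvSeries {X r : ℝ} (hX : 0 < X) (hr : r ≠ 0) {θ κ : ℂ}
    (hθ : θ = X / (1 + X)) (μ ν : ℂ) (n : ℕ) :
    maclaurinCoeff (fun z => (1 + (X : ℂ) * (1 - κ * ((r : ℂ)⁻¹ * z) ^ 2) ^ (1 / 2 : ℂ)) ^ ν *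
      (1 + (1 - κ * ((r : ℂ)⁻¹ * z) ^ 2) ^ (1 / 2 : ℂ)) ^ (-μ) /
        ((2 : ℂ) ^ (-μ) * (1 + (r : ℂ)⁻¹ * z) ^ ν)) n =
      ((1 + X : ℝ) : ℂ) ^ ν * ((r : ℂ)⁻¹ ^ n * coeff n (quadraticInvSeries θ κ μ ν)) := by
  have hX1 : 0 < 1 + X := by linarith
  have hX1' : (1 + X : ℂ) ≠ 0 := by exact_mod_cast hX1.ne'
  have hr' : (r : ℂ) ≠ 0 := by exact_mod_cast hr
  have hθ1 : ‖θ‖ < 1 := by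
    rw [hθ, show (X / (1 + X) : ℂ) = ((X / (1 + X) : ℝ) : ℂ) by push_cast; rfl, Complex.norm_real,
      Real.norm_of_nonneg (by positivity), div_lt_one hX1]
    linarith
  -- Maclaurin coefficients see only a neighbourhood of 0. This radius s satisfies s ≤ 1 and |κ| s²
  -- ≤ 1 for arbitrary κ.
  have hpos : 0 < 1 / (1 + ‖κ‖) := by positivity
  have h := (represents_quadraticInvSeries hθ1 (κ := κ) (s := 1 / (1 + ‖κ‖))
    ((div_le_one (by positivity)).2 (by linarith [norm_nonneg κ])) (by
      rw [div_pow, one_pow, mul_one_div, div_le_one (by positivity)]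
      nlinarith [norm_nonneg κ]) μ ν).rescale (r : ℂ)⁻¹ (s := ‖(r : ℂ)‖ * (1 / (1 + ‖κ‖)))
    (by rw [norm_inv, inv_mul_cancel_left₀ (norm_ne_zero_iff.2 hr')]) hpos
  have h' : Represents (((1 + X : ℝ) : ℂ) ^ ν • rescale (r : ℂ)⁻¹ (quadraticInvSeries θ κ μ ν)) _ _ :=
    fun z hz => ⟨by
      refine ((h z hz).1.mul_left ‖((1 + X : ℝ) : ℂ) ^ ν‖).congr fun n => ?_
      rw [← norm_mul, coeff_smul, smul_eq_mul, mul_assoc], by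
      refine ((h z hz).2.mul_left (((1 + X : ℝ) : ℂ) ^ ν)).congr_fun fun n => ?_
      rw [coeff_smul, smul_eq_mul, mul_assoc]⟩
  have e := h'.maclaurinCoeff_eq (mul_pos (norm_pos_iff.2 hr') hpos) n
  rw [coeff_smul, coeff_rescale, smul_eq_mul] at e
  rw [← e]
  congr 1
  funext z
  beta_reduce
  set w := (1 - κ * ((r : ℂ)⁻¹ * z) ^ 2) ^ (1 / 2 : ℂ)
  have e1 : 1 + (X : ℂ) * w = ((1 + X : ℝ) : ℂ) * (1 - θ * (1 - w)) := by
    rw [hθ]; push_cast; field_simp; ring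
  have e2 : 1 + w = ((2 : ℝ) : ℂ) * (1 - 1 / 2 * (1 - w)) := by push_cast; ring
  have h2 : (2 : ℂ) ^ (-μ) ≠ 0 := by simp [Complex.cpow_eq_zero_iff]
  rw [e1, ofReal_mul_cpow hX1, e2, ofReal_mul_cpow two_pos, Complex.cpow_neg (1 + (r : ℂ)⁻¹ * z),
    Complex.ofReal_ofNat]
  field_simp

lemma frakNMinus_eq {x : ℝ} (hx0 : 0 < x) (hx1 : x < 1) (μ ν : ℂ) (n : ℕ) :
    frakNMinus n ν μ x = ((1 + x⁻¹ : ℝ) : ℂ) ^ ν * ((√(1 - x ^ 2) : ℂ)⁻¹ ^ n *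
      coeff n (quadraticInvSeries (1 / (1 + x)) (1 - x ^ 2) μ ν)) := by
  have hp : 0 < 1 - x ^ 2 := by nlinarith
  have hx : (x : ℂ) ≠ 0 := by exact_mod_cast hx0.ne'
  have hx' : (1 + x : ℂ) ≠ 0 := by exact_mod_cast (show (1 + x : ℝ) ≠ 0 by linarith)
  rw [← maclaurinCoeff_quadraticInvSeries (inv_pos.2 hx0) (Real.sqrt_pos.2 hp).ne'
    (by push_cast; field_simp; rw [add_comm (x : ℂ), div_self hx']), frakNMinus]
  have hs : (√(1 - x ^ 2) : ℂ) ^ 2 = 1 - x ^ 2 := by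
    rw [← Complex.ofReal_pow, Real.sq_sqrt hp.le]; push_cast; rfl
  have hs0 : (1 - x ^ 2 : ℂ) ≠ 0 := by exact_mod_cast hp.ne'
  have ha : |x ^ 2 - 1| = 1 - x ^ 2 := by rw [abs_sub_comm, abs_of_pos hp]
  congr 1
  funext z
  rw [ha, mul_pow, inv_pow, hs, mul_inv_cancel_left₀ hs0]
  push_cast
  rw [one_div (√(1 - x ^ 2) : ℂ)]

lemma frakNPlus_eq {x : ℝ} (hx0 : 0 < x) (hx1 : x < 1) (μ ν : ℂ) (n : ℕ) :
    frakNPlus n ν μ x = ((1 + x : ℝ) : ℂ) ^ ν * ((√((x ^ 2)⁻¹ - 1) : ℂ)⁻¹ ^ n *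
      coeff n (quadraticInvSeries (x / (1 + x)) (1 - (x ^ 2 : ℂ)⁻¹) μ ν)) := by
  have hp : 0 < (x ^ 2)⁻¹ - 1 := sub_pos.2 ((one_lt_inv₀ (by positivity)).2 (by nlinarith))
  rw [← maclaurinCoeff_quadraticInvSeries hx0 (Real.sqrt_pos.2 hp).ne' rfl, frakNPlus]
  have hs : (√((x ^ 2)⁻¹ - 1) : ℂ) ^ 2 = (x ^ 2 : ℂ)⁻¹ - 1 := by
    rw [← Complex.ofReal_pow, Real.sq_sqrt hp.le]; push_cast; rfl
  have hs0 : ((x ^ 2 : ℂ)⁻¹ - 1) ≠ 0 := by exact_mod_cast hp.ne'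
  have h1 : ∀ z : ℂ, 1 - (1 - (x ^ 2 : ℂ)⁻¹) * (((x ^ 2 : ℂ)⁻¹ - 1)⁻¹ * z ^ 2) = 1 + z ^ 2 :=
    fun z => by linear_combination z ^ 2 * mul_inv_cancel₀ hs0
  congr 1
  funext z
  rw [abs_of_pos hp, mul_pow, inv_pow, hs, h1]
  push_cast
  rw [one_div (√((x ^ 2)⁻¹ - 1) : ℂ)]

/-! ### Legendre functions and moments -/

section legendre

variable {x : ℝ}

lemma ratio_cpow (hx0 : 0 < x) (hx1 : x < 1) (z : ℂ) : (((1 - x) / (1 + x) : ℝ) : ℂ) ^ z =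
    Complex.exp ((Real.log (1 - x) - Real.log (1 + x)) * z) := by
  have h1 : 0 < 1 - x := by linarith
  have h2 : 0 < 1 + x := by linarith
  rw [ofReal_cpow_eq_exp (by positivity), Real.log_div h1.ne' h2.ne']; push_cast; rfl

lemma one_sub_sq_cpow (hx0 : 0 < x) (hx1 : x < 1) (z : ℂ) : ((1 - x ^ 2 : ℝ) : ℂ) ^ z =
    Complex.exp ((Real.log (1 - x) + Real.log (1 + x)) * z) := by
  have h1 : 0 < 1 - x := by linarith
  have h2 : 0 < 1 + x := by linarith
  rw [show 1 - x ^ 2 = (1 - x) * (1 + x) by ring, ofReal_cpow_eq_exp (by positivity),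
    Real.log_mul h1.ne' h2.ne']; push_cast; rfl

lemma two_cpow_eq_exp (z : ℂ) : (2 : ℂ) ^ z = Complex.exp (Real.log 2 * z) := by
  rw [← ofReal_cpow_eq_exp two_pos]; simp

lemma legendreP_self (hx0 : 0 < x) (hx1 : x < 1) (ν μ : ℂ) : legendreP ν μ x =
    Complex.exp (-(Real.log 2 : ℂ) * ν + Real.log (1 - x) * (μ / 2) - Real.log (1 + x) * (μ / 2 - ν)) *
      regHyp (-ν) (μ - ν) (1 + μ) (-((1 - x) / (1 + x) : ℝ)) := by
  have h1 : 0 < 1 - x := by linarith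
  have h2 : 0 < 1 + x := by linarith
  rw [legendreP, abs_of_pos h1, two_cpow_eq_exp, ofReal_cpow_eq_exp h1, ofReal_cpow_eq_exp h2,
    ← Complex.exp_add, ← Complex.exp_sub]
  congr 2
  · ring
  · rw [← Complex.ofReal_neg, add_comm x 1, ← neg_div, neg_sub]

lemma legendreP_inv (hx0 : 0 < x) (hx1 : x < 1) (ν μ : ℂ) : legendreP ν μ (1 / x) =
    Complex.exp (-(Real.log 2 : ℂ) * ν + (Real.log (1 - x) - Real.log x) * (μ / 2) -
      (Real.log (1 + x) - Real.log x) * (μ / 2 - ν)) *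
      regHyp (-ν) (μ - ν) (1 + μ) ((1 - x) / (1 + x) : ℝ) := by
  have h1 : 0 < 1 - x := by linarith
  have h2 : 0 < 1 + x := by linarith
  have e1 : |1 - 1 / x| = (1 - x) / x := by
    rw [abs_sub_comm, abs_of_pos (by rw [sub_pos, lt_div_iff₀ hx0]; linarith)]
    field_simp
  have e2 : 1 + 1 / x = (1 + x) / x := by field_simp; ring
  have e3 : (1 / x - 1) / (1 / x + 1) = (1 - x) / (1 + x) := by
    rw [add_comm (1 / x), e2]; field_simp
  rw [legendreP, e1, e2, e3, two_cpow_eq_exp, ofReal_cpow_eq_exp (by positivity),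
    ofReal_cpow_eq_exp (by positivity), ← Complex.exp_add, ← Complex.exp_sub,
    Real.log_div h1.ne' hx0.ne', Real.log_div h2.ne' hx0.ne']
  congr 2
  push_cast
  ring

lemma poch_mul_legendreP_self (hx0 : 0 < x) (hx1 : x < 1) (μ ν : ℂ) (n : ℕ) :
    poch (μ - ν) n * legendreP ν (μ + n) x =
      Complex.exp (-(Real.log 2 : ℂ) * ν + Real.log (1 - x) * ((μ + n) / 2) -
        Real.log (1 + x) * ((μ + n) / 2 - ν)) *
      eulerMoment ((1 - x) / (1 + x) : ℝ) μ ν n := by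
  rw [legendreP_self hx0 hx1, eulerMoment, show μ + n - ν = μ - ν + n by ring, add_assoc 1 μ]
  ring

lemma poch_mul_legendreP_inv (hx0 : 0 < x) (hx1 : x < 1) (μ ν : ℂ) (n : ℕ) :
    poch (μ - ν) n * legendreP ν (μ + n) (1 / x) =
      Complex.exp (-(Real.log 2 : ℂ) * ν + (Real.log (1 - x) - Real.log x) * ((μ + n) / 2) -
        (Real.log (1 + x) - Real.log x) * ((μ + n) / 2 - ν)) *
      eulerMoment (-((1 - x) / (1 + x) : ℝ)) μ ν n := by
  rw [legendreP_inv hx0 hx1, eulerMoment, neg_neg, show μ + n - ν = μ - ν + n by ring,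
    add_assoc 1 μ]
  ring

lemma poch_mul_regHyp (t μ ν : ℂ) (n : ℕ) :
    poch (μ - ν) n * regHyp (-((μ - ν - 2 + n) / 2)) ((μ + ν + n) / 2 - (μ - ν - 2 + n) / 2)
      (1 + (μ + ν + n) / 2) t / Complex.Gamma ((μ - ν + n + 1) / 2) =
      Complex.exp (Real.log 2 * n) * quadraticMoment t μ ν n := by
  rw [← two_cpow_eq_exp, Complex.cpow_natCast, quadraticMoment,
    show -((μ - ν - 2 + n) / 2) = 1 - (μ - ν + n) / 2 by ring,
    show (μ + ν + n) / 2 - (μ - ν - 2 + n) / 2 = ν + 1 by ring,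
    show 1 + (μ + ν + n) / 2 = (μ - ν + n) / 2 + ν + 1 by ring, ← mul_assoc, mul_div_assoc',
    mul_div_mul_left _ _ (pow_ne_zero n two_ne_zero)]
  ring

lemma poch_mul_legendreP_self_div (hx0 : 0 < x) (hx1 : x < 1) (μ ν : ℂ) (n : ℕ) :
    poch (μ - ν) n * legendreP ((μ - ν - 2 + n) / 2) ((μ + ν + n) / 2) x /
        Complex.Gamma ((μ - ν + n + 1) / 2) =
      Complex.exp (-(Real.log 2 : ℂ) * ((μ - ν - 2 + n) / 2) + Real.log (1 - x) * ((μ + ν + n) / 2 / 2) -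
        Real.log (1 + x) * ((μ + ν + n) / 2 / 2 - (μ - ν - 2 + n) / 2)) *
      (Complex.exp (Real.log 2 * n) * quadraticMoment (-((1 - x) / (1 + x) : ℝ)) μ ν n) := by
  rw [legendreP_self hx0 hx1, ← poch_mul_regHyp]
  ring

lemma poch_mul_legendreP_inv_div (hx0 : 0 < x) (hx1 : x < 1) (μ ν : ℂ) (n : ℕ) :
    poch (μ - ν) n * legendreP ((μ - ν - 2 + n) / 2) ((μ + ν + n) / 2) (1 / x) /
        Complex.Gamma ((μ - ν + n + 1) / 2) =
      Complex.exp (-(Real.log 2 : ℂ) * ((μ - ν - 2 + n) / 2) +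
        (Real.log (1 - x) - Real.log x) * ((μ + ν + n) / 2 / 2) -
        (Real.log (1 + x) - Real.log x) * ((μ + ν + n) / 2 / 2 - (μ - ν - 2 + n) / 2)) *
      (Complex.exp (Real.log 2 * n) * quadraticMoment ((1 - x) / (1 + x) : ℝ) μ ν n) := by
  rw [legendreP_inv hx0 hx1, ← poch_mul_regHyp]
  ring

lemma inv_sqrt_pow {r : ℝ} (hr : 0 < r) (n : ℕ) :
    (√r : ℂ)⁻¹ ^ n = Complex.exp (-(Real.log r / 2 * n)) := by
  rw [inv_pow, ← Complex.cpow_natCast, ofReal_cpow_eq_exp (Real.sqrt_pos.2 hr), ← Complex.exp_neg,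
    Real.log_sqrt hr.le]
  push_cast; rfl

end legendre

lemma SeriesTo.of_const_mul {f g : ℕ → ℂ} {S S' : ℂ} (h : SeriesTo f S) (C : ℂ)
    (hg : ∀ n, g n = C * f n) (hS : S' = C * S) : SeriesTo g S' := by
  simp only [SeriesTo, hg, hS, ← Finset.mul_sum]
  exact h.const_mul C

end

/-! ### The four expansions in terms of Legendre functions. -/

noncomputable section

open PowerSeries

section expansions

variable {x : ℝ}

lemma abs_ratio_lt_one (hx0 : 0 < x) (hx1 : x < 1) : |(1 - x) / (1 + x)| < 1 := by
  rw [abs_of_pos (div_pos (by linarith) (by linarith)), div_lt_one (by linarith)]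
  linarith

lemma sqrt_ratio_sq (hx0 : 0 < x) (hx1 : x < 1) :
    (√((1 - x) / (1 + x)) : ℂ) ^ 2 = ((1 - x) / (1 + x) : ℝ) := by
  rw [← Complex.ofReal_pow, Real.sq_sqrt (div_pos (by linarith) (by linarith)).le]

lemma norm_ratio_lt_one (hx0 : 0 < x) (hx1 : x < 1) :
    ‖(((1 - x) / (1 + x) : ℝ) : ℂ)‖ < 1 := by
  rw [Complex.norm_real]; exact abs_ratio_lt_one hx0 hx1

lemma sqrt_ratio_ne_zero (hx0 : 0 < x) (hx1 : x < 1) : (√((1 - x) / (1 + x)) : ℂ) ≠ 0 :=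
  Complex.ofReal_ne_zero.2 (Real.sqrt_pos.2 (div_pos (by linarith) (by linarith))).ne'

lemma inv_sqrt_ratio_pow (hx0 : 0 < x) (hx1 : x < 1) (n : ℕ) :
    (√((1 - x) / (1 + x)) : ℂ)⁻¹ ^ n =
      Complex.exp (-((Real.log (1 - x) - Real.log (1 + x)) / 2 * n)) := by
  have h1 : 0 < 1 - x := by linarith
  have h2 : 0 < 1 + x := by linarith
  rw [inv_sqrt_pow (by positivity), Real.log_div h1.ne' h2.ne']; push_cast; rfl

lemma one_add_ratio_cpow (hx0 : 0 < x) (hx1 : x < 1) (z : ℂ) :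
    (1 - -(((1 - x) / (1 + x) : ℝ) : ℂ)) ^ z =
      Complex.exp ((Real.log 2 - Real.log (1 + x)) * z) := by
  have h2 : 0 < 1 + x := by linarith
  have : (1 - -(((1 - x) / (1 + x) : ℝ) : ℂ)) = ((2 / (1 + x) : ℝ) : ℂ) := by
    rw [← Complex.ofReal_neg, ← Complex.ofReal_one, ← Complex.ofReal_sub]
    congr 1; field_simp; ring
  rw [this, ofReal_cpow_eq_exp (by positivity), Real.log_div two_ne_zero h2.ne']; push_cast; rfl

lemma one_sub_ratio_cpow (hx0 : 0 < x) (hx1 : x < 1) (z : ℂ) :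
    (1 - (((1 - x) / (1 + x) : ℝ) : ℂ)) ^ z =
      Complex.exp ((Real.log 2 + Real.log x - Real.log (1 + x)) * z) := by
  have h2 : 0 < 1 + x := by linarith
  have : (1 - (((1 - x) / (1 + x) : ℝ) : ℂ)) = ((2 * x / (1 + x) : ℝ) : ℂ) := by
    rw [← Complex.ofReal_one, ← Complex.ofReal_sub]
    congr 1; field_simp; ring
  rw [this, ofReal_cpow_eq_exp (by positivity), Real.log_div (by positivity) h2.ne',
    Real.log_mul two_ne_zero hx0.ne']; push_cast; rfl

lemma sqrt_pi_ne_zero : (√Real.pi : ℂ) ≠ 0 :=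
  Complex.ofReal_ne_zero.2 (Real.sqrt_pos.2 Real.pi_pos).ne'

theorem seriesTo_legendreP_inv (hx0 : 0 < x) (hx1 : x < 1) {μ ν : ℂ}
    (h : SeriesTo (fun n => coeff n (eulerSeries (-((1 - x) / (1 + x) : ℝ)) μ ν) *
      eulerMoment (-((1 - x) / (1 + x) : ℝ)) μ ν n)
      (eulerExpansionSum (-((1 - x) / (1 + x) : ℝ)) μ ν)) :
    SeriesTo
        (fun n : ℕ =>
          poch (μ - ν) n * calG n (-ν) μ ((√((1 - x) / (1 + x)) : ℝ) : ℂ)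
            / ((√Real.pi : ℂ) * (((1 - x) / (1 + x) : ℝ) : ℂ) ^ (-ν / 2))
            * legendreP ν (μ + n) (1 / x))
        (((1 - x ^ 2 : ℝ) : ℂ) ^ ((μ + ν) / 4) * legendreP ((μ - ν - 2) / 2) ((μ + ν) / 2) x
          / ((2 : ℂ) ^ ((3 * μ - ν) / 2) * (x : ℂ) ^ ν * Complex.Gamma ((μ - ν + 1) / 2))) := by
  set l2 : ℂ := ((Real.log 2 : ℝ) : ℂ) with hl2
  set lx : ℂ := ((Real.log x : ℝ) : ℂ) with hlx
  set lm : ℂ := ((Real.log (1 - x) : ℝ) : ℂ) with hlm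
  set lp : ℂ := ((Real.log (1 + x) : ℝ) : ℂ) with hlp
  refine h.of_const_mul (Complex.exp (-l2 * ν + (lm - lx) * (μ / 2) - (lp - lx) * (μ / 2 - ν) -
    (lm - lp) * (-ν / 2)) / √Real.pi) (fun n => ?_) ?_
  · have hL := poch_mul_legendreP_inv hx0 hx1 μ ν n
    have hG := calG_eq (sqrt_ratio_ne_zero hx0 hx1)
      (by rw [sqrt_ratio_sq hx0 hx1]; exact norm_ratio_lt_one hx0 hx1) μ ν n
    rw [inv_sqrt_ratio_pow hx0 hx1, sqrt_ratio_sq hx0 hx1] at hG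
    rw [ratio_cpow hx0 hx1, hG]
    simp only [← hl2, ← hlx, ← hlm, ← hlp] at hL ⊢
    -- The factor q^(n/2) of the Legendre function cancels w^(-n) from the coefficient, w = √q, so
    -- the constant of proportionality does not depend on n. The other three translations rest on
    -- the same cancellation.
    have key : Complex.exp (-((lm - lp) / 2 * n)) * Complex.exp (-l2 * ν +
        (lm - lx) * ((μ + n) / 2) - (lp - lx) * ((μ + n) / 2 - ν)) /
        Complex.exp ((lm - lp) * (-ν / 2)) = Complex.exp (-l2 * ν + (lm - lx) * (μ / 2) -
        (lp - lx) * (μ / 2 - ν) - (lm - lp) * (-ν / 2)) := by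
      rw [← Complex.exp_add, ← Complex.exp_sub]; congr 1; ring
    rw [← key]
    linear_combination (Complex.exp (-((lm - lp) / 2 * n)) *
      coeff n (eulerSeries (-((1 - x) / (1 + x) : ℝ)) μ ν) /
      (√Real.pi * Complex.exp ((lm - lp) * (-ν / 2)))) * hL
  · have hL := poch_mul_legendreP_self_div hx0 hx1 μ ν 0
    simp only [poch_zero, Nat.cast_zero, add_zero, mul_zero, Complex.exp_zero, one_mul] at hL
    rw [eulerExpansionSum, one_sub_sq_cpow hx0 hx1, one_add_ratio_cpow hx0 hx1, two_cpow_eq_exp,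
      two_cpow_eq_exp, ofReal_cpow_eq_exp hx0]
    simp only [← hl2, ← hlx, ← hlm, ← hlp] at hL ⊢
    have key : Complex.exp ((lm + lp) * ((μ + ν) / 4)) * Complex.exp (-l2 * ((μ - ν - 2) / 2) +
        lm * ((μ + ν) / 2 / 2) - lp * ((μ + ν) / 2 / 2 - (μ - ν - 2) / 2)) /
        (Complex.exp (l2 * ((3 * μ - ν) / 2)) * Complex.exp (lx * ν)) =
        Complex.exp (-l2 * ν + (lm - lx) * (μ / 2) - (lp - lx) * (μ / 2 - ν) -
        (lm - lp) * (-ν / 2)) * (Complex.exp ((l2 - lp) * (1 - (μ - ν))) *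
        Complex.exp (l2 * -(μ - ν))) := by
      simp only [← Complex.exp_add, ← Complex.exp_sub]; congr 1; ring
    have hpi := mul_inv_cancel₀ sqrt_pi_ne_zero
    linear_combination (Complex.exp ((lm + lp) * ((μ + ν) / 4)) /
      (Complex.exp (l2 * ((3 * μ - ν) / 2)) * Complex.exp (lx * ν))) * hL +
      quadraticMoment (-((1 - x) / (1 + x) : ℝ)) μ ν 0 * key -
      Complex.exp (-l2 * ν + (lm - lx) * (μ / 2) - (lp - lx) * (μ / 2 - ν) -
        (lm - lp) * (-ν / 2)) * (Complex.exp ((l2 - lp) * (1 - (μ - ν))) *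
        Complex.exp (l2 * -(μ - ν))) * quadraticMoment (-((1 - x) / (1 + x) : ℝ)) μ ν 0 * hpi

theorem seriesTo_legendreP_self (hx0 : 0 < x) (hx1 : x < 1) {μ ν : ℂ}
    (h : SeriesTo (fun n => coeff n (eulerSeries ((1 - x) / (1 + x) : ℝ) μ ν) *
      eulerMoment ((1 - x) / (1 + x) : ℝ) μ ν n)
      (eulerExpansionSum ((1 - x) / (1 + x) : ℝ) μ ν)) :
    SeriesTo
        (fun n : ℕ =>
          poch (μ - ν) n * calGHat n (-ν) μ ((√((1 - x) / (1 + x)) : ℝ) : ℂ)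
            / ((√Real.pi : ℂ) * (((1 - x) / (1 + x) : ℝ) : ℂ) ^ (-ν / 2))
            * legendreP ν (μ + n) x)
        (((1 - x ^ 2 : ℝ) : ℂ) ^ ((μ + ν) / 4) * legendreP ((μ - ν - 2) / 2) ((μ + ν) / 2) (1 / x)
          / ((2 : ℂ) ^ ((3 * μ - ν) / 2) * (x : ℂ) ^ ((μ - ν) / 2)
            * Complex.Gamma ((μ - ν + 1) / 2))) := by
  set l2 : ℂ := ((Real.log 2 : ℝ) : ℂ) with hl2
  set lx : ℂ := ((Real.log x : ℝ) : ℂ) with hlx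
  set lm : ℂ := ((Real.log (1 - x) : ℝ) : ℂ) with hlm
  set lp : ℂ := ((Real.log (1 + x) : ℝ) : ℂ) with hlp
  refine h.of_const_mul (Complex.exp (-l2 * ν + lm * (μ / 2) - lp * (μ / 2 - ν) -
    (lm - lp) * (-ν / 2)) / √Real.pi) (fun n => ?_) ?_
  · have hL := poch_mul_legendreP_self hx0 hx1 μ ν n
    have hG := calGHat_eq (sqrt_ratio_ne_zero hx0 hx1)
      (by rw [sqrt_ratio_sq hx0 hx1]; exact norm_ratio_lt_one hx0 hx1) μ ν n
    rw [inv_sqrt_ratio_pow hx0 hx1, sqrt_ratio_sq hx0 hx1] at hG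
    rw [ratio_cpow hx0 hx1, hG]
    simp only [← hl2, ← hlm, ← hlp] at hL ⊢
    have key : Complex.exp (-((lm - lp) / 2 * n)) * Complex.exp (-l2 * ν +
        lm * ((μ + n) / 2) - lp * ((μ + n) / 2 - ν)) /
        Complex.exp ((lm - lp) * (-ν / 2)) = Complex.exp (-l2 * ν + lm * (μ / 2) -
        lp * (μ / 2 - ν) - (lm - lp) * (-ν / 2)) := by
      rw [← Complex.exp_add, ← Complex.exp_sub]; congr 1; ring
    rw [← key]
    linear_combination (Complex.exp (-((lm - lp) / 2 * n)) *
      coeff n (eulerSeries ((1 - x) / (1 + x) : ℝ) μ ν) /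
      (√Real.pi * Complex.exp ((lm - lp) * (-ν / 2)))) * hL
  · have hL := poch_mul_legendreP_inv_div hx0 hx1 μ ν 0
    simp only [poch_zero, Nat.cast_zero, add_zero, mul_zero, Complex.exp_zero, one_mul] at hL
    rw [eulerExpansionSum, one_sub_sq_cpow hx0 hx1, one_sub_ratio_cpow hx0 hx1, two_cpow_eq_exp,
      two_cpow_eq_exp, ofReal_cpow_eq_exp hx0]
    simp only [← hl2, ← hlx, ← hlm, ← hlp] at hL ⊢
    have key : Complex.exp ((lm + lp) * ((μ + ν) / 4)) * Complex.exp (-l2 * ((μ - ν - 2) / 2) +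
        (lm - lx) * ((μ + ν) / 2 / 2) - (lp - lx) * ((μ + ν) / 2 / 2 - (μ - ν - 2) / 2)) /
        (Complex.exp (l2 * ((3 * μ - ν) / 2)) * Complex.exp (lx * ((μ - ν) / 2))) =
        Complex.exp (-l2 * ν + lm * (μ / 2) - lp * (μ / 2 - ν) -
        (lm - lp) * (-ν / 2)) * (Complex.exp ((l2 + lx - lp) * (1 - (μ - ν))) *
        Complex.exp (l2 * -(μ - ν))) := by
      simp only [← Complex.exp_add, ← Complex.exp_sub]; congr 1; ring
    have hpi := mul_inv_cancel₀ sqrt_pi_ne_zero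
    linear_combination (Complex.exp ((lm + lp) * ((μ + ν) / 4)) /
      (Complex.exp (l2 * ((3 * μ - ν) / 2)) * Complex.exp (lx * ((μ - ν) / 2)))) * hL +
      quadraticMoment ((1 - x) / (1 + x) : ℝ) μ ν 0 * key -
      Complex.exp (-l2 * ν + lm * (μ / 2) - lp * (μ / 2 - ν) -
        (lm - lp) * (-ν / 2)) * (Complex.exp ((l2 + lx - lp) * (1 - (μ - ν))) *
        Complex.exp (l2 * -(μ - ν))) * quadraticMoment ((1 - x) / (1 + x) : ℝ) μ ν 0 * hpi

theorem seriesTo_legendreP_inv_inverse (hx0 : 0 < x) (hx1 : x < 1) {μ ν : ℂ}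
    (h : SeriesTo (fun n => coeff n (quadraticInvSeries (1 / (1 + x)) (1 - x ^ 2) μ ν) *
      quadraticMoment (-((1 - x) / (1 + x) : ℝ)) μ ν n)
      (quadraticExpansionSum (-((1 - x) / (1 + x) : ℝ)) μ ν)) :
    SeriesTo
      (fun n : ℕ =>
        poch (μ - ν) n * frakNMinus n ν μ x
          * (((1 - x ^ 2 : ℝ) : ℂ) ^ ((μ - ν + n) / 4)
              * legendreP ((μ - ν - 2 + n) / 2) ((μ + ν + n) / 2) x
            / ((2 : ℂ) ^ ((3 * μ - ν + n) / 2) * Complex.Gamma ((μ - ν + n + 1) / 2))))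
      (legendreP ν μ (1 / x) / (√Real.pi : ℂ)) := by
  have h1 : 0 < 1 - x := by linarith
  have h2 : 0 < 1 + x := by linarith
  set l2 : ℂ := ((Real.log 2 : ℝ) : ℂ) with hl2
  set lx : ℂ := ((Real.log x : ℝ) : ℂ) with hlx
  set lm : ℂ := ((Real.log (1 - x) : ℝ) : ℂ) with hlm
  set lp : ℂ := ((Real.log (1 + x) : ℝ) : ℂ) with hlp
  have hX : ((1 + x⁻¹ : ℝ) : ℂ) ^ ν = Complex.exp ((lp - lx) * ν) := by
    rw [show 1 + x⁻¹ = (1 + x) / x by field_simp; ring, ofReal_cpow_eq_exp (by positivity),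
      Real.log_div h2.ne' hx0.ne']; push_cast; rfl
  refine h.of_const_mul (Complex.exp (lm * (μ / 2) + lp * (μ / 2 - 1) - lx * ν +
    l2 * (1 - 2 * μ + ν))) (fun n => ?_) ?_
  · have hL := poch_mul_legendreP_self_div hx0 hx1 μ ν n
    have hS := inv_sqrt_pow (r := 1 - x ^ 2) (by nlinarith) n
    rw [show 1 - x ^ 2 = (1 - x) * (1 + x) by ring, Real.log_mul h1.ne' h2.ne',
      ← show 1 - x ^ 2 = (1 - x) * (1 + x) by ring, Complex.ofReal_add] at hS
    rw [frakNMinus_eq hx0 hx1, one_sub_sq_cpow hx0 hx1, two_cpow_eq_exp, hX, hS]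
    simp only [← hl2, ← hlm, ← hlp] at hL ⊢
    have key : Complex.exp ((lp - lx) * ν) * Complex.exp (-((lm + lp) / 2 * n)) *
        Complex.exp ((lm + lp) * ((μ - ν + n) / 4)) *
        (Complex.exp (-l2 * ((μ - ν - 2 + n) / 2) + lm * ((μ + ν + n) / 2 / 2) -
          lp * ((μ + ν + n) / 2 / 2 - (μ - ν - 2 + n) / 2)) * Complex.exp (l2 * n)) /
        Complex.exp (l2 * ((3 * μ - ν + n) / 2)) =
        Complex.exp (lm * (μ / 2) + lp * (μ / 2 - 1) - lx * ν + l2 * (1 - 2 * μ + ν)) := by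
      simp only [← Complex.exp_add, ← Complex.exp_sub]; congr 1; ring
    rw [← key]
    linear_combination (Complex.exp ((lp - lx) * ν) * Complex.exp (-((lm + lp) / 2 * n)) *
      Complex.exp ((lm + lp) * ((μ - ν + n) / 4)) / Complex.exp (l2 * ((3 * μ - ν + n) / 2)) *
      coeff n (quadraticInvSeries (1 / (1 + x)) (1 - x ^ 2) μ ν)) * hL
  · have hL := poch_mul_legendreP_inv hx0 hx1 μ ν 0
    simp only [poch_zero, Nat.cast_zero, add_zero, one_mul] at hL
    rw [quadraticExpansionSum, one_add_ratio_cpow hx0 hx1, two_cpow_eq_exp, hL]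
    simp only [← hl2, ← hlx, ← hlm, ← hlp]
    have key : Complex.exp (-l2 * ν + (lm - lx) * (μ / 2) - (lp - lx) * (μ / 2 - ν)) =
        Complex.exp (lm * (μ / 2) + lp * (μ / 2 - 1) - lx * ν + l2 * (1 - 2 * μ + ν)) *
        (Complex.exp ((l2 - lp) * (μ - ν - 1)) * Complex.exp (l2 * (μ - ν))) := by
      simp only [← Complex.exp_add]; congr 1; ring
    rw [key]
    ring

theorem seriesTo_legendreP_self_inverse (hx0 : 0 < x) (hx1 : x < 1) {μ ν : ℂ}
    (h : SeriesTo (fun n => coeff n (quadraticInvSeries (x / (1 + x)) (1 - (x ^ 2 : ℂ)⁻¹) μ ν) *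
      quadraticMoment ((1 - x) / (1 + x) : ℝ) μ ν n)
      (quadraticExpansionSum ((1 - x) / (1 + x) : ℝ) μ ν)) :
    SeriesTo
        (fun n : ℕ =>
          poch (μ - ν) n * frakNPlus n ν μ x
            * (((1 - x ^ 2 : ℝ) : ℂ) ^ ((μ - ν + n) / 4)
                * legendreP ((μ - ν + n - 2) / 2) ((μ + ν + n) / 2) (1 / x)
              / ((2 : ℂ) ^ ((3 * μ - ν + n) / 2) * Complex.Gamma ((μ - ν + n + 1) / 2)
                * (x : ℂ) ^ ((μ - ν + n) / 2))))
        (legendreP ν μ x / (√Real.pi : ℂ)) := by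
  have h1 : 0 < 1 - x := by linarith
  have h2 : 0 < 1 + x := by linarith
  set l2 : ℂ := ((Real.log 2 : ℝ) : ℂ) with hl2
  set lx : ℂ := ((Real.log x : ℝ) : ℂ) with hlx
  set lm : ℂ := ((Real.log (1 - x) : ℝ) : ℂ) with hlm
  set lp : ℂ := ((Real.log (1 + x) : ℝ) : ℂ) with hlp
  have hX : ((1 + x : ℝ) : ℂ) ^ ν = Complex.exp (lp * ν) := ofReal_cpow_eq_exp h2 ν
  refine h.of_const_mul (Complex.exp (lm * (μ / 2) + lp * (μ / 2 - 1) + lx * (1 - (μ - ν)) +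
    l2 * (1 - 2 * μ + ν))) (fun n => ?_) ?_
  · have hL := poch_mul_legendreP_inv_div hx0 hx1 μ ν n
    have e : (x ^ 2)⁻¹ - 1 = (1 - x) * (1 + x) / x ^ 2 := by field_simp; ring
    have hS := inv_sqrt_pow (r := (x ^ 2)⁻¹ - 1) (by rw [e]; positivity) n
    have hlog : ((Real.log ((x ^ 2)⁻¹ - 1) : ℝ) : ℂ) = lm + lp - 2 * lx := by
      rw [e, Real.log_div (by positivity) (by positivity), Real.log_mul h1.ne' h2.ne', Real.log_pow]
      push_cast; rfl
    rw [hlog] at hS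
    rw [frakNPlus_eq hx0 hx1, one_sub_sq_cpow hx0 hx1, two_cpow_eq_exp, ofReal_cpow_eq_exp hx0, hX,
      hS, show μ - ν + n - 2 = μ - ν - 2 + n by ring]
    simp only [← hl2, ← hlx, ← hlm, ← hlp] at hL ⊢
    have key : Complex.exp (lp * ν) * Complex.exp (-((lm + lp - 2 * lx) / 2 * n)) *
        Complex.exp ((lm + lp) * ((μ - ν + n) / 4)) *
        (Complex.exp (-l2 * ((μ - ν - 2 + n) / 2) + (lm - lx) * ((μ + ν + n) / 2 / 2) -
          (lp - lx) * ((μ + ν + n) / 2 / 2 - (μ - ν - 2 + n) / 2)) * Complex.exp (l2 * n)) /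
        (Complex.exp (l2 * ((3 * μ - ν + n) / 2)) * Complex.exp (lx * ((μ - ν + n) / 2))) =
        Complex.exp (lm * (μ / 2) + lp * (μ / 2 - 1) + lx * (1 - (μ - ν)) +
          l2 * (1 - 2 * μ + ν)) := by
      simp only [← Complex.exp_add, ← Complex.exp_sub]; congr 1; ring
    rw [← key]
    linear_combination (Complex.exp (lp * ν) * Complex.exp (-((lm + lp - 2 * lx) / 2 * n)) *
      Complex.exp ((lm + lp) * ((μ - ν + n) / 4)) / (Complex.exp (l2 * ((3 * μ - ν + n) / 2)) *
        Complex.exp (lx * ((μ - ν + n) / 2))) *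
      coeff n (quadraticInvSeries (x / (1 + x)) (1 - (x ^ 2 : ℂ)⁻¹) μ ν)) * hL
  · have hL := poch_mul_legendreP_self hx0 hx1 μ ν 0
    simp only [poch_zero, Nat.cast_zero, add_zero, one_mul] at hL
    rw [quadraticExpansionSum, one_sub_ratio_cpow hx0 hx1, two_cpow_eq_exp, hL]
    simp only [← hl2, ← hlx, ← hlm, ← hlp]
    have key : Complex.exp (-l2 * ν + lm * (μ / 2) - lp * (μ / 2 - ν)) =
        Complex.exp (lm * (μ / 2) + lp * (μ / 2 - 1) + lx * (1 - (μ - ν)) +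
          l2 * (1 - 2 * μ + ν)) *
        (Complex.exp ((l2 + lx - lp) * (μ - ν - 1)) * Complex.exp (l2 * (μ - ν))) := by
      simp only [← Complex.exp_add]; congr 1; ring
    rw [key]
    ring

/-- For t = -q one gets κ = 1-x² in (0,1), which is why this expansion is unconditional. -/
lemma quadratic_params_neg (hx0 : 0 < x) :
    (1 / (1 + x) : ℂ) = (1 - -((1 - x) / (1 + x) : ℝ)) / 2 ∧
    (1 - x ^ 2 : ℂ) = -4 * -((1 - x) / (1 + x) : ℝ) / (1 - -((1 - x) / (1 + x) : ℝ)) ^ 2 := by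
  have h2 : (1 + x : ℂ) ≠ 0 := by exact_mod_cast (show (1 + x : ℝ) ≠ 0 by linarith)
  have e : (1 - -((1 - x) / (1 + x) : ℝ) : ℂ) = 2 / (1 + x) := by
    push_cast; field_simp; ring
  rw [e]
  constructor
  · ring
  · push_cast; field_simp; ring

/-- For t = q one gets κ = 1-1/x², negative, with |κ| < 1 exactly when x > 1/√2 and κ = -1 at
equality. -/
lemma quadratic_params_pos (hx0 : 0 < x) :
    (x / (1 + x) : ℂ) = (1 - ((1 - x) / (1 + x) : ℝ)) / 2 ∧
    (1 - (x ^ 2 : ℂ)⁻¹) = -4 * ((1 - x) / (1 + x) : ℝ) / (1 - ((1 - x) / (1 + x) : ℝ)) ^ 2 := by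
  have h2 : (1 + x : ℂ) ≠ 0 := by exact_mod_cast (show (1 + x : ℝ) ≠ 0 by linarith)
  have h3 : (x : ℂ) ≠ 0 := by exact_mod_cast hx0.ne'
  have e : (1 - ((1 - x) / (1 + x) : ℝ) : ℂ) = 2 * x / (1 + x) := by
    push_cast; field_simp; ring
  rw [e]
  constructor
  · ring
  · push_cast; field_simp; ring

end expansions

theorem theorem8 (μ ν : ℂ) (x : ℝ) (hx0 : 0 < x) (hx1 : x < 1) :
    ((-1 < ν.re ∨ ∃ k : ℕ, ν - μ = k) →
      SeriesTo
        (fun n : ℕ =>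
          poch (μ - ν) n * calG n (-ν) μ ((√((1 - x) / (1 + x)) : ℝ) : ℂ)
            / ((√Real.pi : ℂ) * (((1 - x) / (1 + x) : ℝ) : ℂ) ^ (-ν / 2))
            * legendreP ν (μ + n) (1 / x))
        (((1 - x ^ 2 : ℝ) : ℂ) ^ ((μ + ν) / 4) * legendreP ((μ - ν - 2) / 2) ((μ + ν) / 2) x
          / ((2 : ℂ) ^ ((3 * μ - ν) / 2) * (x : ℂ) ^ ν * Complex.Gamma ((μ - ν + 1) / 2)))) ∧
    SeriesTo
      (fun n : ℕ =>
        poch (μ - ν) n * frakNMinus n ν μ x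
          * (((1 - x ^ 2 : ℝ) : ℂ) ^ ((μ - ν + n) / 4)
              * legendreP ((μ - ν - 2 + n) / 2) ((μ + ν + n) / 2) x
            / ((2 : ℂ) ^ ((3 * μ - ν + n) / 2) * Complex.Gamma ((μ - ν + n + 1) / 2))))
      (legendreP ν μ (1 / x) / (√Real.pi : ℂ)) ∧
    ((1 / √2 < x ∨ (x = 1 / √2 ∧ -(5 / 2) < ν.re) ∨ ∃ k : ℕ, ν - μ = k) →
      SeriesTo
        (fun n : ℕ =>
          poch (μ - ν) n * frakNPlus n ν μ x
            * (((1 - x ^ 2 : ℝ) : ℂ) ^ ((μ - ν + n) / 4)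
                * legendreP ((μ - ν + n - 2) / 2) ((μ + ν + n) / 2) (1 / x)
              / ((2 : ℂ) ^ ((3 * μ - ν + n) / 2) * Complex.Gamma ((μ - ν + n + 1) / 2)
                * (x : ℂ) ^ ((μ - ν + n) / 2))))
        (legendreP ν μ x / (√Real.pi : ℂ))) ∧
    (-1 < ν.re →
      SeriesTo
        (fun n : ℕ =>
          poch (μ - ν) n * calGHat n (-ν) μ ((√((1 - x) / (1 + x)) : ℝ) : ℂ)
            / ((√Real.pi : ℂ) * (((1 - x) / (1 + x) : ℝ) : ℂ) ^ (-ν / 2))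
            * legendreP ν (μ + n) x)
        (((1 - x ^ 2 : ℝ) : ℂ) ^ ((μ + ν) / 4) * legendreP ((μ - ν - 2) / 2) ((μ + ν) / 2) (1 / x)
          / ((2 : ℂ) ^ ((3 * μ - ν) / 2) * (x : ℂ) ^ ((μ - ν) / 2)
            * Complex.Gamma ((μ - ν + 1) / 2)))) := by
  have hq := abs_ratio_lt_one hx0 hx1
  have hq' : |-((1 - x) / (1 + x))| < 1 := by rwa [abs_neg]
  refine ⟨fun h => seriesTo_legendreP_inv hx0 hx1 ?_, seriesTo_legendreP_inv_inverse hx0 hx1 ?_,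
    fun h => seriesTo_legendreP_self_inverse hx0 hx1 ?_,
    fun h => seriesTo_legendreP_self hx0 hx1 (seriesTo_eulerMoment hq μ ν h)⟩
  · rw [← Complex.ofReal_neg]
    rcases h with h | ⟨k, hk⟩
    · exact seriesTo_eulerMoment hq' μ ν h
    · exact seriesTo_eulerMoment_of_terminating hq' hk
  · obtain ⟨hθ, hκ⟩ := quadratic_params_neg hx0
    rw [← Complex.ofReal_neg] at hθ hκ ⊢
    refine seriesTo_quadraticMoment hq' hκ hθ ?_ μ ν
    rw [show (1 - x ^ 2 : ℂ) = ((1 - x ^ 2 : ℝ) : ℂ) by push_cast; rfl, Complex.norm_real,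
      Real.norm_eq_abs, abs_lt]
    constructor <;> nlinarith
  · obtain ⟨hθ, hκ⟩ := quadratic_params_pos hx0
    have hs : 0 < 1 / √2 := by positivity
    have hs2 : (1 / √2) ^ 2 = 1 / 2 := by rw [div_pow, Real.sq_sqrt zero_le_two, one_pow]
    rcases h with h | ⟨h, hν⟩ | ⟨k, hk⟩
    · refine seriesTo_quadraticMoment hq hκ hθ ?_ μ ν
      have h2 : 1 / 2 < x ^ 2 := by nlinarith
      have h3 : (x ^ 2)⁻¹ < 2 := by
        rw [inv_lt_comm₀ (by positivity) two_pos]; linarith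
      have h4 : 0 < (x ^ 2)⁻¹ := by positivity
      rw [show (1 - (x ^ 2 : ℂ)⁻¹) = ((1 - (x ^ 2)⁻¹ : ℝ) : ℂ) by push_cast; rfl, Complex.norm_real,
        Real.norm_eq_abs, abs_lt]
      constructor <;> linarith
    · have h2 : (1 - (x ^ 2 : ℂ)⁻¹) = -1 := by
        have : (x ^ 2 : ℂ) = ((1 / 2 : ℝ) : ℂ) := by rw [← Complex.ofReal_pow, h, hs2]
        rw [this]; push_cast; norm_num
      rw [h2] at hκ ⊢
      exact seriesTo_quadraticMoment_critical hq hκ hθ μ ν hν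
    · rw [hθ, hκ]
      exact seriesTo_quadraticMoment_of_terminating hq hk

end
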